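/- Let $S^1=\mathbb R/2\pi\mathbb Z$ with arc length, $X=L^2(S^1;\mathbb R)$ with inner product $\langle\cdot,\cdot\rangle$ and norm $|\cdot|$, and $X^+=\{f\in X: f\ge 0\text{ a.e.}\}$. Let $\rho>0$, $\sigma\in C^1(S^1;(0,\infty))$, $\delta\in C(S^1;[0,\infty))$, let $\gamma:S^1\to(0,1)\cup(1,\infty)$ be measurable with values in a compact subset of $(0,1)$ or in a compact subset of $(1,\infty)$, and let $a:S^1\to(1,\infty)$, $\eta:S^1\to(0,\infty)$, $w:S^1\to[0,\infty)$ be measurable and bounded, with $w$ not a.e. zero. Assume also that $(a-1)^{(1-\gamma)/\gamma}\,\eta^{-1/\gamma}\in L^2(S^1)$ (which holds, for instance, if $\inf\eta>0$ and $\inf a>1$). Let $\mathcal A\varphi=(\sigma\varphi')'-\delta\varphi$ with $D(\mathcal A)=W^{2,2}(S^1)$, and let $p_0\in X^+$. The admissible controls are the $i\in L^1_{loc}([0,\infty);X^+)$ with $\int_0^\infty e^{-\rho t}|\eta\, i(t)|\,dt<\infty$. The trajectory of $i$ is the mild solution $p^i(t)=e^{t\mathcal A}p_0+\int_0^t e^{(t-r)\mathcal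 A}\,\eta\, i(r)\,dr$ of $p'=\mathcal Ap+\eta i$, $p(0)=p_0$, and the planner maximizes over the admissible controls $$J(p_0;i)=\int_0^\infty e^{-\rho t}\Big(\int_{S^1}\frac{((a(\theta)-1)\,i(t,\theta))^{1-\gamma(\theta)}}{1-\gamma(\theta)}\,d\theta-\langle w,p^i(t)\rangle\Big)dt ,$$ an extended real number, where the utility is $-\infty$ at $i(t,\theta)=0$ if $\gamma(\theta)>1$. Then $\mathcal A$ generates a unique $C_0$-semigroup on $X$. The equation $(\rho-\mathcal A)\alpha=w$ has a unique solution $\alpha\in D(\mathcal A)$, and $\alpha>0$ a.e. For every admissible control the trajectory is continuous on $[0,\infty)$ and stays in $X^+$, and the integrals defining $J$ are well defined in $[-\infty,\infty]$. Moreover: (1) The control that is constant in time and equal to $$i^*(\theta)=\frac1{a(\theta)-1}\Big(\frac{\eta(\theta)\,\alpha(\theta)}{a(\theta)-1}\Big)^{-1/\gamma(\theta)}\qquad\text{for a.e. }\theta\in S^1$$ belongs to $X$, is admissible and is optimal. Every optimal control equals $i^*$ for a.e. $t\ge0$. (2) The optimal trajectory $p^*$ is the unique solution of $$\partial_t p=\partial_\theta(\sigma\,\partial_\theta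 p)-\delta p+\eta\, i^*,\qquad p(0,\cdot)=p_0,$$ that is, the unique $p\in C([0,\infty);X)$ with $p(0)=p_0$ that at each $t>0$ is differentiable in $X$, has $p(t)\in W^{2,2}(S^1)$, and satisfies $p'(t)=\mathcal Ap(t)+\eta i^*$. (3) The optimal welfare is $\sup_i J(p_0;i)=J(p_0;i^*)=-\langle\alpha,p_0\rangle+q$, where $$q=\frac1\rho\int_{S^1}\sup_{v\ge0}\Big\{\frac{((a(\theta)-1)v)^{1-\gamma(\theta)}}{1-\gamma(\theta)}-\eta(\theta)\,v\,\alpha(\theta)\Big\}\,d\theta$$ is finite. -/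

import Mathlib

open MeasureTheory Filter Topology Set

noncomputable section

namespace Pollution

instance factTwoPiPos : Fact ((0 : ℝ) < 2 * Real.pi) := ⟨Real.two_pi_pos⟩

/-- The unit circle, parametrised by the angle; `volume` is arc length, of total mass `2π`. -/
abbrev Circ : Type := AddCircle (2 * Real.pi)

/-- The state and control space `X = L²(S¹; ℝ)`. -/
abbrev X : Type := Lp ℝ 2 (volume : Measure Circ)

/-! ### Functions on the circle and weak derivatives -/

/-- `f` is of class `Cⁿ` on the circle: its `2π`-periodic lift to `ℝ` is of class `Cⁿ`. -/
def CircContDiff (n : WithTop ℕ∞) (f : Circ → ℝ) : Prop :=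
  ContDiff ℝ n (fun t : ℝ => f (t : Circ))

/-- The angular derivative of a function on the circle. -/
def circDeriv (f : Circ → ℝ) (θ : Circ) : ℝ :=
  deriv (fun s : ℝ => f (θ + (s : Circ))) 0

/-- `g` is the weak derivative of `f` on the circle (meant for square integrable `f`, `g`). -/
def HasWeakDeriv (f g : Circ → ℝ) : Prop :=
  ∀ φ : Circ → ℝ, CircContDiff ((⊤ : ℕ∞) : WithTop ℕ∞) φ →
    ∫ θ, f θ * circDeriv φ θ = -∫ θ, g θ * φ θ

/-- `f ∈ W^{2,2}(S¹)`. -/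
def MemW22 (f : X) : Prop :=
  ∃ f₁ f₂ : X, HasWeakDeriv f f₁ ∧ HasWeakDeriv f₁ f₂

/-- The graph of the operator `𝒜 f = (σ f')' - δ f` with domain `W^{2,2}(S¹)`:
`opGraph σ δ f h` says that `f ∈ W^{2,2}(S¹)` and `𝒜 f = h`. -/
def opGraph (σ δ : Circ → ℝ) (f h : X) : Prop :=
  MemW22 f ∧ ∃ f₁ : X, HasWeakDeriv f f₁ ∧
    HasWeakDeriv (fun θ => σ θ * f₁ θ) (fun θ => h θ + δ θ * f θ)

open Classical in
/-- The class in `X` of a square integrable function (`0` if `f` is not square integrable). -/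
def toX (f : Circ → ℝ) : X :=
  if h : MemLp f 2 volume then h.toLp f else 0

/-- Pointwise multiplication of an element of `X` by a (bounded measurable) function. -/
def mulX (m : Circ → ℝ) (f : X) : X := toX (fun θ => m θ * f θ)

/-! ### Semigroups and mild solutions -/

/-- `S` is a `C₀`-semigroup of bounded linear operators on `X`. -/
structure IsC0Semigroup (S : NNReal → X →L[ℝ] X) : Prop where
  zero : S 0 = ContinuousLinearMap.id ℝ X
  add : ∀ s t, S (s + t) = (S s).comp (S t)
  tendsto : ∀ f : X, Tendsto (fun t => S t f) (𝓝[>] 0) (𝓝 f)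

/-- `G` is the graph of the infinitesimal generator of `S`. -/
def IsGenerator (S : NNReal → X →L[ℝ] X) (G : X → X → Prop) : Prop :=
  ∀ f h : X, G f h ↔
    Tendsto (fun t : NNReal => (t : ℝ)⁻¹ • (S t f - f)) (𝓝[>] 0) (𝓝 h)

/-- The `C₀`-semigroup `S` is generated by `𝒜 f = (σ f')' - δ f`, `D(𝒜) = W^{2,2}(S¹)`. -/
def IsPollutionSemigroup (σ δ : Circ → ℝ) (S : NNReal → X →L[ℝ] X) : Prop :=
  IsC0Semigroup S ∧ IsGenerator S (opGraph σ δ)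

/-- The mild solution `y(t) = S(t) x + ∫₀ᵗ S(t - r) (η u(r)) dr` of
`y' = 𝒜 y + η u`, `y(0) = x`, at times `t ≥ 0`. -/
def trajectory (S : NNReal → X →L[ℝ] X) (η : Circ → ℝ) (x : X) (u : ℝ → X) (t : ℝ) : X :=
  S t.toNNReal x + ∫ r in (0 : ℝ)..t, S (t - r).toNNReal (mulX η (u r))

/-- `p` solves `∂ₜ p = (σ p_θ)_θ - δ p + f` for `t > 0`, with `p(0) = x`: the function `p` is
continuous on `[0, ∞)` with values in `L²(S¹)`, and at every `t > 0` it is differentiable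
in `L²(S¹)`, lies in `W^{2,2}(S¹)` and satisfies the equation `p'(t) - f = 𝒜 p(t)`. -/
def SolvesPDE (σ δ : Circ → ℝ) (f x : X) (p : ℝ → X) : Prop :=
  ContinuousOn p (Ici 0) ∧ p 0 = x ∧
    ∀ t : ℝ, 0 < t → ∃ d : X, HasDerivAt p d t ∧ opGraph σ δ (p t) (d - f)

/-! ### The objective functional -/

/-- The integral of an extended real valued function: integral of the positive part minus
integral of the negative part (see `HasEIntegral` for when it is well defined). -/
def eintegral {Ω : Type*} [MeasurableSpace Ω] (μ : Measure Ω) (f : Ω → EReal) : EReal :=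
  ((∫⁻ x, (f x).toENNReal ∂μ : ENNReal) : EReal) - ((∫⁻ x, (-f x).toENNReal ∂μ : ENNReal) : EReal)

/-- The extended integral of `f` is well defined, i.e. not of the form `∞ - ∞`. -/
def HasEIntegral {Ω : Type*} [MeasurableSpace Ω] (μ : Measure Ω) (f : Ω → EReal) : Prop :=
  AEMeasurable f μ ∧ (∫⁻ x, (f x).toENNReal ∂μ ≠ ⊤ ∨ ∫⁻ x, (-f x).toENNReal ∂μ ≠ ⊤)

/-- The utility `c^{1-γ}/(1-γ)` of a consumption `c ≥ 0`; it is `-∞` at `c = 0` if `γ > 1`. -/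
def crra (γ c : ℝ) : EReal :=
  if c = 0 ∧ 1 < γ then ⊥ else ((c ^ (1 - γ) / (1 - γ) : ℝ) : EReal)

/-- The utility from consumption `Ψ(u) = ∫_{S¹} ((a - 1) u)^{1-γ}/(1-γ) dθ`. -/
def utility (γ a : Circ → ℝ) (u : X) : EReal :=
  eintegral volume (fun θ => crra (γ θ) ((a θ - 1) * u θ))

/-- The discounted running payoff `e^{-ρt} (Ψ(u(t)) - ⟨w, y(t)⟩)`. -/
def payoff (ρ : ℝ) (w γ a : Circ → ℝ) (u y : ℝ → X) (t : ℝ) : EReal :=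
  (Real.exp (-ρ * t) : EReal) * (utility γ a (u t) - ((inner ℝ (toX w) (y t) : ℝ) : EReal))

/-- The objective functional
`J(x; u) = ∫₀^∞ e^{-ρt} (Ψ(u(t)) - ⟨w, y^{x,u}(t)⟩) dt`. -/
def objective (S : NNReal → X →L[ℝ] X) (ρ : ℝ) (η w γ a : Circ → ℝ) (x : X) (u : ℝ → X) : EReal :=
  eintegral (volume.restrict (Ici 0)) (payoff ρ w γ a u (trajectory S η x u))

/-- Admissible controls: `u ∈ L¹_loc([0, ∞); X⁺)` with `∫₀^∞ e^{-ρt} ‖η u(t)‖ dt < ∞`. -/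
structure Admissible (ρ : ℝ) (η : Circ → ℝ) (u : ℝ → X) : Prop where
  locallyIntegrable : LocallyIntegrableOn u (Ici 0)
  nonneg : ∀ᵐ t ∂(volume.restrict (Ici (0 : ℝ))), 0 ≤ u t
  integrable : IntegrableOn (fun t => Real.exp (-ρ * t) * ‖mulX η (u t)‖) (Ici 0)

/-- The value function `V(x) = sup_u J(x; u)`. -/
def value (S : NNReal → X →L[ℝ] X) (ρ : ℝ) (η w γ a : Circ → ℝ) (x : X) : EReal :=
  ⨆ (u : ℝ → X) (_ : Admissible ρ η u), objective S ρ η w γ a x u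

/-- `u` is an optimal control from the initial state `x`. -/
def IsOptimal (S : NNReal → X →L[ℝ] X) (ρ : ℝ) (η w γ a : Circ → ℝ) (x : X) (u : ℝ → X) : Prop :=
  Admissible ρ η u ∧
    ∀ v, Admissible ρ η v → objective S ρ η w γ a x v ≤ objective S ρ η w γ a x u

/-! ### The explicit solution -/

/-- `α ∈ D(𝒜)` solves `(ρ - 𝒜) α = w`. -/
def SolvesElliptic (σ δ : Circ → ℝ) (ρ : ℝ) (w : Circ → ℝ) (α : X) : Prop :=
  opGraph σ δ α (ρ • α - toX w)

/-- The investment profile `i*(θ) = (a(θ) - 1)⁻¹ (η(θ) α(θ) / (a(θ) - 1))^{-1/γ(θ)}`. -/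
def optInvestment (η γ a : Circ → ℝ) (α : X) (θ : Circ) : ℝ :=
  (a θ - 1)⁻¹ * (η θ * α θ / (a θ - 1)) ^ (-1 / γ θ)

/-- The constant
`q = (1/ρ) ∫_{S¹} sup_{v ≥ 0} { ((a - 1) v)^{1-γ}/(1-γ) - η v α } dθ`. -/
def qConst (ρ : ℝ) (η γ a : Circ → ℝ) (α : X) : EReal :=
  ((1 / ρ : ℝ) : EReal) * eintegral volume (fun θ =>
    ⨆ v : NNReal, crra (γ θ) ((a θ - 1) * v) - ((η θ * v * α θ : ℝ) : EReal))

end Pollution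

end

open Pollution

noncomputable section

set_option linter.unusedSectionVars false

namespace Pollution

/-! ### Exponentials of bounded nonpositive symmetric operators -/

section BoundedExp

variable {H : Type*} [NormedAddCommGroup H] [InnerProductSpace ℝ H] [CompleteSpace H]

/-! The state enters the objective linearly, so its cost can be computed once and for all. The
operator $\mathcal A$ is self-adjoint and nonpositive, hence the Laplace transform at $\rho$ of its
semigroup is the resolvent $(\rho-\mathcal A)^{-1}$, which is symmetric. With $\alpha=(\rho-\mathcal
A)^{-1}w$ this gives $\int_0^\infty e^{-\rho t}\langle
w,p^i(t)\rangle\,dt=\langle\alpha,p_0\rangle+\int_0^\infty e^{-\rho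
t}\langle\alpha,\eta\,i(t)\rangle\,dt$ (`laplace_mild`, `integrable_part`). The dynamics have
disappeared: what remains is to maximize $c^{1-\gamma}/(1-\gamma)-mc$ over $c\ge0$ for each $t$ and
$\theta$, with $c=(a-1)i$ and price $m=\eta\alpha/(a-1)>0$. Strict concavity gives the unique
maximizer $c=m^{-1/\gamma}$, which is $i^*$.

To handle infinite values, the utility is split as $\text{maxUtil}+mc-\text{loss}$ with
$\text{loss}\in[0,\infty]$ vanishing only at the maximizer (`crra_eq_sub_loss`, `loss_eq_zero_iff`).
An integrable function minus a nonnegative one always has an extended integral, and `objective_eq`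
becomes $J=-\langle\alpha,p_0\rangle+q-\int_0^\infty e^{-\rho t}\,\text{totalLoss}\,dt$.
Well-posedness, optimality, uniqueness and the value are all read off from this formula.

Two ingredients remain. An abstract one: a nonpositive self-adjoint graph generates exactly one
$C_0$-semigroup, of symmetric contractions, which maps $X$ into the domain at positive times; it is
built from Yosida approximations. A concrete one: $\mathcal A$ is such an operator (Lax-Milgram on
the graph of the weak derivative, see `opGraph_surj`), and its resolvents preserve nonnegativity,
with $\alpha$ bounded away from zero (`elliptic_nonneg`, `elliptic_pos`). Positivity of the
semigroup follows from that of the resolvents. -/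

lemma hasDerivAt_exp_smul_apply (A : H →L[ℝ] H) (f : H) (t : ℝ) :
    HasDerivAt (fun s : ℝ => NormedSpace.exp (s • A) f) (A (NormedSpace.exp (t • A) f)) t := by
  have h := (hasDerivAt_exp_smul_const' (𝕂 := ℝ) A t)
  exact ((ContinuousLinearMap.apply ℝ H f).hasFDerivAt.comp_hasDerivAt t h)

lemma commute_exp_smul (A B : H →L[ℝ] H) (h : Commute B A) (t : ℝ) :
    Commute B (NormedSpace.exp (t • A)) :=
  (h.smul_right t).exp_right

lemma exp_add_smul (A : H →L[ℝ] H) (s t : ℝ) :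
    NormedSpace.exp ((s + t) • A) = NormedSpace.exp (s • A) * NormedSpace.exp (t • A) := by
  let _ : NormedAlgebra ℚ (H →L[ℝ] H) := NormedAlgebra.restrictScalars ℚ ℝ _
  rw [add_smul]
  exact NormedSpace.exp_add_of_commute (((Commute.refl A).smul_left s).smul_right t)

lemma inner_exp_smul_symm (A : H →L[ℝ] H) (hs : ∀ f g, inner ℝ (A f) g = inner ℝ f (A g))
    (t : ℝ) (f g : H) :
    inner ℝ (NormedSpace.exp (t • A) f) g = inner ℝ f (NormedSpace.exp (t • A) g) := by
  have hA : IsSelfAdjoint A := by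
    rw [ContinuousLinearMap.isSelfAdjoint_iff_isSymmetric]
    exact fun x y => hs x y
  have h : IsSelfAdjoint (NormedSpace.exp (t • A)) :=
    IsSelfAdjoint.exp (((IsSelfAdjoint.all t)).smul hA)
  rw [ContinuousLinearMap.isSelfAdjoint_iff_isSymmetric] at h
  exact h f g

lemma hasDerivAt_norm_sq {u : ℝ → H} {u' : H} {t : ℝ} (h : HasDerivAt u u' t) :
    HasDerivAt (fun s => ‖u s‖ ^ 2) (2 * inner ℝ u' (u t)) t := by
  have := h.norm_sq
  rwa [real_inner_comm] at this

lemma norm_exp_smul_apply_le (A : H →L[ℝ] H) (hd : ∀ f, inner ℝ (A f) f ≤ 0) {t : ℝ} (ht : 0 ≤ t)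
    (f : H) : ‖NormedSpace.exp (t • A) f‖ ≤ ‖f‖ := by
  have h1 := fun s => hasDerivAt_norm_sq (hasDerivAt_exp_smul_apply A f s)
  have hanti : Antitone (fun s : ℝ => ‖NormedSpace.exp (s • A) f‖ ^ 2) := by
    apply antitone_of_deriv_nonpos (fun s => (h1 s).differentiableAt)
    intro s
    rw [(h1 s).deriv]
    linarith [hd (NormedSpace.exp (s • A) f)]
  have := hanti ht
  simp only [zero_smul, NormedSpace.exp_zero, one_apply_eq_self] at this
  exact (pow_le_pow_iff_left₀ (norm_nonneg _) (norm_nonneg _) two_ne_zero).1 this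

/-- The parabolic smoothing estimate `t ‖A e^{tA} f‖ ≤ ‖f‖`. -/
lemma mul_norm_exp_smul_apply_le (A : H →L[ℝ] H)
    (hs : ∀ f g, inner ℝ (A f) g = inner ℝ f (A g))
    (hd : ∀ f, inner ℝ (A f) f ≤ 0) {t : ℝ} (ht : 0 ≤ t)
    (f : H) : t * ‖A (NormedSpace.exp (t • A) f)‖ ≤ ‖f‖ := by
  set u : ℝ → H := fun s => NormedSpace.exp (s • A) f with hu
  have hu' : ∀ s, HasDerivAt u (A (u s)) s := hasDerivAt_exp_smul_apply A f
  have hAu' : ∀ s, HasDerivAt (fun s => A (u s)) (A (A (u s))) s := fun s =>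
    A.hasFDerivAt.comp_hasDerivAt s (hu' s)
  -- The weights are chosen so that in $E'$ every term cancels except $4s^2\langle
  -- A(Au),Au\rangle\le0$; all three terms of $E$ are nonnegative and $E(0)=\|f\|^2$.
  set E : ℝ → ℝ := fun s => ‖u s‖ ^ 2 - 2 * s * inner ℝ (A (u s)) (u s) + 2 * s ^ 2 * ‖A (u s)‖ ^ 2
  have hE : ∀ s, HasDerivAt E (4 * s ^ 2 * inner ℝ (A (A (u s))) (A (u s))) s := by
    intro s
    have h1 := hasDerivAt_norm_sq (hu' s)
    have h2 := hasDerivAt_norm_sq (hAu' s)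
    have h3 := (hAu' s).inner ℝ (hu' s)
    have h4 := ((hasDerivAt_id s).const_mul 2).mul h3
    have h5 := (((hasDerivAt_id s).pow 2).const_mul 2).mul h2
    refine ((h1.sub h4).add h5).congr_deriv ?_
    rw [hs (A (u s)) (u s), real_inner_self_eq_norm_sq]
    simp only [id]
    norm_num
    ring
  have hanti : Antitone E := by
    apply antitone_of_deriv_nonpos (fun s => (hE s).differentiableAt)
    intro s
    rw [(hE s).deriv]
    exact mul_nonpos_of_nonneg_of_nonpos (by positivity) (hd _)
  have h0 := hanti ht
  have hE0 : E 0 = ‖f‖ ^ 2 := by simp [E, hu]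
  rw [hE0] at h0
  have h6 : (t * ‖A (u t)‖) ^ 2 ≤ ‖f‖ ^ 2 := by
    have h7 : 0 ≤ -(2 * t * inner ℝ (A (u t)) (u t)) := by
      have := mul_nonneg (mul_nonneg zero_le_two ht) (neg_nonneg.2 (hd (u t)))
      linarith
    have h8 : ‖u t‖ ^ 2 - 2 * t * inner ℝ (A (u t)) (u t) + 2 * t ^ 2 * ‖A (u t)‖ ^ 2
      ≤ ‖f‖ ^ 2 := h0
    nlinarith [sq_nonneg (‖u t‖), sq_nonneg (t * ‖A (u t)‖)]
  exact (pow_le_pow_iff_left₀ (by positivity) (norm_nonneg _) two_ne_zero).1 h6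

/-- Interpolate by $V(s)=e^{(t-s)B}e^{sA}f$: since $A$ and $B$ commute, $V'(s)$ is a product of
contractions applied to $Af-Bf$. This makes the exponentials of the Yosida approximations Cauchy on
the domain. -/
lemma norm_exp_smul_sub_exp_smul_le (A B : H →L[ℝ] H) (hAB : Commute A B)
    (hA : ∀ f, inner ℝ (A f) f ≤ 0) (hB : ∀ f, inner ℝ (B f) f ≤ 0) {t : ℝ} (ht : 0 ≤ t) (f : H) :
    ‖NormedSpace.exp (t • A) f - NormedSpace.exp (t • B) f‖ ≤ t * ‖A f - B f‖ := by
  set V : ℝ → H := fun s => NormedSpace.exp ((t - s) • B) (NormedSpace.exp (s • A) f) with hV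
  have hV' : ∀ s, HasDerivAt V
      (NormedSpace.exp ((t - s) • B) (NormedSpace.exp (s • A) (A f - B f))) s := by
    intro s
    have h1 : HasDerivAt (fun s : ℝ => NormedSpace.exp ((t - s) • B))
        (-(NormedSpace.exp ((t - s) • B) * B)) s := by
      have h := (hasDerivAt_exp_smul_const (𝕂 := ℝ) B (t - s)).scomp s
        ((hasDerivAt_id s).const_sub t)
      simpa [Function.comp_def] using h
    have h2 := hasDerivAt_exp_smul_apply A f s
    refine (h1.clm_apply h2).congr_deriv ?_
    have c1 : A (NormedSpace.exp (s • A) f) = NormedSpace.exp (s • A) (A f) :=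
      congrArg (fun T : H →L[ℝ] H => T f) (commute_exp_smul A A (Commute.refl A) s).eq
    have c2 : B (NormedSpace.exp (s • A) f) = NormedSpace.exp (s • A) (B f) :=
      congrArg (fun T : H →L[ℝ] H => T f) (commute_exp_smul A B hAB.symm s).eq
    simp only [neg_apply, mul_apply_eq_comp, c1, c2, map_sub]
    abel
  have hb : ∀ s ∈ Ico 0 t, ‖NormedSpace.exp ((t - s) • B) (NormedSpace.exp (s • A) (A f - B f))‖
      ≤ ‖A f - B f‖ := fun s hs =>
    (norm_exp_smul_apply_le B hB (sub_nonneg.2 hs.2.le) _).trans (norm_exp_smul_apply_le A hA hs.1 _)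
  have := norm_image_sub_le_of_norm_deriv_le_segment'
    (fun s _ => (hV' s).hasDerivWithinAt) hb t (right_mem_Icc.2 ht)
  simpa [hV, mul_comm] using this

end BoundedExp

/-! ### Nonpositive self-adjoint operators given by their graph -/

/-- `G` is the graph of a nonpositive self-adjoint operator. -/
structure IsNonposSelfAdjoint {H : Type*} [NormedAddCommGroup H] [InnerProductSpace ℝ H]
    (G : H → H → Prop) : Prop where
  add : ∀ {f h f' h'}, G f h → G f' h' → G (f + f') (h + h')
  smul : ∀ (c : ℝ) {f h}, G f h → G (c • f) (c • h)
  eq_zero : ∀ {h}, G 0 h → h = 0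
  symm : ∀ {f h f' h'}, G f h → G f' h' → inner ℝ h f' = inner ℝ f h'
  nonpos : ∀ {f h}, G f h → inner ℝ h f ≤ 0
  surj : ∀ l : ℝ, 0 < l → ∀ v, ∃ f, G f (l • f - v)

namespace IsNonposSelfAdjoint

variable {H : Type*} [NormedAddCommGroup H] [InnerProductSpace ℝ H]
  {G : H → H → Prop} (hG : IsNonposSelfAdjoint G)

include hG

lemma sub {f h f' h' : H} (h1 : G f h) (h2 : G f' h') : G (f - f') (h - h') := by
  simpa [sub_eq_add_neg] using hG.add h1 (hG.smul (-1) h2)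

lemma mul_norm_le {l : ℝ} {f v : H} (h : G f (l • f - v)) : l * ‖f‖ ≤ ‖v‖ := by
  have h1 := hG.nonpos h
  rw [inner_sub_left, inner_smul_left, real_inner_self_eq_norm_sq] at h1
  simp only [conj_trivial] at h1
  have h2 := real_inner_le_norm v f
  by_cases hf : ‖f‖ = 0
  · rw [hf, mul_zero]; positivity
  · have : 0 < ‖f‖ := lt_of_le_of_ne (norm_nonneg _) (Ne.symm hf)
    nlinarith

lemma unique_solution {l : ℝ} (hl : 0 < l) {f f' v : H} (h : G f (l • f - v))
    (h' : G f' (l • f' - v)) : f = f' := by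
  have h1 : G (f - f') (l • (f - f') - 0) := by
    have := hG.sub h h'
    convert this using 1
    module
  have h2 := hG.mul_norm_le h1
  rw [norm_zero] at h2
  have : ‖f - f'‖ ≤ 0 := nonpos_of_mul_nonpos_right h2 hl
  exact sub_eq_zero.1 (norm_le_zero_iff.1 this)

omit hG in
/-- The resolvent `(l - G)⁻¹`. -/
def resolvent (hG : IsNonposSelfAdjoint G) (l : ℝ) (hl : 0 < l) : H →L[ℝ] H :=
  LinearMap.mkContinuous
    { toFun := fun v => (hG.surj l hl v).choose
      map_add' := fun v w => by
        refine hG.unique_solution hl (hG.surj l hl (v + w)).choose_spec ?_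
        have := hG.add (hG.surj l hl v).choose_spec (hG.surj l hl w).choose_spec
        convert this using 1
        module
      map_smul' := fun c v => by
        refine hG.unique_solution hl (hG.surj l hl (c • v)).choose_spec ?_
        rw [RingHom.id_apply, smul_comm l c, ← smul_sub]
        exact hG.smul c (hG.surj l hl v).choose_spec } (l⁻¹) (fun v => by
      have := hG.mul_norm_le (hG.surj l hl v).choose_spec
      rw [← div_eq_inv_mul, le_div_iff₀ hl, mul_comm]
      exact this)

lemma resolvent_spec {l : ℝ} (hl : 0 < l) (v : H) :
    G (hG.resolvent l hl v) (l • hG.resolvent l hl v - v) :=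
  (hG.surj l hl v).choose_spec

lemma eq_resolvent {l : ℝ} (hl : 0 < l) {f v : H} (h : G f (l • f - v)) :
    f = hG.resolvent l hl v :=
  hG.unique_solution hl h (hG.resolvent_spec hl v)

/-- Expresses the unbounded graph through one bounded operator, so that closedness and invariance
under the semigroup or under integration reduce to continuity and commutation of the resolvent. -/
lemma graph_iff {l : ℝ} (hl : 0 < l) {f h : H} : G f h ↔ f = hG.resolvent l hl (l • f - h) := by
  constructor
  · intro h1
    apply hG.eq_resolvent hl
    simpa using h1
  · intro h1
    have := hG.resolvent_spec hl (l • f - h)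
    rw [← h1] at this
    simpa using this

lemma norm_resolvent_apply_le {l : ℝ} (hl : 0 < l) (v : H) :
    l * ‖hG.resolvent l hl v‖ ≤ ‖v‖ :=
  hG.mul_norm_le (hG.resolvent_spec hl v)

lemma resolvent_symm {l : ℝ} (hl : 0 < l) (v w : H) :
    inner ℝ (hG.resolvent l hl v) w = inner ℝ v (hG.resolvent l hl w) := by
  have := hG.symm (hG.resolvent_spec hl v) (hG.resolvent_spec hl w)
  simp only [inner_sub_left, inner_sub_right, inner_smul_left, inner_smul_right,
    conj_trivial] at this
  linarith

lemma resolvent_sub {l m : ℝ} (hl : 0 < l) (hm : 0 < m) (v : H) :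
    hG.resolvent l hl v - hG.resolvent m hm v
      = (m - l) • hG.resolvent l hl (hG.resolvent m hm v) := by
  have h1 : hG.resolvent m hm v
      = hG.resolvent l hl (v + (l - m) • hG.resolvent m hm v) := by
    apply hG.eq_resolvent
    convert hG.resolvent_spec hm v using 1
    module
  rw [map_add, map_smul] at h1
  rw [eq_sub_of_add_eq h1.symm]
  module

/-- The resolvent identity, written once for $(l,m)$ and once for $(m,l)$, gives both products up to
the factor $m-l\neq0$. -/
lemma resolvent_commute {l m : ℝ} (hl : 0 < l) (hm : 0 < m) :
    Commute (hG.resolvent l hl) (hG.resolvent m hm) := by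
  by_cases h : l = m
  · subst h; exact Commute.refl _
  · ext v
    have h1 := hG.resolvent_sub hl hm v
    have h2 := hG.resolvent_sub hm hl v
    have h3 : (m - l) • hG.resolvent l hl (hG.resolvent m hm v)
        = (m - l) • hG.resolvent m hm (hG.resolvent l hl v) := by
      rw [← h1, ← neg_sub, h2]; module
    exact smul_right_injective H (sub_ne_zero.2 (Ne.symm h)) h3

lemma closed {ι : Type*} {l : Filter ι} [l.NeBot] {f h : ι → H} {F K : H}
    (hf : Tendsto f l (𝓝 F)) (hh : Tendsto h l (𝓝 K)) (hfh : ∀ᶠ i in l, G (f i) (h i)) : G F K := by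
  rw [hG.graph_iff one_pos]
  refine tendsto_nhds_unique_of_eventuallyEq hf
    (((hG.resolvent 1 one_pos).continuous.tendsto _).comp ((hf.const_smul (1 : ℝ)).sub hh)) ?_
  filter_upwards [hfh] with i hi
  exact (hG.graph_iff one_pos).1 hi

/-! #### Yosida approximations -/

omit hG in
/-- `n (n - G)⁻¹`, with `n + 1` in place of `n`. -/
def yosidaProj (hG : IsNonposSelfAdjoint G) (n : ℕ) : H →L[ℝ] H :=
  ((n : ℝ) + 1) • hG.resolvent (n + 1) n.cast_add_one_pos

omit hG in
/-- The Yosida approximation of `G`. -/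
def yosida (hG : IsNonposSelfAdjoint G) (n : ℕ) : H →L[ℝ] H :=
  ((n : ℝ) + 1) • (hG.yosidaProj n - 1)

lemma yosida_apply (n : ℕ) (v : H) :
    hG.yosida n v = ((n : ℝ) + 1) • (hG.yosidaProj n v - v) := rfl

lemma norm_yosidaProj_apply_le (n : ℕ) (v : H) : ‖hG.yosidaProj n v‖ ≤ ‖v‖ := by
  have := hG.norm_resolvent_apply_le n.cast_add_one_pos v
  rw [yosidaProj, smul_apply, norm_smul, Real.norm_of_nonneg (by positivity)]
  exact this

lemma yosida_spec (n : ℕ) (v : H) : G (hG.yosidaProj n v) (hG.yosida n v) := by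
  have := hG.smul ((n : ℝ) + 1) (hG.resolvent_spec n.cast_add_one_pos v)
  exact this

lemma yosidaProj_symm (n : ℕ) (v w : H) :
    inner ℝ (hG.yosidaProj n v) w = inner ℝ v (hG.yosidaProj n w) := by
  have := hG.resolvent_symm (n.cast_add_one_pos (α := ℝ)) v w
  simp only [yosidaProj, smul_apply, inner_smul_left, inner_smul_right, this,
    conj_trivial]

lemma yosida_symm (n : ℕ) (v w : H) :
    inner ℝ (hG.yosida n v) w = inner ℝ v (hG.yosida n w) := by
  simp only [yosida_apply, inner_smul_left, inner_smul_right, inner_sub_left, inner_sub_right,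
    hG.yosidaProj_symm, conj_trivial]

lemma yosida_nonpos (n : ℕ) (v : H) : inner ℝ (hG.yosida n v) v ≤ 0 := by
  rw [yosida_apply, inner_smul_left, inner_sub_left, real_inner_self_eq_norm_sq]
  have h1 := real_inner_le_norm (hG.yosidaProj n v) v
  have h2 := hG.norm_yosidaProj_apply_le n v
  have h3 : ‖hG.yosidaProj n v‖ * ‖v‖ ≤ ‖v‖ * ‖v‖ := by gcongr
  refine mul_nonpos_of_nonneg_of_nonpos (by simp; positivity) (by nlinarith)

lemma yosidaProj_sub {f h : H} (hf : G f h) (n : ℕ) :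
    hG.yosidaProj n f - f = hG.resolvent (n + 1) n.cast_add_one_pos h := by
  have h1 := (hG.graph_iff n.cast_add_one_pos).1 hf
  rw [map_sub, map_smul] at h1
  change ((n : ℝ) + 1) • hG.resolvent (n + 1) n.cast_add_one_pos f - f = _
  nth_rewrite 2 [h1]
  abel

lemma yosida_eq {f h : H} (hf : G f h) (n : ℕ) : hG.yosida n f = hG.yosidaProj n h := by
  rw [yosida_apply, hG.yosidaProj_sub hf]
  rfl

lemma yosida_commute (m n : ℕ) : Commute (hG.yosida m) (hG.yosida n) := by
  have h := hG.resolvent_commute (m.cast_add_one_pos (α := ℝ)) (n.cast_add_one_pos (α := ℝ))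
  exact ((((h.smul_left _).smul_right _).sub_left (Commute.one_left _)).sub_right
    (((Commute.one_right _).sub_left (Commute.one_left _)))).smul_left _ |>.smul_right _

lemma resolvent_commute_yosida {l : ℝ} (hl : 0 < l) (n : ℕ) :
    Commute (hG.resolvent l hl) (hG.yosida n) := by
  have h := hG.resolvent_commute hl (n.cast_add_one_pos (α := ℝ))
  exact ((h.smul_right _).sub_right (Commute.one_right _)).smul_right _

variable [CompleteSpace H]

/-- If $v$ is orthogonal to the domain then $\langle Rv,v\rangle=0$ for $R=(1-G)^{-1}$.
Nonpositivity at $Rv$ yields $\|Rv\|^2\le\langle v,Rv\rangle=0$, and single-valuedness of the graph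
at $0$ forces $v=0$. -/
lemma dense_domain : Dense {f : H | ∃ h, G f h} := by
  let D : Submodule ℝ H :=
    { carrier := {f : H | ∃ h, G f h}
      add_mem' := fun ⟨h, hh⟩ ⟨k, hk⟩ => ⟨h + k, hG.add hh hk⟩
      zero_mem' := ⟨0, by
        obtain ⟨f, hf⟩ := hG.surj 1 one_pos 0
        simpa using hG.smul 0 hf⟩
      smul_mem' := fun c _ ⟨h, hh⟩ => ⟨c • h, hG.smul c hh⟩ }
  change Dense (D : Set H)
  rw [Submodule.dense_iff_topologicalClosure_eq_top, Submodule.topologicalClosure_eq_top_iff,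
    Submodule.eq_bot_iff]
  intro v hv
  have hR := hG.resolvent_spec one_pos v
  have h1 : inner ℝ (hG.resolvent 1 one_pos v) v = 0 := hv _ ⟨_, hR⟩
  have h2 := hG.nonpos hR
  rw [one_smul, inner_sub_left, real_inner_comm, real_inner_self_eq_norm_sq, real_inner_comm, h1]
    at h2
  have h3 : hG.resolvent 1 one_pos v = 0 := by
    rw [← norm_eq_zero]
    nlinarith [norm_nonneg (hG.resolvent 1 one_pos v)]
  rw [h3] at hR
  simpa using hG.eq_zero hR

omit hG in
lemma tendsto_of_dense {E F : Type*} [NormedAddCommGroup E] [NormedAddCommGroup F]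
    [NormedSpace ℝ E] [NormedSpace ℝ F]
    {T : ℕ → E →L[ℝ] F} {T' : E →L[ℝ] F} (hT : ∀ n x, ‖T n x‖ ≤ ‖x‖) (hT' : ∀ x, ‖T' x‖ ≤ ‖x‖)
    {D : Set E} (hD : Dense D) (h : ∀ x ∈ D, Tendsto (fun n => T n x) atTop (𝓝 (T' x))) (x : E) :
    Tendsto (fun n => T n x) atTop (𝓝 (T' x)) := by
  rw [Metric.tendsto_atTop]
  intro ε hε
  obtain ⟨y, hy, hxy⟩ := hD.exists_dist_lt x (show 0 < ε / 3 by positivity)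
  obtain ⟨N, hN⟩ := Metric.tendsto_atTop.1 (h y hy) (ε / 3) (by positivity)
  refine ⟨N, fun n hn => ?_⟩
  have h1 := hN n hn
  have h2 := hT n (x - y)
  have h3 := hT' (y - x)
  rw [norm_sub_rev y x] at h3
  rw [dist_eq_norm] at *
  have : T n x - T' x = T n (x - y) + (T n y - T' y) + T' (y - x) := by
    simp only [map_sub]; abel
  rw [this]
  calc _ ≤ ‖T n (x - y)‖ + ‖T n y - T' y‖ + ‖T' (y - x)‖ := norm_add₃_le
    _ < ε := by linarith

lemma tendsto_yosidaProj (f : H) : Tendsto (fun n => hG.yosidaProj n f) atTop (𝓝 f) := by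
  refine tendsto_of_dense (T' := ContinuousLinearMap.id ℝ H) hG.norm_yosidaProj_apply_le
    (fun x => le_rfl) hG.dense_domain ?_ f
  rintro x ⟨h, hx⟩
  rw [tendsto_iff_norm_sub_tendsto_zero]
  refine squeeze_zero (fun _ => norm_nonneg _) (g := fun n : ℕ => (1 / ((n : ℝ) + 1)) * ‖h‖)
    (fun n => ?_) ?_
  · have := hG.norm_resolvent_apply_le (n.cast_add_one_pos (α := ℝ)) h
    rw [ContinuousLinearMap.id_apply, hG.yosidaProj_sub hx, one_div, ← div_eq_inv_mul,
      le_div_iff₀ n.cast_add_one_pos, mul_comm]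
    exact this
  · simpa using (tendsto_one_div_add_atTop_nhds_zero_nat (𝕜 := ℝ)).mul_const ‖h‖

lemma tendsto_yosida {f h : H} (hf : G f h) : Tendsto (fun n => hG.yosida n f) atTop (𝓝 h) := by
  simp_rw [hG.yosida_eq hf]
  exact hG.tendsto_yosidaProj h

lemma norm_yosida_le {f h : H} (hf : G f h) (n : ℕ) : ‖hG.yosida n f‖ ≤ ‖h‖ := by
  rw [hG.yosida_eq hf]
  exact hG.norm_yosidaProj_apply_le n h

end IsNonposSelfAdjoint

namespace IsNonposSelfAdjoint

variable {H : Type*} [NormedAddCommGroup H] [InnerProductSpace ℝ H] [CompleteSpace H]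
  {G : H → H → Prop} (hG : IsNonposSelfAdjoint G)

/-! #### The semigroup generated by a nonpositive self-adjoint operator -/

/-- The exponential of the Yosida approximation. -/
def yosidaExp (n : ℕ) (t : ℝ) : H →L[ℝ] H := NormedSpace.exp (t • hG.yosida n)

include hG

lemma norm_yosidaExp_apply_le (n : ℕ) {t : ℝ} (ht : 0 ≤ t) (f : H) :
    ‖hG.yosidaExp n t f‖ ≤ ‖f‖ :=
  norm_exp_smul_apply_le _ (hG.yosida_nonpos n) ht f

lemma exists_tendsto_yosidaExp {t : ℝ} (ht : 0 ≤ t) (f : H) :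
    ∃ L, Tendsto (fun n => hG.yosidaExp n t f) atTop (𝓝 L) := by
  apply cauchySeq_tendsto_of_complete
  rw [Metric.cauchySeq_iff]
  intro ε hε
  obtain ⟨y, ⟨h, hy⟩, hxy⟩ := hG.dense_domain.exists_dist_lt f (show 0 < ε / 3 by positivity)
  have hc := (hG.tendsto_yosida hy).const_smul t |>.cauchySeq
  obtain ⟨N, hN⟩ := Metric.cauchySeq_iff.1 hc (ε / 3) (by positivity)
  refine ⟨N, fun m hm n hn => ?_⟩
  have h0 := hN m hm n hn
  have h1 := hG.norm_yosidaExp_apply_le m ht (f - y)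
  have h2 := norm_exp_smul_sub_exp_smul_le _ _ (hG.yosida_commute m n)
    (hG.yosida_nonpos m) (hG.yosida_nonpos n) ht y
  have h3 := hG.norm_yosidaExp_apply_le n ht (y - f)
  rw [norm_sub_rev y f] at h3
  rw [dist_eq_norm] at *
  rw [← smul_sub, norm_smul, Real.norm_of_nonneg ht] at h0
  have : hG.yosidaExp m t f - hG.yosidaExp n t f = hG.yosidaExp m t (f - y)
      + (hG.yosidaExp m t y - hG.yosidaExp n t y) + hG.yosidaExp n t (y - f) := by
    simp only [map_sub]; abel
  rw [this]
  have h2' : ‖hG.yosidaExp m t y - hG.yosidaExp n t y‖ < ε / 3 := h2.trans_lt h0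
  calc _ ≤ ‖hG.yosidaExp m t (f - y)‖ + ‖hG.yosidaExp m t y - hG.yosidaExp n t y‖
        + ‖hG.yosidaExp n t (y - f)‖ := norm_add₃_le
    _ < ε := by linarith

omit hG in
/-- The semigroup generated by `G`. -/
def semigroup (hG : IsNonposSelfAdjoint G) (t : NNReal) : H →L[ℝ] H :=
  continuousLinearMapOfTendsto (l := atTop) (fun n => hG.yosidaExp n t)
    (f := fun f => (hG.exists_tendsto_yosidaExp t.2 f).choose)
    (tendsto_pi_nhds.2 fun f => (hG.exists_tendsto_yosidaExp t.2 f).choose_spec)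

lemma tendsto_yosidaExp (t : NNReal) (f : H) :
    Tendsto (fun n => hG.yosidaExp n t f) atTop (𝓝 (hG.semigroup t f)) :=
  (hG.exists_tendsto_yosidaExp t.2 f).choose_spec

lemma norm_semigroup_apply_le (t : NNReal) (f : H) : ‖hG.semigroup t f‖ ≤ ‖f‖ :=
  le_of_tendsto (hG.tendsto_yosidaExp t f).norm
    (Eventually.of_forall fun n => hG.norm_yosidaExp_apply_le n t.2 f)

lemma semigroup_symm (t : NNReal) (f g : H) :
    inner ℝ (hG.semigroup t f) g = inner ℝ f (hG.semigroup t g) := by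
  refine tendsto_nhds_unique ((hG.tendsto_yosidaExp t f).inner tendsto_const_nhds)
    (Tendsto.congr (fun n => ?_) (tendsto_const_nhds.inner (hG.tendsto_yosidaExp t g)))
  exact (inner_exp_smul_symm _ (hG.yosida_symm n) t f g).symm

lemma semigroup_zero : hG.semigroup 0 = ContinuousLinearMap.id ℝ H := by
  ext f
  refine tendsto_nhds_unique (hG.tendsto_yosidaExp 0 f) ?_
  simp [yosidaExp, NormedSpace.exp_zero]

/-- Joint convergence of contractions. -/
lemma tendsto_yosidaExp_comp (t : NNReal) {f : ℕ → H} {F : H} (hf : Tendsto f atTop (𝓝 F)) :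
    Tendsto (fun n => hG.yosidaExp n t (f n)) atTop (𝓝 (hG.semigroup t F)) := by
  have h1 : Tendsto (fun n => hG.yosidaExp n t (f n - F)) atTop (𝓝 0) := by
    refine squeeze_zero_norm (fun n => hG.norm_yosidaExp_apply_le n t.2 _) ?_
    simpa using (hf.sub_const F).norm
  have h2 := h1.add (hG.tendsto_yosidaExp t F)
  rw [zero_add] at h2
  exact h2.congr fun n => by simp

lemma semigroup_add (s t : NNReal) :
    hG.semigroup (s + t) = (hG.semigroup s).comp (hG.semigroup t) := by
  ext f
  refine tendsto_nhds_unique (hG.tendsto_yosidaExp (s + t) f) ?_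
  refine (hG.tendsto_yosidaExp_comp s (hG.tendsto_yosidaExp t f)).congr fun n => ?_
  simp only [yosidaExp, NNReal.coe_add, exp_add_smul, mul_apply_eq_comp]

lemma semigroup_add_apply (s t : NNReal) (f : H) :
    hG.semigroup (s + t) f = hG.semigroup s (hG.semigroup t f) := by
  rw [hG.semigroup_add]; rfl

lemma resolvent_semigroup {l : ℝ} (hl : 0 < l) (t : NNReal) (f : H) :
    hG.resolvent l hl (hG.semigroup t f) = hG.semigroup t (hG.resolvent l hl f) := by
  refine tendsto_nhds_unique (((hG.resolvent l hl).continuous.tendsto _).comp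
    (hG.tendsto_yosidaExp t f)) ((hG.tendsto_yosidaExp t _).congr fun n => ?_)
  exact (congrArg (fun T : H →L[ℝ] H => T f)
    (commute_exp_smul _ _ (hG.resolvent_commute_yosida hl n) t).eq).symm

lemma semigroup_graph {f h : H} (hf : G f h) (t : NNReal) :
    G (hG.semigroup t f) (hG.semigroup t h) := by
  rw [hG.graph_iff one_pos, one_smul, ← map_sub, hG.resolvent_semigroup]
  have := (hG.graph_iff one_pos).1 hf
  rw [one_smul] at this
  rw [← this]

/-! The semigroup as a function of a real time. -/

lemma norm_yosidaExp_sub_le {f h : H} (hf : G f h) (n : ℕ) {t : ℝ} (ht : 0 ≤ t) :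
    ‖hG.yosidaExp n t f - f‖ ≤ t * ‖h‖ := by
  -- Comparison with the generator $0$, whose exponential is the identity.
  have h1 := norm_exp_smul_sub_exp_smul_le (hG.yosida n) 0 (Commute.zero_right _)
    (hG.yosida_nonpos n) (fun f => by simp) ht f
  simp only [smul_zero, NormedSpace.exp_zero, one_apply_eq_self, zero_apply, sub_zero] at h1
  exact h1.trans (by gcongr; exact hG.norm_yosida_le hf n)

lemma norm_semigroup_sub_le {f h : H} (hf : G f h) (t : NNReal) :
    ‖hG.semigroup t f - f‖ ≤ t * ‖h‖ :=
  le_of_tendsto ((hG.tendsto_yosidaExp t f).sub_const f).norm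
    (Eventually.of_forall fun n => hG.norm_yosidaExp_sub_le hf n t.2)

omit hG in
lemma dist_semigroup_le (hG : IsNonposSelfAdjoint G) {f h : H} (hf : G f h) (s t : NNReal) :
    dist (hG.semigroup s f) (hG.semigroup t f) ≤ dist s t * ‖h‖ := by
  wlog hst : s ≤ t generalizing s t
  · rw [dist_comm, dist_comm s]; exact this t s (le_of_not_ge hst)
  obtain ⟨r, rfl⟩ := exists_add_of_le hst
  rw [hG.semigroup_add_apply, dist_comm, dist_eq_norm, ← map_sub, dist_comm, NNReal.dist_eq]
  refine (hG.norm_semigroup_apply_le _ _).trans ((hG.norm_semigroup_sub_le hf r).trans_eq ?_)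
  simp

lemma continuous_semigroup_apply (f : H) : Continuous fun t => hG.semigroup t f := by
  rw [Metric.continuous_iff]
  intro t ε hε
  obtain ⟨y, ⟨h, hy⟩, hxy⟩ := hG.dense_domain.exists_dist_lt f (show 0 < ε / 3 by positivity)
  refine ⟨ε / 3 / (‖h‖ + 1), by positivity, fun s hs => ?_⟩
  have h1 := hG.dist_semigroup_le hy s t
  have h2 : dist s t * ‖h‖ ≤ ε / 3 := by
    rw [lt_div_iff₀ (by positivity)] at hs
    nlinarith [dist_nonneg (x := s) (y := t), norm_nonneg h]
  have h3 := hG.norm_semigroup_apply_le s (f - y)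
  have h4 := hG.norm_semigroup_apply_le t (f - y)
  rw [map_sub, ← dist_eq_norm, ← dist_eq_norm] at h3 h4
  rw [dist_comm] at h4
  calc dist (hG.semigroup s f) (hG.semigroup t f)
      ≤ dist (hG.semigroup s f) (hG.semigroup s y) + dist (hG.semigroup s y) (hG.semigroup t y)
        + dist (hG.semigroup t y) (hG.semigroup t f) := dist_triangle4 _ _ _ _
    _ < ε := by linarith

lemma continuous_semigroup_toNNReal (f : H) :
    Continuous fun t : ℝ => hG.semigroup t.toNNReal f :=
  (hG.continuous_semigroup_apply f).comp continuous_real_toNNReal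

lemma continuous_semigroup_uncurry :
    Continuous fun p : NNReal × H => hG.semigroup p.1 p.2 := by
  rw [continuous_iff_continuousAt]
  rintro ⟨t, f⟩
  have h1 : Tendsto (fun p : NNReal × H => hG.semigroup p.1 (p.2 - f)) (𝓝 (t, f)) (𝓝 0) := by
    refine squeeze_zero_norm (fun p => hG.norm_semigroup_apply_le p.1 _) ?_
    have : Continuous fun p : NNReal × H => ‖p.2 - f‖ := by fun_prop
    simpa using this.tendsto (t, f)
  have h2 := h1.add (((hG.continuous_semigroup_apply f).comp continuous_fst).tendsto (t, f))
  simp only [zero_add, Function.comp_apply] at h2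
  exact h2.congr fun p => by simp

/-- The integrated equation survives the limit in the Yosida index by dominated convergence, while
derivatives would not obviously do so. Differentiability of orbits is then recovered from the
fundamental theorem of calculus. -/
lemma semigroup_sub_eq_integral {f h : H} (hf : G f h) {t : ℝ} (ht : 0 ≤ t) :
    hG.semigroup t.toNNReal f - f = ∫ s in (0 : ℝ)..t, hG.semigroup s.toNNReal h := by
  have h1 : ∀ n, hG.yosidaExp n t f - f = ∫ s in (0 : ℝ)..t, hG.yosidaExp n s (hG.yosida n f) := by
    intro n
    have hd : ∀ s, HasDerivAt (fun s => hG.yosidaExp n s f) (hG.yosidaExp n s (hG.yosida n f)) s := by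
      intro s
      refine (hasDerivAt_exp_smul_apply (hG.yosida n) f s).congr_deriv ?_
      exact congrArg (fun T : H →L[ℝ] H => T f)
        (commute_exp_smul _ (hG.yosida n) (Commute.refl _) s).eq
    have hc : Continuous fun s => hG.yosidaExp n s (hG.yosida n f) := by
      rw [continuous_iff_continuousAt]
      exact fun s => (hasDerivAt_exp_smul_apply (hG.yosida n) (hG.yosida n f) s).continuousAt
    rw [intervalIntegral.integral_eq_sub_of_hasDerivAt (fun s _ => hd s) (hc.intervalIntegrable _ _)]
    simp [yosidaExp, NormedSpace.exp_zero]
  have h2 : Tendsto (fun n => ∫ s in (0 : ℝ)..t, hG.yosidaExp n s (hG.yosida n f)) atTop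
      (𝓝 (∫ s in (0 : ℝ)..t, hG.semigroup s.toNNReal h)) := by
    refine intervalIntegral.tendsto_integral_filter_of_dominated_convergence (fun _ => ‖h‖)
      (Eventually.of_forall fun n => ?_) (Eventually.of_forall fun n => ae_of_all _ fun s hs => ?_)
      intervalIntegrable_const (ae_of_all _ fun s hs => ?_)
    · have hc : Continuous fun s => hG.yosidaExp n s (hG.yosida n f) := by
        rw [continuous_iff_continuousAt]
        exact fun s => (hasDerivAt_exp_smul_apply (hG.yosida n) (hG.yosida n f) s).continuousAt
      exact hc.aestronglyMeasurable
    · rw [uIoc_of_le ht] at hs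
      exact (hG.norm_yosidaExp_apply_le n hs.1.le _).trans (hG.norm_yosida_le hf n)
    · rw [uIoc_of_le ht] at hs
      have := hG.tendsto_yosidaExp_comp s.toNNReal (hG.tendsto_yosida hf)
      rwa [Real.coe_toNNReal _ hs.1.le] at this
  refine tendsto_nhds_unique ?_ h2
  simp_rw [← h1]
  have := (hG.tendsto_yosidaExp t.toNNReal f).sub_const f
  rwa [Real.coe_toNNReal _ ht] at this

lemma hasDerivAt_integral_semigroup (h : H) (t : ℝ) :
    HasDerivAt (fun t => ∫ s in (0 : ℝ)..t, hG.semigroup s.toNNReal h)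
      (hG.semigroup t.toNNReal h) t :=
  (hG.continuous_semigroup_toNNReal h).integral_hasStrictDerivAt 0 t |>.hasDerivAt

lemma hasDerivWithinAt_semigroup {f h : H} (hf : G f h) {t : ℝ} (ht : 0 ≤ t) :
    HasDerivWithinAt (fun s : ℝ => hG.semigroup s.toNNReal f) (hG.semigroup t.toNNReal h)
      (Ici 0) t := by
  have h1 := ((hG.hasDerivAt_integral_semigroup h t).const_add f).hasDerivWithinAt (s := Ici 0)
  refine h1.congr (fun s hs => ?_) ?_
  · rw [← hG.semigroup_sub_eq_integral hf hs]; abel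
  · rw [← hG.semigroup_sub_eq_integral hf ht]; abel

lemma hasDerivAt_semigroup_of_graph {f h : H} (hf : G f h) {t : ℝ} (ht : 0 < t) :
    HasDerivAt (fun s : ℝ => hG.semigroup s.toNNReal f) (hG.semigroup t.toNNReal h) t :=
  (hG.hasDerivWithinAt_semigroup hf ht.le).hasDerivAt (Ici_mem_nhds ht)

/-! Smoothing. -/

/-- The bound involves $f$ alone and not $h=Gf$, which is what allows an extension beyond the
domain. -/
lemma mul_norm_semigroup_le {f h : H} (hf : G f h) (t : NNReal) :
    t * ‖hG.semigroup t h‖ ≤ ‖f‖ := by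
  refine le_of_tendsto ((hG.tendsto_yosidaExp_comp t (hG.tendsto_yosida hf)).norm.const_mul (t : ℝ))
    (Eventually.of_forall fun n => ?_)
  have := mul_norm_exp_smul_apply_le _ (hG.yosida_symm n) (hG.yosida_nonpos n) t.coe_nonneg f
  rwa [show hG.yosida n (NormedSpace.exp ((t : ℝ) • hG.yosida n) f)
    = hG.yosidaExp n t (hG.yosida n f) from congrArg (fun T : H →L[ℝ] H => T f)
        (commute_exp_smul _ (hG.yosida n) (Commute.refl _) t).eq] at this

/-- Approximate $f$ by the domain elements `yosidaProj n f`. The smoothing bound makes the images of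
$S(t)$ applied to them Cauchy under $G$, and $G$ is closed. -/
lemma exists_graph_semigroup {t : NNReal} (ht : 0 < t) (f : H) :
    ∃ k, G (hG.semigroup t f) k := by
  have hc : CauchySeq fun n => hG.semigroup t (hG.yosida n f) := by
    have h0 := (hG.tendsto_yosidaProj f).cauchySeq
    rw [Metric.cauchySeq_iff] at h0 ⊢
    intro ε hε
    obtain ⟨N, hN⟩ := h0 (t * ε) (by positivity)
    refine ⟨N, fun m hm n hn => ?_⟩
    have h1 := hN m hm n hn
    have h2 := hG.mul_norm_semigroup_le (hG.sub (hG.yosida_spec m f) (hG.yosida_spec n f)) t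
    rw [map_sub, ← dist_eq_norm, ← dist_eq_norm] at h2
    exact lt_of_mul_lt_mul_left (h2.trans_lt h1) t.2
  obtain ⟨k, hk⟩ := cauchySeq_tendsto_of_complete hc
  exact ⟨k, hG.closed (((hG.semigroup t).continuous.tendsto _).comp (hG.tendsto_yosidaProj f)) hk
    (Eventually.of_forall fun n => hG.semigroup_graph (hG.yosida_spec n f) t)⟩

/-- Split the time at $t/2$: smoothing puts $S(t/2)f$ in the domain, and from there the orbit is
differentiable. -/
lemma hasDerivAt_semigroup {t : ℝ} (ht : 0 < t) (f : H) :
    ∃ k, G (hG.semigroup t.toNNReal f) k ∧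
      HasDerivAt (fun s : ℝ => hG.semigroup s.toNNReal f) k t := by
  obtain ⟨k, hk⟩ := hG.exists_graph_semigroup (t := (t / 2).toNNReal) (by simpa using ht) f
  have hadd : ∀ s : ℝ, t / 2 < s → s.toNNReal = (s - t / 2).toNNReal + (t / 2).toNNReal := by
    intro s hs
    rw [← Real.toNNReal_add (by linarith) (by linarith)]; congr 1; ring
  refine ⟨hG.semigroup (t / 2).toNNReal k, ?_, ?_⟩
  · have := hG.semigroup_graph hk (t / 2).toNNReal
    rwa [← hG.semigroup_add_apply, ← Real.toNNReal_add (by linarith) (by linarith),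
      add_halves] at this
  · have h1 := hG.hasDerivAt_semigroup_of_graph hk (half_pos ht)
    have h2 : HasDerivAt (fun s : ℝ => hG.semigroup (s - t / 2).toNNReal
        (hG.semigroup (t / 2).toNNReal f)) (hG.semigroup (t / 2).toNNReal k) t := by
      have h3 : t - t / 2 = t / 2 := by ring
      exact HasDerivAt.comp_sub_const (f := fun s : ℝ => hG.semigroup s.toNNReal
        (hG.semigroup (t / 2).toNNReal f)) t (t / 2) (h3.symm ▸ h1)
    refine h2.congr_of_eventuallyEq ?_
    filter_upwards [Ioi_mem_nhds (half_lt_self ht)] with s hs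
    rw [hadd s hs, hG.semigroup_add_apply]

/-- No regularity of $f$ is needed: applying the resolvent inside the integral replaces $f$ by a
domain element, for which the integrated equation holds. -/
lemma graph_integral_semigroup (f : H) {t : ℝ} (ht : 0 ≤ t) :
    G (∫ s in (0 : ℝ)..t, hG.semigroup s.toNNReal f) (hG.semigroup t.toNNReal f - f) := by
  have hi : ∀ g, IntervalIntegrable (fun s : ℝ => hG.semigroup s.toNNReal g) volume 0 t :=
    fun g => (hG.continuous_semigroup_toNNReal g).intervalIntegrable _ _
  rw [hG.graph_iff one_pos, one_smul, map_sub, map_sub,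
    ← ContinuousLinearMap.intervalIntegral_comp_comm _ (hi f)]
  simp_rw [hG.resolvent_semigroup]
  have h1 := hG.semigroup_sub_eq_integral (hG.resolvent_spec one_pos f) ht
  simp_rw [one_smul, map_sub] at h1
  rw [intervalIntegral.integral_sub (hi _) (hi _)] at h1
  rw [h1]
  abel

/-! The Laplace transform. -/

/-- With $f=(l-G)^{-1}v$ the integrand is the derivative of $-e^{-ls}S(s)f$, which tends to $0$ at
infinity and equals $-f$ at $s=0$. -/
lemma integral_exp_semigroup {l : ℝ} (hl : 0 < l) (v : H) :
    IntegrableOn (fun s : ℝ => Real.exp (-l * s) • hG.semigroup s.toNNReal v) (Ioi 0) ∧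
    ∫ s in Ioi (0 : ℝ), Real.exp (-l * s) • hG.semigroup s.toNNReal v = hG.resolvent l hl v := by
  have hint : IntegrableOn (fun s : ℝ => Real.exp (-l * s) • hG.semigroup s.toNNReal v)
      (Ioi 0) := by
    have h0 : IntegrableOn (fun s : ℝ => Real.exp (-l * s) * ‖v‖) (Ioi 0) :=
      (integrableOn_exp_mul_Ioi (neg_neg_of_pos hl) 0).mul_const _
    refine h0.mono' (Continuous.aestronglyMeasurable ?_) (ae_of_all _ fun s => ?_)
    · exact (by fun_prop : Continuous fun s : ℝ => Real.exp (-l * s)).smul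
        (hG.continuous_semigroup_toNNReal v)
    · rw [norm_smul, Real.norm_of_nonneg (Real.exp_pos _).le]
      gcongr
      exact hG.norm_semigroup_apply_le _ v
  refine ⟨hint, ?_⟩
  set f := hG.resolvent l hl v with hf
  have hspec := hG.resolvent_spec hl v
  have hd : ∀ s ∈ Ioi (0 : ℝ), HasDerivAt
      (fun s : ℝ => -(Real.exp (-l * s) • hG.semigroup s.toNNReal f))
      (Real.exp (-l * s) • hG.semigroup s.toNNReal v) s := by
    intro s hs
    have h1 := hG.hasDerivAt_semigroup_of_graph hspec hs
    have h2 : HasDerivAt (fun s : ℝ => Real.exp (-l * s)) (Real.exp (-l * s) * (-l)) s := by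
      simpa using ((hasDerivAt_id s).const_mul (-l)).exp
    refine (h2.smul h1).neg.congr_deriv ?_
    rw [map_sub, map_smul]
    module
  have hlim : Tendsto (fun s : ℝ => -(Real.exp (-l * s) • hG.semigroup s.toNNReal f)) atTop
      (𝓝 0) := by
    refine squeeze_zero_norm (a := fun s => Real.exp (-l * s) * ‖f‖) (fun s => ?_) ?_
    · rw [norm_neg, norm_smul, Real.norm_of_nonneg (Real.exp_pos _).le]
      gcongr
      exact hG.norm_semigroup_apply_le _ f
    · have : Tendsto (fun s : ℝ => Real.exp (-l * s)) atTop (𝓝 0) :=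
        Real.tendsto_exp_atBot.comp (tendsto_id.const_mul_atTop_of_neg (neg_neg_of_pos hl))
      simpa using this.mul_const ‖f‖
  have := integral_Ioi_of_hasDerivAt_of_tendsto (a := 0) (m := (0 : H)) (f := fun s : ℝ =>
    -(Real.exp (-l * s) • hG.semigroup s.toNNReal f)) ?_ hd hint hlim
  · rw [this]
    simp [hG.semigroup_zero]
  · exact ((by fun_prop : Continuous fun s : ℝ => Real.exp (-l * s)).smul
      (hG.continuous_semigroup_toNNReal f)).neg.continuousWithinAt

/-! Invariance of closed convex cones. -/

/-- With $P_n$ for `yosidaProj n` and $a=t(n+1)$, the Yosida exponential is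
$e^{-a}\sum_k\frac{a^k}{k!}P_n^k$. All coefficients are nonnegative and $P_n$ is a positive multiple
of a resolvent, so a closed convex cone preserved by resolvents is preserved here too. -/
lemma semigroup_mem_of_resolvent_mem (C : Set H) (hC : IsClosed C) (hC0 : (0 : H) ∈ C)
    (hadd : ∀ x ∈ C, ∀ y ∈ C, x + y ∈ C) (hsmul : ∀ (c : ℝ), 0 ≤ c → ∀ x ∈ C, c • x ∈ C)
    (hR : ∀ (l : ℝ) (hl : 0 < l), ∀ x ∈ C, hG.resolvent l hl x ∈ C)
    (t : NNReal) {f : H} (hf : f ∈ C) : hG.semigroup t f ∈ C := by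
  refine hC.mem_of_tendsto (hG.tendsto_yosidaExp t f) (Eventually.of_forall fun n => ?_)
  let _ : NormedAlgebra ℚ (H →L[ℝ] H) := NormedAlgebra.restrictScalars ℚ ℝ _
  set a : ℝ := (t : ℝ) * ((n : ℝ) + 1) with ha
  have ha0 : 0 ≤ a := by positivity
  have h1 : (t : ℝ) • hG.yosida n
      = algebraMap ℝ (H →L[ℝ] H) (-a) + a • hG.yosidaProj n := by
    rw [yosida, smul_smul, ← ha, Algebra.algebraMap_eq_smul_one]
    module
  rw [yosidaExp, h1, NormedSpace.exp_add_of_commute (Algebra.commute_algebraMap_left _ _),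
    ← NormedSpace.algebraMap_exp_comm, ← Real.exp_eq_exp_ℝ, Algebra.algebraMap_eq_smul_one,
    smul_mul_assoc, one_mul, smul_apply]
  refine hsmul _ (Real.exp_pos _).le _ ?_
  have hpow : ∀ k : ℕ, (hG.yosidaProj n ^ k) f ∈ C := by
    intro k
    induction k with
    | zero => simpa using hf
    | succ k ih =>
      rw [pow_succ', mul_apply_eq_comp]
      exact hsmul _ (by positivity) _ (hR _ _ _ ih)
  have hs := NormedSpace.exp_series_hasSum_exp' (𝕂 := ℝ) (a • hG.yosidaProj n)
  have hs2 := ((ContinuousLinearMap.apply ℝ H f).hasSum hs).tendsto_sum_nat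
  refine hC.mem_of_tendsto hs2 (Eventually.of_forall fun m => ?_)
  refine Finset.sum_induction _ (· ∈ C) (fun x y hx hy => hadd x hx y hy) hC0 fun k _ => ?_
  simp only [ContinuousLinearMap.apply_apply, smul_apply, smul_pow]
  exact hsmul _ (by positivity) _ (hsmul _ (by positivity) _ (hpow k))

end IsNonposSelfAdjoint

/-! ### General $C_0$-semigroups: local boundedness and continuity of orbits. -/

section C0

variable {S : NNReal → X →L[ℝ] X}

lemma IsC0Semigroup.tendsto_zero (hS : IsC0Semigroup S) (f : X) :
    Tendsto (fun t => S t f) (𝓝 0) (𝓝 f) := by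
  have h := hS.tendsto f
  have h2 : Tendsto (fun t => S t f) (pure 0) (𝓝 f) := by
    rw [tendsto_pure_left]
    intro s hs
    rw [hS.zero]
    exact mem_of_mem_nhds hs
  have h3 : (𝓝 (0 : NNReal)) = pure 0 ⊔ 𝓝[>] 0 := by
    rw [← nhdsWithin_singleton, ← nhdsWithin_union]
    have : ({0} ∪ Ioi 0 : Set NNReal) = univ := by
      ext x; simp
    rw [this, nhdsWithin_univ]
  rw [h3]
  exact h2.sup h

/-- `IsC0Semigroup` includes no norm bound. Were there none near $0$, some $t_n\to0$ would have
$\|S(t_n)\|>n$ although every orbit along $t_n$ converges, against Banach-Steinhaus. -/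
lemma IsC0Semigroup.exists_norm_le (hS : IsC0Semigroup S) :
    ∃ ε : NNReal, 0 < ε ∧ ∃ M : ℝ, ∀ t ≤ ε, ‖S t‖ ≤ M := by
  by_contra! hcon
  have h1 : ∀ n : ℕ, ∃ t : NNReal, t ≤ 1 / (n + 1) ∧ (n : ℝ) < ‖S t‖ := fun n =>
    hcon (1 / (n + 1)) (by positivity) n
  choose t ht hn using h1
  have ht0 : Tendsto t atTop (𝓝 0) :=
    tendsto_of_tendsto_of_tendsto_of_le_of_le tendsto_const_nhds
      (tendsto_one_div_add_atTop_nhds_zero_nat (𝕜 := NNReal)) (fun _ => zero_le) ht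
  obtain ⟨C, hC⟩ := banach_steinhaus (g := fun n => S (t n)) (fun x => by
    obtain ⟨B, hB⟩ := ((hS.tendsto_zero x).comp ht0).norm.bddAbove_range
    exact ⟨B, fun n => hB ⟨n, rfl⟩⟩)
  obtain ⟨n, hn'⟩ := exists_nat_gt C
  linarith [hn n, hC n]

/-- Right continuity is immediate from the semigroup law; continuity from the left requires a common
bound for $S(s)$ with $s$ just below $t$. It serves to compare an arbitrary semigroup with the
constructed one. -/
lemma IsC0Semigroup.continuous (hS : IsC0Semigroup S) (f : X) : Continuous fun t => S t f := by
  obtain ⟨ε, hε, M, hM⟩ := hS.exists_norm_le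
  rw [continuous_iff_continuousAt]
  intro t
  -- a common bound for `S s`, `s ≤ t`, `s` close to `t`
  obtain ⟨B, δ, hδ, hB⟩ : ∃ (B : ℝ) (δ : NNReal), 0 < δ ∧ ∀ s ≤ t, t - s ≤ δ → ‖S s‖ ≤ B := by
    by_cases h : t ≤ ε
    · exact ⟨M, 1, one_pos, fun s hs _ => hM s (hs.trans h)⟩
    · have h' : ε ≤ t := (not_le.1 h).le
      refine ⟨‖S (t - ε)‖ * M, ε, hε, fun s hs hsd => ?_⟩
      have hts : t ≤ ε + s := tsub_le_iff_right.1 hsd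
      have h1 : t - ε ≤ s := tsub_le_iff_left.2 hts
      have h2 : s = (t - ε) + (s - (t - ε)) := (add_tsub_cancel_of_le h1).symm
      rw [h2, hS.add]
      refine (ContinuousLinearMap.opNorm_comp_le _ _).trans ?_
      gcongr
      apply hM
      rw [tsub_le_iff_left, tsub_add_cancel_of_le h']
      exact hs
  rw [Metric.continuousAt_iff]
  intro r hr
  have hB0 : 0 ≤ B := (norm_nonneg _).trans (hB t le_rfl (by simp))
  set K := max B ‖S t‖ + 1
  have hK : 0 < K := by positivity
  obtain ⟨d, hd, hd'⟩ := Metric.tendsto_nhds_nhds.1 (hS.tendsto_zero f) (r / K) (by positivity)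
  refine ⟨min d δ, lt_min hd (by exact_mod_cast hδ), fun s hs => ?_⟩
  have key : ∀ a b : NNReal, a ≤ b → dist a b < d → ‖S a‖ ≤ K → dist (S a f) (S b f) < r := by
    intro a b hab hdab ha
    obtain ⟨c, rfl⟩ := exists_add_of_le hab
    have h1 : dist (S c f) f < r / K := by
      apply hd'
      rw [NNReal.dist_eq] at hdab ⊢
      simpa using hdab
    rw [hS.add, ContinuousLinearMap.comp_apply, dist_comm, dist_eq_norm, ← map_sub]
    refine ((S a).le_opNorm _).trans_lt ?_
    rw [dist_eq_norm, lt_div_iff₀ hK] at h1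
    refine lt_of_le_of_lt ?_ h1
    rw [mul_comm]
    gcongr
  rcases le_total s t with h | h
  · refine key s t h (hs.trans_le (min_le_left _ _)) ((hB s h ?_).trans ?_)
    · have := (hs.trans_le (min_le_right _ _)).le
      rw [NNReal.dist_eq, abs_sub_comm] at this
      rw [← NNReal.coe_le_coe, NNReal.coe_sub h]
      exact (le_abs_self _).trans this
    · exact (le_max_left _ _).trans (by linarith)
  · rw [dist_comm]
    rw [dist_comm] at hs
    exact key t s h (hs.trans_le (min_le_left _ _)) ((le_max_right B _).trans (by linarith))

end C0

/-! ### The generator, uniqueness of the semigroup, and the Cauchy problem. -/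

namespace IsNonposSelfAdjoint

variable {G : X → X → Prop} (hG : IsNonposSelfAdjoint G)

include hG

lemma isC0Semigroup : IsC0Semigroup hG.semigroup where
  zero := hG.semigroup_zero
  add := hG.semigroup_add
  tendsto f := by
    have := (hG.continuous_semigroup_apply f).tendsto 0
    rw [hG.semigroup_zero] at this
    exact this.mono_left nhdsWithin_le_nhds

lemma tendsto_generator {f h : X} (hf : G f h) :
    Tendsto (fun t : NNReal => (t : ℝ)⁻¹ • (hG.semigroup t f - f)) (𝓝[>] 0) (𝓝 h) := by
  have h1 := hG.hasDerivWithinAt_semigroup hf le_rfl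
  rw [hasDerivWithinAt_iff_tendsto_slope] at h1
  simp only [Real.toNNReal_zero, hG.semigroup_zero, ContinuousLinearMap.id_apply] at h1
  have h2 : Tendsto (fun t : NNReal => (t : ℝ)) (𝓝[>] 0) (𝓝[Ici 0 \ {0}] (0 : ℝ)) := by
    rw [tendsto_nhdsWithin_iff]
    refine ⟨(NNReal.continuous_coe.tendsto 0).mono_left nhdsWithin_le_nhds, ?_⟩
    filter_upwards [self_mem_nhdsWithin] with t ht
    exact ⟨t.2, fun h => (ne_of_gt ht) (by simpa using h)⟩
  refine (h1.comp h2).congr fun t => ?_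
  simp [slope, hG.semigroup_zero]

/-- For the converse direction: difference quotients of contractions are dissipative, so the
generator is a dissipative extension of $G$. As $1-G$ is onto, there is no room for a proper one:
with $g=(1-G)^{-1}(f-h)$, dissipativity at $f-g$ reads $\|f-g\|^2\le0$. -/
lemma isGenerator : IsGenerator hG.semigroup G := by
  intro f h
  refine ⟨hG.tendsto_generator, fun hlim => ?_⟩
  have hg := hG.resolvent_spec one_pos (f - h)
  set g := hG.resolvent 1 one_pos (f - h)
  have h1 := hlim.sub (hG.tendsto_generator hg)
  have h2 := h1.inner (𝕜 := ℝ) (tendsto_const_nhds (x := f - g))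
  have h3 : inner ℝ (h - ((1 : ℝ) • g - (f - h))) (f - g) ≤ 0 := by
    refine le_of_tendsto h2 (Eventually.of_forall fun t => ?_)
    rw [← smul_sub, inner_smul_left]
    refine mul_nonpos_of_nonneg_of_nonpos (by simp) ?_
    have h4 : hG.semigroup t f - f - (hG.semigroup t g - g)
        = hG.semigroup t (f - g) - (f - g) := by rw [map_sub]; abel
    rw [h4, inner_sub_left, real_inner_self_eq_norm_sq]
    have h5 := real_inner_le_norm (hG.semigroup t (f - g)) (f - g)
    have h6 := hG.norm_semigroup_apply_le t (f - g)
    nlinarith [norm_nonneg (f - g)]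
  have h4 : h - ((1 : ℝ) • g - (f - h)) = f - g := by module
  rw [h4, real_inner_self_eq_norm_sq] at h3
  have h5 : f - g = 0 := by
    rw [← norm_eq_zero]; nlinarith [norm_nonneg (f - g)]
  have h6 : f = g := sub_eq_zero.1 h5
  rw [← h6] at hg
  simpa using hg

/-- For $f$ in the domain the difference of the two orbits stays in the domain and solves $v'=Gv$,
so its norm cannot grow from $0$. Density of the domain does the rest. -/
lemma eq_of_generator {S : NNReal → X →L[ℝ] X} (hS : IsC0Semigroup S) (hgen : IsGenerator S G) :
    S = hG.semigroup := by
  have key : ∀ f h, G f h → ∀ t, S t f = hG.semigroup t f := by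
    intro f h hf
    -- the generator commutes with the semigroup
    have hSf : ∀ t, G (S t f) (S t h) := by
      intro t
      rw [hgen]
      have := ((S t).continuous.tendsto _).comp ((hgen f h).1 hf)
      refine this.congr fun s => ?_
      have h1 : S t (S s f) = S s (S t f) := by
        have h2 := hS.add t s
        rw [add_comm, hS.add] at h2
        exact congrArg (fun T : X →L[ℝ] X => T f) h2.symm
      simp only [Function.comp_apply, map_smul, map_sub, h1]
    -- The generator limit gives derivatives from the right only; these are enough for the
    -- comparison principle used below.
    have hder : ∀ t : ℝ, 0 ≤ t → HasDerivWithinAt (fun s : ℝ => S s.toNNReal f)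
        (S t.toNNReal h) (Ici t) t := by
      intro t ht
      rw [hasDerivWithinAt_iff_tendsto_slope]
      have h1 := (hgen _ _).1 (hSf t.toNNReal)
      have h2 : Tendsto (fun s : ℝ => (s - t).toNNReal) (𝓝[Ici t \ {t}] t) (𝓝[>] 0) := by
        rw [tendsto_nhdsWithin_iff]
        refine ⟨?_, ?_⟩
        · have : Continuous fun s : ℝ => (s - t).toNNReal := by fun_prop
          simpa using (this.tendsto t).mono_left nhdsWithin_le_nhds
        · filter_upwards [self_mem_nhdsWithin] with s hs
          simpa using lt_of_le_of_ne hs.1 (Ne.symm hs.2)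
      refine (h1.comp h2).congr' ?_
      filter_upwards [self_mem_nhdsWithin] with s hs
      have hs1 : t ≤ s := hs.1
      have h3 : s.toNNReal = (s - t).toNNReal + t.toNNReal := by
        rw [← Real.toNNReal_add (by linarith) ht]; congr 1; ring
      rw [slope_def_module, h3, hS.add, Function.comp_apply, Real.coe_toNNReal _ (by linarith)]
      rfl
    intro t
    set v : ℝ → X := fun s => S s.toNNReal f - hG.semigroup s.toNNReal f
    have hv : ∀ s ∈ Ico (0 : ℝ) t, HasDerivWithinAt (fun s => ‖v s‖ ^ 2)
        (2 * inner ℝ (v s) (S s.toNNReal h - hG.semigroup s.toNNReal h)) (Ici s) s := by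
      intro s hs
      exact ((hder s hs.1).sub ((hG.hasDerivWithinAt_semigroup hf hs.1).mono
        (Ici_subset_Ici.2 hs.1))).norm_sq
    have hc : Continuous v := ((hS.continuous f).comp continuous_real_toNNReal).sub
      (hG.continuous_semigroup_toNNReal f)
    have h0 : ‖v 0‖ ^ 2 ≤ 0 := by
      simp [v, hS.zero, hG.semigroup_zero]
    have h1 := image_le_of_deriv_right_le_deriv_boundary (B := fun _ => 0) (B' := fun _ => 0)
      (hc.norm.pow 2).continuousOn hv h0 continuousOn_const
      (fun s _ => (hasDerivWithinAt_const s _ _)) (fun s hs => by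
        have := hG.nonpos (hG.sub (hSf s.toNNReal) (hG.semigroup_graph hf s.toNNReal))
        rw [real_inner_comm] at this
        linarith) (right_mem_Icc.2 t.2)
    have h2 : ‖v t‖ = 0 := by
      have : ‖v t‖ ^ 2 = 0 := le_antisymm h1 (by positivity)
      simpa using this
    have h3 := sub_eq_zero.1 (norm_eq_zero.1 h2)
    simpa using h3
  ext1 t
  have := Continuous.ext_on hG.dense_domain (S t).continuous (hG.semigroup t).continuous
    (fun f ⟨h, hf⟩ => key f h hf t)
  exact ContinuousLinearMap.ext fun f => congrFun this f

/-- The source cancels in the difference, whose squared norm is nonincreasing because $G\le0$;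
continuity at $0$ brings in the initial value. -/
lemma cauchy_unique {f : X} {p q : ℝ → X} (hp : ContinuousOn p (Ici 0))
    (hq : ContinuousOn q (Ici 0)) (h0 : p 0 = q 0)
    (hp' : ∀ t : ℝ, 0 < t → ∃ d : X, HasDerivAt p d t ∧ G (p t) (d - f))
    (hq' : ∀ t : ℝ, 0 < t → ∃ d : X, HasDerivAt q d t ∧ G (q t) (d - f)) :
    EqOn p q (Ici 0) := by
  have hd : ∀ t : ℝ, 0 < t → ∃ d : ℝ, d ≤ 0 ∧ HasDerivAt (fun s => ‖p s - q s‖ ^ 2) d t := by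
    intro t ht
    obtain ⟨d, h1, h2⟩ := hp' t ht
    obtain ⟨e, h3, h4⟩ := hq' t ht
    refine ⟨_, ?_, hasDerivAt_norm_sq (h1.sub h3)⟩
    have := hG.nonpos (hG.sub h2 h4)
    rw [sub_sub_sub_cancel_right] at this
    linarith
  have hanti : AntitoneOn (fun s => ‖p s - q s‖ ^ 2) (Ici 0) := by
    refine antitoneOn_of_deriv_nonpos (convex_Ici 0) ((hp.sub hq).norm.pow 2) ?_ ?_
    · intro t ht
      rw [interior_Ici] at ht
      obtain ⟨d, _, h⟩ := hd t ht
      exact h.differentiableAt.differentiableWithinAt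
    · intro t ht
      rw [interior_Ici] at ht
      obtain ⟨d, hd0, h⟩ := hd t ht
      rw [h.deriv]
      exact hd0
  intro t ht
  have h1 := hanti self_mem_Ici ht ht
  simp only [h0, sub_self, norm_zero, ne_eq, OfNat.ofNat_ne_zero, not_false_eq_true,
    zero_pow] at h1
  have h2 : ‖p t - q t‖ ^ 2 = 0 := le_antisymm h1 (by positivity)
  exact sub_eq_zero.1 (norm_eq_zero.1 (by simpa using h2))

/-- `S(t) x + ∫₀ᵗ S(s) f ds` solves the Cauchy problem `p' = G p + f`, `p(0) = x`. -/
lemma cauchy_solution (f x : X) {t : ℝ} (ht : 0 < t) :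
    ∃ d : X, HasDerivAt (fun t : ℝ => hG.semigroup t.toNNReal x +
        ∫ s in (0 : ℝ)..t, hG.semigroup s.toNNReal f) d t ∧
      G (hG.semigroup t.toNNReal x + ∫ s in (0 : ℝ)..t, hG.semigroup s.toNNReal f) (d - f) := by
  obtain ⟨k, hk, hk'⟩ := hG.hasDerivAt_semigroup ht x
  refine ⟨_, hk'.add (hG.hasDerivAt_integral_semigroup f t), ?_⟩
  rw [add_sub_assoc]
  exact hG.add hk (hG.graph_integral_semigroup f ht.le)

end IsNonposSelfAdjoint

/-! ### Primitives on the circle -/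

lemma continuous_of_lift {f : Circ → ℝ} (h : Continuous fun t : ℝ => f (t : Circ)) :
    Continuous f :=
  (QuotientAddGroup.isQuotientMap_mk (N := AddSubgroup.zmultiples (2 * Real.pi))).continuous_iff.2 h

lemma continuous_lift {f : Circ → ℝ} (h : Continuous f) : Continuous fun t : ℝ => f (t : Circ) :=
  h.comp (AddCircle.continuous_mk' _)

lemma integrable_of_continuous {f : Circ → ℝ} (h : Continuous f) : Integrable f := by
  rw [← integrableOn_univ]
  exact h.continuousOn.integrableOn_compact isCompact_univ

lemma integral_circ (f : Circ → ℝ) : ∫ θ, f θ = ∫ t in (0 : ℝ)..(2 * Real.pi), f (t : Circ) := by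
  rw [← AddCircle.intervalIntegral_preimage (2 * Real.pi) 0, zero_add]

lemma ae_lift {P : Circ → Prop} (h : ∀ᵐ θ, P θ) : ∀ᵐ t : ℝ, P (t : Circ) := by
  rw [← Measure.restrict_univ (μ := (volume : Measure ℝ)),
    ← iUnion_Ioc_add_zsmul Real.two_pi_pos 0, ae_restrict_iUnion_iff]
  intro n
  have h1 := (AddCircle.measurePreserving_mk (2 * Real.pi) (0 + n • (2 * Real.pi)))
  have h2 : 0 + (n + 1) • (2 * Real.pi) = 0 + n • (2 * Real.pi) + 2 * Real.pi := by
    rw [add_smul, one_smul, add_assoc]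
  rw [h2]
  exact h1.quasiMeasurePreserving.ae h

lemma intervalIntegrable_lift {g : Circ → ℝ} (hg : Integrable g) (x y : ℝ) :
    IntervalIntegrable (fun t : ℝ => g (t : Circ)) volume x y := by
  have hper : Function.Periodic (fun t : ℝ => g (t : Circ)) (2 * Real.pi) := fun t => by
    simp
  refine hper.intervalIntegrable (t := 0) Real.two_pi_pos.ne' ?_ x y
  rw [intervalIntegrable_iff, zero_add, uIoc_of_le Real.two_pi_pos.le]
  have h1 := (AddCircle.measurePreserving_mk (2 * Real.pi) 0)
  rw [zero_add] at h1
  exact h1.integrable_comp_of_integrable hg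

/-- `F` is a primitive of the integrable function `g` on the circle. -/
def HasPrim (F g : Circ → ℝ) : Prop :=
  Integrable g ∧ ∀ x y : ℝ, F (y : Circ) - F (x : Circ) = ∫ t in x..y, g (t : Circ)

namespace HasPrim

variable {F g K k : Circ → ℝ}

lemma continuous (h : HasPrim F g) : Continuous F := by
  apply continuous_of_lift
  have h1 : (fun t : ℝ => F (t : Circ)) = fun t => F ((0 : ℝ) : Circ) + ∫ s in (0 : ℝ)..t, g s := by
    ext t; rw [← h.2]; abel
  rw [h1]
  exact continuous_const.add (intervalIntegral.continuous_primitive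
    (fun a b => intervalIntegrable_lift h.1 a b) 0)

lemma congr_ae {g' : Circ → ℝ} (h : HasPrim F g) (hg : g =ᵐ[volume] g') : HasPrim F g' := by
  refine ⟨h.1.congr hg, fun x y => ?_⟩
  rw [h.2]
  refine intervalIntegral.integral_congr_ae ?_
  filter_upwards [ae_lift hg] with t ht _ using ht

lemma add_const (h : HasPrim F g) (c : ℝ) : HasPrim (fun θ => F θ + c) g :=
  ⟨h.1, fun x y => by rw [← h.2]; ring⟩

lemma absolutelyContinuous (h : HasPrim F g) (x y : ℝ) :
    AbsolutelyContinuousOnInterval (fun t : ℝ => F (t : Circ)) x y := by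
  have h1 := (intervalIntegrable_lift h.1 x y).absolutelyContinuousOnInterval_intervalIntegral
    (c := x) left_mem_uIcc
  have h2 : AbsolutelyContinuousOnInterval (fun _ : ℝ => F (x : Circ)) x y :=
    ContDiffOn.absolutelyContinuousOnInterval contDiffOn_const
  have h3 : (fun t : ℝ => F (t : Circ))
      = (fun t => ∫ s in x..t, g (s : Circ)) + fun _ : ℝ => F (x : Circ) := by
    ext t
    rw [Pi.add_apply, ← h.2]; abel
  rw [h3]
  exact h1.add h2

lemma ae_hasDerivAt (h : HasPrim F g) :
    ∀ᵐ t : ℝ, HasDerivAt (fun t : ℝ => F (t : Circ)) (g (t : Circ)) t := by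
  have hl : LocallyIntegrable (fun t : ℝ => g (t : Circ)) volume := fun x =>
    ⟨Icc (x - 1) (x + 1), Icc_mem_nhds (by linarith) (by linarith),
      (intervalIntegrable_iff_integrableOn_Icc_of_le (by linarith)).1
        (intervalIntegrable_lift h.1 _ _)⟩
  filter_upwards [_root_.LocallyIntegrable.ae_hasDerivAt_integral hl] with t ht
  refine ((ht 0).const_add (F ((0 : ℝ) : Circ))).congr_of_eventuallyEq
    (Eventually.of_forall fun s => ?_)
  simp only
  rw [← h.2]; ring

lemma _root_.Pollution.integrable_continuous_mul {f k : Circ → ℝ} (hf : Continuous f)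
    (hk : Integrable k) : Integrable (fun θ => f θ * k θ) := by
  rw [← integrableOn_univ] at hk ⊢
  exact hk.continuousOn_mul hf.continuousOn isCompact_univ

lemma integrable_mul (h : HasPrim F g) {k : Circ → ℝ} (hk : Integrable k) :
    Integrable (fun θ => F θ * k θ) :=
  integrable_continuous_mul h.continuous hk

lemma mul (h : HasPrim F g) (h' : HasPrim K k) :
    HasPrim (fun θ => F θ * K θ) (fun θ => F θ * k θ + g θ * K θ) := by
  refine ⟨(h.integrable_mul h'.1).add
    ((h'.integrable_mul h.1).congr (ae_of_all _ fun θ => mul_comm _ _)), fun x y => ?_⟩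
  · rw [← (h.absolutelyContinuous x y).integral_deriv_mul_eq_sub (h'.absolutelyContinuous x y)]
    refine intervalIntegral.integral_congr_ae ?_
    filter_upwards [h.ae_hasDerivAt, h'.ae_hasDerivAt] with t h1 h2 _
    rw [h1.deriv, h2.deriv, add_comm]

lemma integral_eq_zero (h : HasPrim F g) : ∫ θ, g θ = 0 := by
  rw [integral_circ, ← h.2]
  simp [AddCircle.coe_period]

lemma integral_by_parts (h : HasPrim F g) (h' : HasPrim K k) :
    ∫ θ, F θ * k θ = -∫ θ, g θ * K θ := by
  have h1 := (h.mul h').integral_eq_zero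
  rw [integral_add (h.integrable_mul h'.1)
    ((h'.integrable_mul h.1).congr (ae_of_all _ fun θ => mul_comm _ _))] at h1
  linarith

end HasPrim

/-- Zero mean is exactly what makes the primitive on the line periodic, so that it descends to the
circle. -/
lemma exists_hasPrim {g : Circ → ℝ} (hg : Integrable g) (h0 : ∫ θ, g θ = 0) :
    ∃ F, HasPrim F g := by
  have hi := intervalIntegrable_lift hg
  have hper : Function.Periodic (fun x : ℝ => ∫ t in (0 : ℝ)..x, g (t : Circ)) (2 * Real.pi) := by
    intro x
    change ∫ t in (0 : ℝ)..(x + 2 * Real.pi), g (t : Circ) = ∫ t in (0 : ℝ)..x, g (t : Circ)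
    rw [← intervalIntegral.integral_add_adjacent_intervals (hi 0 x) (hi _ _),
      AddCircle.intervalIntegral_preimage (2 * Real.pi) x g, h0, add_zero]
  refine ⟨hper.lift, hg, fun x y => ?_⟩
  change hper.lift ((y : ℝ) : AddCircle (2 * Real.pi)) - hper.lift ((x : ℝ) : AddCircle (2 * Real.pi)) = _
  rw [Function.Periodic.lift_coe, Function.Periodic.lift_coe]
  exact intervalIntegral.integral_interval_sub_left (hi _ _) (hi _ _)

lemma circDeriv_coe (φ : Circ → ℝ) (t : ℝ) :
    circDeriv φ (t : Circ) = deriv (fun s : ℝ => φ (s : Circ)) t := by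
  have := deriv_comp_const_add (fun s : ℝ => φ (s : Circ)) t 0
  simp only [add_zero] at this
  rw [← this]
  rfl

lemma CircContDiff.continuous {n : WithTop ℕ∞} {φ : Circ → ℝ} (h : CircContDiff n φ) :
    Continuous φ :=
  continuous_of_lift (ContDiff.continuous h)

lemma CircContDiff.continuous_circDeriv {φ : Circ → ℝ} (h : CircContDiff 1 φ) :
    Continuous (circDeriv φ) := by
  apply continuous_of_lift
  simp_rw [circDeriv_coe]
  exact ContDiff.continuous_deriv_one h

lemma CircContDiff.hasPrim {φ : Circ → ℝ} (h : CircContDiff 1 φ) : HasPrim φ (circDeriv φ) := by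
  refine ⟨integrable_of_continuous h.continuous_circDeriv, fun x y => ?_⟩
  simp_rw [circDeriv_coe]
  rw [intervalIntegral.integral_deriv_eq_sub]
  · intro t _
    exact ContDiff.differentiable h one_ne_zero t
  · exact (ContDiff.continuous_deriv_one h).intervalIntegrable _ _

lemma CircContDiff.of_top {φ : Circ → ℝ} (h : CircContDiff ((⊤ : ℕ∞) : WithTop ℕ∞) φ) :
    CircContDiff 1 φ :=
  ContDiff.of_le h (by exact_mod_cast le_top)

/-- Smooth functions as a subalgebra of `C(S¹; ℝ)`. -/
def smoothSubalgebra : Subalgebra ℝ C(Circ, ℝ) where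
  carrier := {f | CircContDiff ((⊤ : ℕ∞) : WithTop ℕ∞) f}
  mul_mem' := fun {f g} (hf : CircContDiff ((⊤ : ℕ∞) : WithTop ℕ∞) f)
      (hg : CircContDiff ((⊤ : ℕ∞) : WithTop ℕ∞) g) => by
    change ContDiff ℝ ((⊤ : ℕ∞) : WithTop ℕ∞) (fun t : ℝ => f (t : Circ) * g (t : Circ))
    exact ContDiff.mul hf hg
  add_mem' := fun {f g} (hf : CircContDiff ((⊤ : ℕ∞) : WithTop ℕ∞) f)
      (hg : CircContDiff ((⊤ : ℕ∞) : WithTop ℕ∞) g) => by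
    change ContDiff ℝ ((⊤ : ℕ∞) : WithTop ℕ∞) (fun t : ℝ => f (t : Circ) + g (t : Circ))
    exact ContDiff.add hf hg
  algebraMap_mem' := fun c => by
    change ContDiff ℝ ((⊤ : ℕ∞) : WithTop ℕ∞) (fun _ : ℝ => c)
    exact contDiff_const

/-- Stone-Weierstrass: `Real.Angle` is the same quotient as `Circ`, and its cosine and sine together
separate points. -/
lemma smoothSubalgebra_topologicalClosure : smoothSubalgebra.topologicalClosure = ⊤ := by
  apply ContinuousMap.subalgebra_topologicalClosure_eq_top_of_separatesPoints
  intro x y hxy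
  by_contra! hcon
  apply hxy
  have hc : Real.Angle.cos x = Real.Angle.cos y :=
    hcon _ ⟨⟨Real.Angle.cos, Real.Angle.continuous_cos⟩,
      (by
        change ContDiff ℝ ((⊤ : ℕ∞) : WithTop ℕ∞) Real.cos
        exact Real.contDiff_cos), rfl⟩
  have hs : Real.Angle.sin x = Real.Angle.sin y :=
    hcon _ ⟨⟨Real.Angle.sin, Real.Angle.continuous_sin⟩,
      (by
        change ContDiff ℝ ((⊤ : ℕ∞) : WithTop ℕ∞) Real.sin
        exact Real.contDiff_sin), rfl⟩
  induction x using QuotientAddGroup.induction_on with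
  | H s =>
    induction y using QuotientAddGroup.induction_on with
    | H t => exact Real.Angle.cos_sin_inj hc hs

/-- Smooth functions are uniformly dense in the continuous ones, and these are dense in $L^2$. -/
lemma ae_eq_zero_of_forall_smooth {h : Circ → ℝ} (hh : MemLp h 2 volume)
    (h0 : ∀ φ : Circ → ℝ, CircContDiff ((⊤ : ℕ∞) : WithTop ℕ∞) φ → ∫ θ, h θ * φ θ = 0) :
    h =ᵐ[volume] 0 := by
  set T := ContinuousMap.toLp (E := ℝ) 2 (volume : Measure Circ) ℝ
  have hT : ∀ φ : C(Circ, ℝ), inner ℝ (hh.toLp h) (T φ) = ∫ θ, h θ * φ θ := by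
    intro φ
    rw [L2.inner_def]
    refine integral_congr_ae ?_
    filter_upwards [hh.coeFn_toLp, ContinuousMap.coeFn_toLp (p := 2) (𝕜 := ℝ) volume φ] with θ h1 h2
    rw [h1, h2]
    simp [mul_comm]
  have h1 : ∀ φ : C(Circ, ℝ), inner ℝ (hh.toLp h) (T φ) = 0 := by
    have hcl : IsClosed {φ : C(Circ, ℝ) | inner ℝ (hh.toLp h) (T φ) = 0} :=
      isClosed_eq (continuous_const.inner T.continuous) continuous_const
    have h2 : (smoothSubalgebra : Set C(Circ, ℝ)) ⊆ {φ | inner ℝ (hh.toLp h) (T φ) = 0} :=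
      fun φ hφ => (hT φ).trans (h0 φ hφ)
    have h3 := closure_minimal h2 hcl
    intro φ
    apply h3
    have h4 : φ ∈ smoothSubalgebra.topologicalClosure := by
      rw [smoothSubalgebra_topologicalClosure]; trivial
    exact h4
  have h2 : hh.toLp h = 0 := by
    have hd : DenseRange T := ContinuousMap.toLp_denseRange ℝ volume ℝ (by norm_num)
    have h3 : ∀ v : X, inner ℝ (hh.toLp h) v = 0 := fun v =>
      congrFun (hd.equalizer (g := fun v => inner ℝ (hh.toLp h) v) (h := fun _ => (0 : ℝ))
        (by fun_prop) (by fun_prop) (funext h1)) v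
    exact inner_self_eq_zero.1 (h3 _)
  have h3 := hh.coeFn_toLp
  rw [h2] at h3
  exact h3.symm.trans (Lp.coeFn_zero _ _ _)

lemma memLp_two_of_continuous {f : Circ → ℝ} (h : Continuous f) : MemLp f 2 volume := by
  obtain ⟨C, hC⟩ := isCompact_univ.exists_bound_of_continuousOn h.continuousOn
  exact MemLp.of_bound h.aestronglyMeasurable C (ae_of_all _ fun θ => hC θ (mem_univ _))

lemma volume_circ_real : (volume : Measure Circ).real univ = 2 * Real.pi := by
  rw [Measure.real, AddCircle.measure_univ, ENNReal.toReal_ofReal Real.two_pi_pos.le]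

lemma HasPrim.hasWeakDeriv {f F g : Circ → ℝ} (h : HasPrim F g) (hf : f =ᵐ[volume] F) :
    HasWeakDeriv f g := by
  intro φ hφ
  rw [← h.integral_by_parts hφ.of_top.hasPrim]
  refine integral_congr_ae ?_
  filter_upwards [hf] with θ hθ
  rw [hθ]

/-- Du Bois-Reymond: a function with a weak derivative has an absolutely continuous version. -/
lemma HasWeakDeriv.exists_hasPrim {f g : Circ → ℝ} (h : HasWeakDeriv f g) (hf : MemLp f 2 volume)
    (hg : MemLp g 2 volume) : ∃ F, HasPrim F g ∧ f =ᵐ[volume] F := by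
  have hgi : Integrable g := hg.integrable (by norm_num)
  have hfi : Integrable f := hf.integrable (by norm_num)
  have h0 : ∫ θ, g θ = 0 := by
    have := h (fun _ => 1) contDiff_const
    simp only [circDeriv, deriv_const, mul_zero, integral_zero, mul_one] at this
    linarith
  obtain ⟨F, hF⟩ := Pollution.exists_hasPrim hgi h0
  have hFi := integrable_of_continuous hF.continuous
  set c' := (2 * Real.pi)⁻¹ * ∫ θ, (f θ - F θ) with hc'
  have key : (fun θ => f θ - F θ - c') =ᵐ[volume] 0 := by
    refine ae_eq_zero_of_forall_smooth
      ((hf.sub (memLp_two_of_continuous hF.continuous)).sub (memLp_const c')) fun ψ hψ => ?_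
    have hψi := integrable_of_continuous hψ.continuous
    set c := (2 * Real.pi)⁻¹ * ∫ θ, ψ θ with hc
    have hψc : Integrable fun θ => ψ θ - c := hψi.sub (integrable_const c)
    -- Minus its mean, an arbitrary smooth $\psi$ is the derivative of an admissible test function
    -- $\Phi$. Testing with $\Phi$ shows that $f-F$ is orthogonal to $\psi-c$, so $f-F$ equals its
    -- mean $c'$.
    obtain ⟨Φ, hΦ⟩ := Pollution.exists_hasPrim hψc (by
      rw [integral_sub hψi (integrable_const c), integral_const, volume_circ_real, hc, smul_eq_mul,
        mul_inv_cancel_left₀ Real.two_pi_pos.ne', sub_self])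
    have hΦ' : ∀ t : ℝ, HasDerivAt (fun s : ℝ => Φ (s : Circ)) (ψ (t : Circ) - c) t := by
      intro t
      have hcont : Continuous fun s : ℝ => ψ (s : Circ) - c :=
        (continuous_lift hψ.continuous).sub continuous_const
      refine ((hcont.integral_hasStrictDerivAt 0 t).hasDerivAt.const_add
        (Φ ((0 : ℝ) : Circ))).congr_of_eventuallyEq (Eventually.of_forall fun s => ?_)
      have := hΦ.2 0 s
      simp only at this ⊢
      rw [← this]; ring
    have hΦs : CircContDiff ((⊤ : ℕ∞) : WithTop ℕ∞) Φ := by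
      rw [CircContDiff, contDiff_infty_iff_deriv]
      refine ⟨fun t => (hΦ' t).differentiableAt, ?_⟩
      rw [show deriv (fun t : ℝ => Φ (t : Circ)) = fun t : ℝ => ψ (t : Circ) - c from
        funext fun t => (hΦ' t).deriv]
      exact ContDiff.sub hψ contDiff_const
    have hΦd : circDeriv Φ = fun θ => ψ θ - c := by
      ext θ
      induction θ using QuotientAddGroup.induction_on with
      | H t => exact (circDeriv_coe Φ t).trans (hΦ' t).deriv
    have h1 := h Φ hΦs
    rw [hΦd, ← hF.integral_by_parts hΦ] at h1
    have hfc : Integrable fun θ => f θ * (ψ θ - c) :=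
      (HasPrim.integrable_mul (F := fun θ => ψ θ - c) (g := circDeriv ψ)
        (hψ.of_top.hasPrim.add_const (-c)) hfi).congr (ae_of_all _ fun θ => mul_comm _ _)
    have hFc : Integrable fun θ => F θ * (ψ θ - c) := hF.integrable_mul hψc
    have e1 : ∀ θ, (f θ - F θ - c') * ψ θ
        = (f θ * (ψ θ - c) - F θ * (ψ θ - c)) + (c * (f θ - F θ) - c' * ψ θ) := fun θ => by ring
    simp_rw [e1]
    have i1 : Integrable fun θ => c * (f θ - F θ) := (hfi.sub hFi).const_mul c
    have i2 : Integrable fun θ => c' * ψ θ := hψi.const_mul c'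
    have i3 : Integrable fun θ => f θ * (ψ θ - c) - F θ * (ψ θ - c) := hfc.sub hFc
    have i4 : Integrable fun θ => c * (f θ - F θ) - c' * ψ θ := i1.sub i2
    rw [integral_add i3 i4, integral_sub hfc hFc, integral_sub i1 i2, h1,
      integral_const_mul, integral_const_mul, hc, hc']
    ring
  refine ⟨_, hF.add_const c', ?_⟩
  filter_upwards [key] with θ hθ
  simp only [Pi.zero_apply] at hθ
  linarith

/-! ### Multiplication operators on `L²(S¹)` -/

/-- `m` is measurable and bounded. -/
def IsBddMeas (m : Circ → ℝ) : Prop := Measurable m ∧ ∃ C, ∀ θ, ‖m θ‖ ≤ C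

lemma isBddMeas_of_continuous {m : Circ → ℝ} (h : Continuous m) : IsBddMeas m := by
  obtain ⟨C, hC⟩ := isCompact_univ.exists_bound_of_continuousOn h.continuousOn
  exact ⟨h.measurable, C, fun θ => hC θ (mem_univ _)⟩

lemma IsBddMeas.memLp_mul {m f : Circ → ℝ} (hm : IsBddMeas m) (hf : MemLp f 2 volume) :
    MemLp (fun θ => m θ * f θ) 2 volume := by
  obtain ⟨C, hC⟩ := hm.2
  refine hf.of_le_mul (c := C) (hm.1.aestronglyMeasurable.mul hf.1) (ae_of_all _ fun θ => ?_)
  rw [norm_mul]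
  exact mul_le_mul_of_nonneg_right (hC θ) (norm_nonneg _)

lemma toX_ae {f : Circ → ℝ} (hf : MemLp f 2 volume) : toX f =ᵐ[volume] f := by
  rw [toX, dif_pos hf]
  exact hf.coeFn_toLp

lemma IsBddMeas.mulX_ae {m : Circ → ℝ} (hm : IsBddMeas m) (f : X) :
    mulX m f =ᵐ[volume] fun θ => m θ * f θ :=
  toX_ae (hm.memLp_mul (Lp.memLp f))

/-- Multiplication by a bounded measurable function as a bounded operator. -/
def mulXL {m : Circ → ℝ} (hm : IsBddMeas m) : X →L[ℝ] X :=
  LinearMap.mkContinuous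
    { toFun := mulX m
      map_add' := fun f g => by
        ext1
        filter_upwards [hm.mulX_ae (f + g), hm.mulX_ae f, hm.mulX_ae g, Lp.coeFn_add f g,
          Lp.coeFn_add (mulX m f) (mulX m g)] with θ h1 h2 h3 h4 h5
        rw [h1, h5, Pi.add_apply, h2, h3, h4, Pi.add_apply, mul_add]
      map_smul' := fun c f => by
        ext1
        filter_upwards [hm.mulX_ae (c • f), hm.mulX_ae f, Lp.coeFn_smul c f,
          Lp.coeFn_smul c (mulX m f)] with θ h1 h2 h4 h5
        rw [h1, RingHom.id_apply, h5, Pi.smul_apply, h2, h4, Pi.smul_apply, smul_eq_mul, smul_eq_mul]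
        ring } (hm.2.choose) (fun f => by
      refine Lp.norm_le_mul_norm_of_ae_le_mul ?_
      filter_upwards [hm.mulX_ae f] with θ h1
      change ‖(mulX m f : Circ → ℝ) θ‖ ≤ _
      rw [h1, norm_mul]
      exact mul_le_mul_of_nonneg_right (hm.2.choose_spec θ) (norm_nonneg _))

@[simp] lemma mulXL_apply {m : Circ → ℝ} (hm : IsBddMeas m) (f : X) : mulXL hm f = mulX m f := rfl

lemma inner_X (f g : X) : inner ℝ f g = ∫ θ, f θ * g θ := by
  rw [L2.inner_def]
  refine integral_congr_ae (ae_of_all _ fun θ => ?_)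
  simp [mul_comm]

lemma integrable_mul_X (f g : X) : Integrable fun θ => f θ * g θ := by
  have := L2.integrable_inner (𝕜 := ℝ) g f
  simpa using this

lemma inner_mulX {m : Circ → ℝ} (hm : IsBddMeas m) (f g : X) :
    inner ℝ (mulX m f) g = ∫ θ, m θ * f θ * g θ := by
  rw [inner_X]
  refine integral_congr_ae ?_
  filter_upwards [hm.mulX_ae f] with θ h
  rw [h]

lemma inner_mulX_self_ge {m : Circ → ℝ} (hm : IsBddMeas m) {c : ℝ} (hc : ∀ θ, c ≤ m θ) (f : X) :
    c * ‖f‖ ^ 2 ≤ inner ℝ (mulX m f) f := by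
  rw [← real_inner_self_eq_norm_sq, inner_X, inner_X, ← integral_const_mul]
  refine integral_mono_ae ((integrable_mul_X f f).const_mul c) (integrable_mul_X _ _) ?_
  filter_upwards [hm.mulX_ae f] with θ h
  simp only [h]
  nlinarith [mul_le_mul_of_nonneg_right (hc θ) (mul_self_nonneg (f θ))]

/-! ### A Lax-Milgram argument on a closed subspace of a product -/

/-- Meant for $V=\{(f,f')\}$, on which the norm of the product is the $W^{1,2}$ norm: coercivity of
the two multiplication operators is coercivity of the energy form. -/
lemma exists_weak_solution {E : Type*} [NormedAddCommGroup E] [InnerProductSpace ℝ E]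
    [CompleteSpace E] (V : Submodule ℝ (WithLp 2 (E × E))) (hV : IsClosed (V : Set (WithLp 2 (E × E))))
    (A₁ A₂ : E →L[ℝ] E) {c : ℝ} (hc : 0 < c) (h₁ : ∀ x, c * ‖x‖ ^ 2 ≤ inner ℝ (A₁ x) x)
    (h₂ : ∀ x, c * ‖x‖ ^ 2 ≤ inner ℝ (A₂ x) x) (h : E) :
    ∃ u ∈ V, ∀ v ∈ V, inner ℝ (A₁ u.fst) v.fst + inner ℝ (A₂ u.snd) v.snd = inner ℝ h v.fst := by
  have : CompleteSpace V := hV.completeSpace_coe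
  have hfst : ∀ u : WithLp 2 (E × E), ‖u.fst‖ ≤ ‖u‖ := fun u => by
    have := WithLp.prod_norm_sq_eq_of_L2 u
    nlinarith [norm_nonneg u, norm_nonneg u.fst, sq_nonneg ‖u.snd‖]
  have hsnd : ∀ u : WithLp 2 (E × E), ‖u.snd‖ ≤ ‖u‖ := fun u => by
    have := WithLp.prod_norm_sq_eq_of_L2 u
    nlinarith [norm_nonneg u, norm_nonneg u.snd, sq_nonneg ‖u.fst‖]
  let B₀ : V →ₗ[ℝ] V →ₗ[ℝ] ℝ := LinearMap.mk₂ ℝ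
    (fun u v => inner ℝ (A₁ u.1.fst) v.1.fst + inner ℝ (A₂ u.1.snd) v.1.snd)
    (fun u u' v => by simp [inner_add_left]; ring) (fun c u v => by simp [inner_smul_left]; ring)
    (fun u v v' => by simp [inner_add_right]; ring) (fun c u v => by simp [inner_smul_right]; ring)
  let B : V →L[ℝ] V →L[ℝ] ℝ := B₀.mkContinuous₂ (‖A₁‖ + ‖A₂‖) (fun u v => by
    change ‖inner ℝ (A₁ u.1.fst) v.1.fst + inner ℝ (A₂ u.1.snd) v.1.snd‖ ≤ _
    have e1 : ‖inner ℝ (A₁ u.1.fst) v.1.fst‖ ≤ ‖A₁‖ * ‖u‖ * ‖v‖ := by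
      refine (norm_inner_le_norm _ _).trans ?_
      gcongr
      · exact (A₁.le_opNorm _).trans (by gcongr; exact hfst _)
      · exact hfst _
    have e2 : ‖inner ℝ (A₂ u.1.snd) v.1.snd‖ ≤ ‖A₂‖ * ‖u‖ * ‖v‖ := by
      refine (norm_inner_le_norm _ _).trans ?_
      gcongr
      · exact (A₂.le_opNorm _).trans (by gcongr; exact hsnd _)
      · exact hsnd _
    refine (norm_add_le _ _).trans ((add_le_add e1 e2).trans_eq (by ring)))
  have hB : IsCoercive B := by
    refine ⟨c, hc, fun u => ?_⟩
    change _ ≤ inner ℝ (A₁ u.1.fst) u.1.fst + inner ℝ (A₂ u.1.snd) u.1.snd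
    have e := WithLp.prod_norm_sq_eq_of_L2 u.1
    have e' : c * ‖u‖ * ‖u‖ = c * ‖u.1.fst‖ ^ 2 + c * ‖u.1.snd‖ ^ 2 := by
      rw [← mul_add, ← e, mul_assoc, ← sq]; rfl
    rw [e']
    exact add_le_add (h₁ _) (h₂ _)
  let ℓ : V →L[ℝ] ℝ := LinearMap.mkContinuous
    { toFun := fun v => inner ℝ h v.1.fst
      map_add' := fun v v' => by simp [inner_add_right]
      map_smul' := fun c v => by simp [inner_smul_right] } ‖h‖ (fun v =>
        (norm_inner_le_norm _ _).trans (by gcongr; exact hfst _))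
  refine ⟨(hB.continuousLinearEquivOfBilin.symm ((InnerProductSpace.toDual ℝ V).symm ℓ)).1,
    Subtype.property _, fun v hv => ?_⟩
  have := hB.continuousLinearEquivOfBilin_apply
    (hB.continuousLinearEquivOfBilin.symm ((InnerProductSpace.toDual ℝ V).symm ℓ)) ⟨v, hv⟩
  rw [ContinuousLinearEquiv.apply_symm_apply, InnerProductSpace.toDual_symm_apply] at this
  exact this.symm

/-! ### The operator `f ↦ (σ f')' - δ f` -/

/-- The assumptions on the coefficients of the operator. -/
structure Coeffs (σ δ : Circ → ℝ) : Prop where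
  σ_contDiff : CircContDiff 1 σ
  σ_pos : ∀ θ, 0 < σ θ
  δ_cont : Continuous δ
  δ_nonneg : ∀ θ, 0 ≤ δ θ

namespace Coeffs

variable {σ δ : Circ → ℝ} (hc : Coeffs σ δ)

include hc

lemma inv_contDiff : CircContDiff 1 fun θ => (σ θ)⁻¹ :=
  ContDiff.inv hc.σ_contDiff fun _ => (hc.σ_pos _).ne'

lemma continuous_div {K : Circ → ℝ} (hK : Continuous K) : Continuous fun θ => K θ / σ θ :=
  hK.div hc.σ_contDiff.continuous fun θ => (hc.σ_pos θ).ne'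

lemma exists_pos_le : ∃ c, 0 < c ∧ ∀ θ, c ≤ σ θ := by
  obtain ⟨θ₀, _, h⟩ := isCompact_univ.exists_isMinOn (univ_nonempty (α := Circ))
    hc.σ_contDiff.continuous.continuousOn
  exact ⟨σ θ₀, hc.σ_pos θ₀, fun θ => h (mem_univ θ)⟩

lemma memLp_add_mul (f h : X) : MemLp (fun θ => h θ + δ θ * f θ) 2 volume :=
  (Lp.memLp h).add ((isBddMeas_of_continuous hc.δ_cont).memLp_mul (Lp.memLp f))

/-- The second order equation becomes a first order system for absolutely continuous functions,
$F'=K/\sigma$ and $K'=h+\delta f$, where $K=\sigma F'$ is the flux. All later arguments about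
$\mathcal A$ work with this system. -/
lemma exists_prims {f f₁ h : X} (h1 : HasWeakDeriv f f₁)
    (h2 : HasWeakDeriv (fun θ => σ θ * f₁ θ) (fun θ => h θ + δ θ * f θ)) :
    ∃ F K : Circ → ℝ, f =ᵐ[volume] F ∧ HasPrim F (fun θ => K θ / σ θ) ∧
      HasPrim K (fun θ => h θ + δ θ * f θ) := by
  obtain ⟨F, hF, hfF⟩ := h1.exists_hasPrim (Lp.memLp f) (Lp.memLp f₁)
  obtain ⟨K, hK, hfK⟩ := h2.exists_hasPrim
    ((isBddMeas_of_continuous hc.σ_contDiff.continuous).memLp_mul (Lp.memLp f₁))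
    (hc.memLp_add_mul f h)
  refine ⟨F, K, hfF, hF.congr_ae ?_, hK⟩
  filter_upwards [hfK] with θ hθ
  rw [← hθ, mul_div_cancel_left₀ _ (hc.σ_pos θ).ne']

lemma opGraph_of_prims {f h : X} {F K : Circ → ℝ} (hfF : f =ᵐ[volume] F)
    (hF : HasPrim F (fun θ => K θ / σ θ)) (hK : HasPrim K (fun θ => h θ + δ θ * f θ)) :
    opGraph σ δ f h := by
  have hL := memLp_two_of_continuous (hc.continuous_div hK.continuous)
  have hf₁ := toX_ae hL
  set f₁ := toX fun θ => K θ / σ θ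
  have h1 : HasWeakDeriv f f₁ := (hF.congr_ae hf₁.symm).hasWeakDeriv hfF
  -- The $C^1$ regularity of $\sigma$ enters here: $f'=K\sigma^{-1}$ is a product of two functions
  -- with square integrable derivatives, hence $f\in W^{2,2}$.
  have h2 := hK.mul hc.inv_contDiff.hasPrim
  have hL2 : MemLp (fun θ => K θ * circDeriv (fun θ => (σ θ)⁻¹) θ
      + (h θ + δ θ * f θ) * (σ θ)⁻¹) 2 volume := by
    refine MemLp.add (memLp_two_of_continuous
      (hK.continuous.mul hc.inv_contDiff.continuous_circDeriv)) ?_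
    exact ((isBddMeas_of_continuous hc.inv_contDiff.continuous).memLp_mul
      (hc.memLp_add_mul f h)).ae_eq (ae_of_all _ fun θ => mul_comm _ _)
  refine ⟨⟨f₁, toX _, h1, (h2.congr_ae (toX_ae hL2).symm).hasWeakDeriv ?_⟩, f₁, h1,
    hK.hasWeakDeriv ?_⟩
  · filter_upwards [hf₁] with θ hθ
    rw [hθ, div_eq_mul_inv]
  · filter_upwards [hf₁] with θ hθ
    rw [hθ, mul_div_cancel₀ _ (hc.σ_pos θ).ne']

lemma opGraph_iff {f h : X} : opGraph σ δ f h ↔ ∃ F K : Circ → ℝ, f =ᵐ[volume] F ∧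
    HasPrim F (fun θ => K θ / σ θ) ∧ HasPrim K (fun θ => h θ + δ θ * f θ) :=
  ⟨fun ⟨_, _, h1, h2⟩ => hc.exists_prims h1 h2, fun ⟨_, _, h1, h2, h3⟩ =>
    hc.opGraph_of_prims h1 h2 h3⟩

end Coeffs

/-! ### The energy space and self-adjointness of the elliptic operator. -/

lemma HasPrim.add {F g K k : Circ → ℝ} (h : HasPrim F g) (h' : HasPrim K k) :
    HasPrim (fun θ => F θ + K θ) (fun θ => g θ + k θ) :=
  ⟨h.1.add h'.1, fun x y => by
    rw [intervalIntegral.integral_add (intervalIntegrable_lift h.1 x y)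
      (intervalIntegrable_lift h'.1 x y), ← h.2, ← h'.2]
    ring⟩

lemma HasPrim.const_mul {F g : Circ → ℝ} (h : HasPrim F g) (c : ℝ) :
    HasPrim (fun θ => c * F θ) (fun θ => c * g θ) :=
  ⟨h.1.const_mul c, fun x y => by
    rw [intervalIntegral.integral_const_mul, ← h.2]
    ring⟩

lemma HasPrim.ae_eq_zero {F g : Circ → ℝ} (h : HasPrim F g) (hg : MemLp g 2 volume)
    (hF : F =ᵐ[volume] 0) : g =ᵐ[volume] 0 := by
  refine ae_eq_zero_of_forall_smooth hg fun φ hφ => ?_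
  have := h.integral_by_parts hφ.of_top.hasPrim
  rw [integral_congr_ae (g := fun _ => (0 : ℝ)) (by
    filter_upwards [hF] with θ hθ
    rw [hθ]; simp), integral_zero] at this
  linarith

/-- The closed subspace `{(f, f') : f ∈ W^{1,2}}` of `X × X`. -/
def sobolevGraph : Submodule ℝ (WithLp 2 (X × X)) where
  carrier := {u | HasWeakDeriv u.fst u.snd}
  add_mem' := fun {u v} hu hv => by
    obtain ⟨F, hF, hF'⟩ := HasWeakDeriv.exists_hasPrim hu (Lp.memLp _) (Lp.memLp _)
    obtain ⟨K, hK, hK'⟩ := HasWeakDeriv.exists_hasPrim hv (Lp.memLp _) (Lp.memLp _)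
    refine ((hF.add hK).congr_ae ?_).hasWeakDeriv ?_
    · exact (Lp.coeFn_add u.snd v.snd).symm
    · filter_upwards [Lp.coeFn_add u.fst v.fst, hF', hK'] with θ h1 h2 h3
      rw [← h2, ← h3]; exact h1
  zero_mem' := by
    intro φ _
    rw [integral_congr_ae (g := fun _ => (0 : ℝ)), integral_zero,
      integral_congr_ae (g := fun _ => (0 : ℝ)), integral_zero, neg_zero]
    · filter_upwards [Lp.coeFn_zero ℝ 2 (volume : Measure Circ)] with θ h
      change (0 : X) θ * _ = _
      rw [h]; simp
    · filter_upwards [Lp.coeFn_zero ℝ 2 (volume : Measure Circ)] with θ h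
      change (0 : X) θ * _ = _
      rw [h]; simp
  smul_mem' := fun c u hu => by
    obtain ⟨F, hF, hF'⟩ := HasWeakDeriv.exists_hasPrim hu (Lp.memLp _) (Lp.memLp _)
    refine ((hF.const_mul c).congr_ae ?_).hasWeakDeriv ?_
    · exact (Lp.coeFn_smul c u.snd).symm
    · filter_upwards [Lp.coeFn_smul c u.fst, hF'] with θ h1 h2
      rw [← h2]; exact h1

lemma isClosed_sobolevGraph :
    IsClosed (sobolevGraph : Set (WithLp 2 (X × X))) := by
  have : (sobolevGraph : Set (WithLp 2 (X × X))) = ⋂ (φ : Circ → ℝ)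
      (_ : CircContDiff ((⊤ : ℕ∞) : WithTop ℕ∞) φ),
      {u | inner ℝ u.fst (toX (circDeriv φ)) = -inner ℝ u.snd (toX φ)} := by
    ext u
    simp only [mem_iInter, mem_ofPred_eq]
    refine forall_congr' fun φ => forall_congr' fun hφ => ?_
    rw [inner_X, inner_X]
    have e1 : ∫ θ, u.fst θ * toX (circDeriv φ) θ = ∫ θ, u.fst θ * circDeriv φ θ := by
      refine integral_congr_ae ?_
      filter_upwards [toX_ae (memLp_two_of_continuous hφ.of_top.continuous_circDeriv)] with θ h
      rw [h]
    have e2 : ∫ θ, u.snd θ * toX φ θ = ∫ θ, u.snd θ * φ θ := by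
      refine integral_congr_ae ?_
      filter_upwards [toX_ae (memLp_two_of_continuous hφ.continuous)] with θ h
      rw [h]
    rw [e1, e2]
  rw [this]
  refine isClosed_iInter fun φ => isClosed_iInter fun hφ => isClosed_eq ?_ ?_
  · exact (WithLp.fstL 2 ℝ X X).continuous.inner continuous_const
  · exact ((WithLp.sndL 2 ℝ X X).continuous.inner continuous_const).neg

namespace Coeffs

variable {σ δ : Circ → ℝ} (hc : Coeffs σ δ)

include hc

/-- Integration by parts gives an expression symmetric in the two functions and nonpositive on the
diagonal, hence both `symm` and `nonpos` for the operator. -/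
lemma inner_eq {f h f' : X} {F K F' K' : Circ → ℝ}
    (hK : HasPrim K (fun θ => h θ + δ θ * f θ)) (hf : f =ᵐ[volume] F)
    (hf' : f' =ᵐ[volume] F') (hF' : HasPrim F' (fun θ => K' θ / σ θ)) :
    inner ℝ h f' = -(∫ θ, K θ * (K' θ / σ θ)) - ∫ θ, δ θ * F θ * F' θ := by
  rw [hK.integral_by_parts hF', inner_X, neg_neg, ← integral_sub]
  · refine integral_congr_ae ?_
    filter_upwards [hf, hf'] with θ h1 h2
    rw [h1, h2]; ring
  · exact (hF'.integrable_mul hK.1).congr (ae_of_all _ fun θ => mul_comm _ _)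
  · refine (hF'.integrable_mul (k := fun θ => δ θ * f θ) ?_).congr ?_
    · exact integrable_continuous_mul hc.δ_cont ((Lp.memLp f).integrable (by norm_num))
    · filter_upwards [hf] with θ h1
      rw [h1]; ring

/-- Lax-Milgram for the form $\int(l+\delta)f\varphi+\sigma f'\varphi'$, coercive with constant
$\min(\min\sigma,l)$. Restricted to smooth $\varphi$, the weak equation says precisely that $\sigma
f'$ has the required weak derivative. -/
lemma opGraph_surj {l : ℝ} (hl : 0 < l) (h : X) : ∃ f, opGraph σ δ f (l • f - h) := by
  obtain ⟨c, hc0, hcσ⟩ := hc.exists_pos_le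
  have hσ := isBddMeas_of_continuous hc.σ_contDiff.continuous
  have hδ : IsBddMeas fun θ => l + δ θ :=
    isBddMeas_of_continuous (continuous_const.add hc.δ_cont)
  obtain ⟨u, hu, huv⟩ := exists_weak_solution sobolevGraph isClosed_sobolevGraph (mulXL hδ)
    (mulXL hσ) (lt_min hc0 hl)
    (fun x => inner_mulX_self_ge hδ (fun θ => (min_le_right c l).trans
      (le_add_of_nonneg_right (hc.δ_nonneg θ))) x)
    (fun x => inner_mulX_self_ge hσ (fun θ => (min_le_left c l).trans (hcσ θ)) x) h
  refine ⟨u.fst, hc.opGraph_iff.2 (hc.exists_prims hu ?_)⟩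
  intro φ hφ
  have hφX := toX_ae (memLp_two_of_continuous hφ.continuous)
  have hφX' := toX_ae (memLp_two_of_continuous hφ.of_top.continuous_circDeriv)
  have h1 := huv (WithLp.toLp 2 (toX φ, toX (circDeriv φ)))
    ((hφ.of_top.hasPrim.congr_ae hφX'.symm).hasWeakDeriv hφX)
  simp only [mulXL_apply] at h1
  rw [inner_mulX hδ, inner_mulX hσ, inner_X] at h1
  have e1 : ∫ θ, (l + δ θ) * u.fst θ * toX φ θ = ∫ θ, φ θ * ((l + δ θ) * u.fst θ) := by
    refine integral_congr_ae ?_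
    filter_upwards [hφX] with θ h
    rw [h]; ring
  have e2 : ∫ θ, σ θ * u.snd θ * toX (circDeriv φ) θ = ∫ θ, σ θ * u.snd θ * circDeriv φ θ := by
    refine integral_congr_ae ?_
    filter_upwards [hφX'] with θ h
    rw [h]
  have e3 : ∫ θ, h θ * toX φ θ = ∫ θ, φ θ * h θ := by
    refine integral_congr_ae ?_
    filter_upwards [hφX] with θ h
    rw [h]; ring
  have e4 : ∫ θ, ((l • u.fst - h) θ + δ θ * u.fst θ) * φ θ
      = ∫ θ, φ θ * ((l + δ θ) * u.fst θ) - φ θ * h θ := by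
    refine integral_congr_ae ?_
    filter_upwards [Lp.coeFn_sub (l • u.fst) h, Lp.coeFn_smul l u.fst] with θ h1 h2
    rw [h1, Pi.sub_apply, h2, Pi.smul_apply, smul_eq_mul]
    ring
  have h2 : (∫ θ, (l + δ θ) * u.fst θ * toX φ θ) + ∫ θ, σ θ * u.snd θ * toX (circDeriv φ) θ
      = ∫ θ, h θ * toX φ θ := h1
  rw [e1, e2, e3] at h2
  rw [e4, integral_sub]
  · linarith
  · exact hφ.of_top.hasPrim.integrable_mul ((hδ.memLp_mul (Lp.memLp _)).integrable (by norm_num))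
  · exact hφ.of_top.hasPrim.integrable_mul ((Lp.memLp h).integrable (by norm_num))

lemma isNonposSelfAdjoint : IsNonposSelfAdjoint (opGraph σ δ) where
  add {f h f' h'} h1 h2 := by
    obtain ⟨F, K, e1, e2, e3⟩ := hc.opGraph_iff.1 h1
    obtain ⟨F', K', e1', e2', e3'⟩ := hc.opGraph_iff.1 h2
    refine hc.opGraph_iff.2 ⟨_, _, ?_, (e2.add e2').congr_ae (ae_of_all _ fun θ =>
      (add_div _ _ _).symm), (e3.add e3').congr_ae ?_⟩
    · filter_upwards [Lp.coeFn_add f f', e1, e1'] with θ h1 h2 h3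
      rw [h1, Pi.add_apply, h2, h3]
    · filter_upwards [Lp.coeFn_add f f', Lp.coeFn_add h h'] with θ h1 h2
      rw [h1, h2, Pi.add_apply, Pi.add_apply]; ring
  smul c {f h} h1 := by
    obtain ⟨F, K, e1, e2, e3⟩ := hc.opGraph_iff.1 h1
    refine hc.opGraph_iff.2 ⟨_, _, ?_, (e2.const_mul c).congr_ae (ae_of_all _ fun θ =>
      (mul_div_assoc _ _ _).symm), (e3.const_mul c).congr_ae ?_⟩
    · filter_upwards [Lp.coeFn_smul c f, e1] with θ h1 h2
      rw [h1, Pi.smul_apply, h2, smul_eq_mul]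
    · filter_upwards [Lp.coeFn_smul c f, Lp.coeFn_smul c h] with θ h1 h2
      rw [h1, h2, Pi.smul_apply, Pi.smul_apply, smul_eq_mul, smul_eq_mul]; ring
  eq_zero {h} h1 := by
    obtain ⟨F, K, e1, e2, e3⟩ := hc.opGraph_iff.1 h1
    have h0 := Lp.coeFn_zero ℝ 2 (volume : Measure Circ)
    have h2 := e2.ae_eq_zero (memLp_two_of_continuous (hc.continuous_div e3.continuous))
      (e1.symm.trans h0)
    have h3 := e3.ae_eq_zero (hc.memLp_add_mul _ _) (by
      filter_upwards [h2] with θ h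
      have := hc.σ_pos θ
      simpa [this.ne'] using h)
    ext1
    filter_upwards [h3, h0] with θ h h'
    rw [h', Pi.zero_apply] at *
    simpa using h
  symm {f h f' h'} h1 h2 := by
    obtain ⟨F, K, e1, e2, e3⟩ := hc.opGraph_iff.1 h1
    obtain ⟨F', K', e1', e2', e3'⟩ := hc.opGraph_iff.1 h2
    rw [hc.inner_eq e3 e1 e1' e2', real_inner_comm, hc.inner_eq e3' e1' e1 e2]
    congr 2
    · congr 1; ext θ; ring
    · ext θ; ring
  nonpos {f h} h1 := by
    obtain ⟨F, K, e1, e2, e3⟩ := hc.opGraph_iff.1 h1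
    rw [hc.inner_eq e3 e1 e1 e2]
    have i1 : 0 ≤ ∫ θ, K θ * (K θ / σ θ) := integral_nonneg fun θ => by
      have := hc.σ_pos θ
      change 0 ≤ K θ * (K θ / σ θ)
      rw [← mul_div_assoc, ← sq]; positivity
    have i2 : 0 ≤ ∫ θ, δ θ * F θ * F θ := integral_nonneg fun θ => by
      have := hc.δ_nonneg θ
      change 0 ≤ δ θ * F θ * F θ
      rw [mul_assoc, ← sq]; positivity
    linarith
  surj l hl v := hc.opGraph_surj hl v

end Coeffs

/-! ### Minimum principle and positivity. -/

lemma X_nonneg_iff {f : X} : 0 ≤ f ↔ ∀ᵐ θ, 0 ≤ f θ := (Lp.coeFn_nonneg f).symm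

lemma exists_lift_isMin {F : Circ → ℝ} (hF : Continuous F) :
    ∃ t : ℝ, ∀ θ, F (t : Circ) ≤ F θ := by
  obtain ⟨θ₀, _, h⟩ := isCompact_univ.exists_isMinOn (univ_nonempty (α := Circ)) hF.continuousOn
  induction θ₀ using QuotientAddGroup.induction_on with
  | H t => exact ⟨t, fun θ => h (mem_univ θ)⟩

lemma HasPrim.hasDerivAt {F g : Circ → ℝ} (h : HasPrim F g) (hg : Continuous g) (t : ℝ) :
    HasDerivAt (fun s : ℝ => F (s : Circ)) (g (t : Circ)) t := by
  refine (((continuous_lift hg).integral_hasStrictDerivAt 0 t).hasDerivAt.const_add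
    (F ((0 : ℝ) : Circ))).congr_of_eventuallyEq (Eventually.of_forall fun s => ?_)
  simp only
  rw [← h.2]; ring

lemma HasPrim.eq_zero_of_isMin {F g : Circ → ℝ} (h : HasPrim F g) (hg : Continuous g) {t : ℝ}
    (ht : ∀ θ, F (t : Circ) ≤ F θ) : g (t : Circ) = 0 :=
  IsLocalMin.hasDerivAt_eq_zero (Eventually.of_forall fun s => ht (s : Circ)) (h.hasDerivAt hg t)

namespace Coeffs

variable {σ δ : Circ → ℝ} (hc : Coeffs σ δ)

include hc

lemma exists_elliptic_prims {l : ℝ} {f h : X} (hf : opGraph σ δ f (l • f - h)) :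
    ∃ F K : Circ → ℝ, f =ᵐ[volume] F ∧ HasPrim F (fun θ => K θ / σ θ) ∧
      HasPrim K (fun θ => (l + δ θ) * F θ - h θ) := by
  obtain ⟨F, K, e1, e2, e3⟩ := hc.opGraph_iff.1 hf
  refine ⟨F, K, e1, e2, e3.congr_ae ?_⟩
  filter_upwards [Lp.coeFn_sub (l • f) h, Lp.coeFn_smul l f, e1] with θ h1 h2 h3
  rw [h1, Pi.sub_apply, h2, Pi.smul_apply, smul_eq_mul, h3]
  ring

/-- At a minimum of `F`, the flux `K = σ F'` vanishes, and right of it the flux is at most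
`∫ (l + δ) F`. -/
lemma flux_le {l : ℝ} {h : X} (hh : 0 ≤ h) {F K : Circ → ℝ}
    (hF : HasPrim F (fun θ => K θ / σ θ)) (hK : HasPrim K (fun θ => (l + δ θ) * F θ - h θ))
    {t : ℝ} (ht : ∀ θ, F (t : Circ) ≤ F θ) {y : ℝ} (hy : t ≤ y) :
    K (y : Circ) ≤ ∫ s in t..y, (l + δ s) * F (s : Circ) := by
  have h0 := hF.eq_zero_of_isMin (hc.continuous_div hK.continuous) ht
  have hKt : K (t : Circ) = 0 := by
    simpa [(hc.σ_pos t).ne'] using h0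
  have h1 := hK.2 t y
  rw [hKt, sub_zero] at h1
  rw [h1]
  refine intervalIntegral.integral_mono_ae hy (intervalIntegrable_lift hK.1 _ _) ?_ ?_
  · exact (((continuous_const.add (continuous_lift hc.δ_cont)).mul
      (continuous_lift hF.continuous))).intervalIntegrable _ _
  · filter_upwards [ae_lift (X_nonneg_iff.1 hh)] with s hs
    linarith

/-- Since $h$ is only square integrable, no second derivative is available at a minimum, and the
flux is used instead. It vanishes at a negative minimum and is negative just to the right, because
$(l+\delta)F<0$ there; then $F$ decreases further, a contradiction. -/
lemma elliptic_nonneg {l : ℝ} (hl : 0 < l) {h : X} (hh : 0 ≤ h) {F K : Circ → ℝ}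
    (hF : HasPrim F (fun θ => K θ / σ θ)) (hK : HasPrim K (fun θ => (l + δ θ) * F θ - h θ)) :
    ∀ θ, 0 ≤ F θ := by
  obtain ⟨t, ht⟩ := exists_lift_isMin hF.continuous
  by_contra! hcon
  obtain ⟨θ₁, hθ₁⟩ := hcon
  have hneg : F (t : Circ) < 0 := (ht θ₁).trans_lt hθ₁
  have hFc := continuous_lift hF.continuous
  obtain ⟨ε, hε, hball⟩ := Metric.eventually_nhds_iff.1
    ((hFc.tendsto t).eventually (gt_mem_nhds hneg))
  have hFneg : ∀ s ∈ Icc t (t + ε / 2), F (s : Circ) < 0 := fun s hs => by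
    apply hball
    rw [Real.dist_eq, abs_of_nonneg (by linarith [hs.1])]
    linarith [hs.2]
  have hKneg : ∀ y ∈ Ioo t (t + ε / 2), K (y : Circ) / σ (y : Circ) < 0 := by
    intro y hy
    refine div_neg_of_neg_of_pos ((hc.flux_le hh hF hK ht hy.1.le).trans_lt ?_) (hc.σ_pos _)
    have hpos : 0 < ∫ s in t..y, -((l + δ s) * F (s : Circ)) := by
      refine intervalIntegral.intervalIntegral_pos_of_pos_on ?_ ?_ hy.1
      · exact ((((continuous_const.add (continuous_lift hc.δ_cont)).mul hFc)).neg).intervalIntegrable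
          _ _
      · intro s hs
        have h1 := hFneg s ⟨hs.1.le, hs.2.le.trans hy.2.le⟩
        have h2 : 0 < l + δ s := add_pos_of_pos_of_nonneg hl (hc.δ_nonneg _)
        nlinarith
    rw [intervalIntegral.integral_neg] at hpos
    linarith
  have hanti : StrictAntiOn (fun s : ℝ => F (s : Circ)) (Icc t (t + ε / 2)) := by
    refine strictAntiOn_of_deriv_neg (convex_Icc _ _) hFc.continuousOn fun s hs => ?_
    rw [interior_Icc] at hs
    rw [(hF.hasDerivAt (hc.continuous_div hK.continuous) s).deriv]
    exact hKneg s hs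
  have h1 := hanti (left_mem_Icc.2 (by linarith)) (right_mem_Icc.2 (by linarith))
    (show t < t + ε / 2 by linarith)
  exact absurd (ht ((t + ε / 2 : ℝ) : Circ)) (not_le.2 h1)

/-- A zero of $F$ is a minimum, so the flux to its right is at most $Cm\varepsilon$, where $m=\max
F$ on $[t,t+\varepsilon]$. Integrating once more, $m\le\frac Cc\varepsilon^2m$, and $m=0$ when
$\frac Cc\varepsilon^2<1$. This $\varepsilon$ does not depend on $t$, so one zero spreads around the
whole circle. -/
lemma elliptic_pos {l : ℝ} (hl : 0 < l) {h : X} (hh : 0 ≤ h) {F K : Circ → ℝ}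
    (hF : HasPrim F (fun θ => K θ / σ θ)) (hK : HasPrim K (fun θ => (l + δ θ) * F θ - h θ))
    (hne : ∃ θ, F θ ≠ 0) : ∀ θ, 0 < F θ := by
  have hF0 := hc.elliptic_nonneg hl hh hF hK
  have hFc := continuous_lift hF.continuous
  obtain ⟨c, hc0, hcσ⟩ := hc.exists_pos_le
  obtain ⟨C, hC⟩ := isCompact_univ.exists_bound_of_continuousOn
    (continuous_const.add hc.δ_cont : Continuous fun θ : Circ => l + δ θ).continuousOn
  have hC0 : 0 ≤ C := (norm_nonneg _).trans (hC ((0 : ℝ) : Circ) (mem_univ _))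
  -- zeros propagate to the right by a fixed amount
  obtain ⟨ε, hε, hεC⟩ : ∃ ε : ℝ, 0 < ε ∧ C / c * ε ^ 2 < 1 := by
    have h1 : Tendsto (fun ε : ℝ => C / c * ε ^ 2) (𝓝[>] 0) (𝓝 0) := by
      have : Continuous fun ε : ℝ => C / c * ε ^ 2 := by fun_prop
      simpa using (this.tendsto 0).mono_left nhdsWithin_le_nhds
    obtain ⟨ε, h2, h3⟩ := ((h1.eventually (gt_mem_nhds one_pos)).and self_mem_nhdsWithin).exists
    exact ⟨ε, h3, h2⟩
  have hprop : ∀ t : ℝ, F (t : Circ) = 0 → ∀ s ∈ Icc t (t + ε), F (s : Circ) = 0 := by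
    intro t ht
    have hmin : ∀ θ, F (t : Circ) ≤ F θ := fun θ => ht ▸ hF0 θ
    obtain ⟨z, hz, hzmax⟩ := isCompact_Icc.exists_isMaxOn
      (nonempty_Icc.2 (by linarith : t ≤ t + ε)) hFc.continuousOn
    set m := F (z : Circ)
    have hm0 : 0 ≤ m := hF0 _
    have hKle : ∀ y ∈ Icc t (t + ε), K (y : Circ) ≤ C * m * ε := by
      intro y hy
      refine (hc.flux_le hh hF hK hmin hy.1).trans ?_
      have h1 : ∫ s in t..y, (l + δ s) * F (s : Circ) ≤ ∫ _ in t..y, C * m := by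
        refine intervalIntegral.integral_mono_on hy.1 ?_ intervalIntegrable_const fun s hs => ?_
        · exact (((continuous_const.add (continuous_lift hc.δ_cont)).mul hFc)).intervalIntegrable _ _
        · have h2 : l + δ s ≤ C := (le_abs_self _).trans (hC (s : Circ) (mem_univ _))
          have h3 : F (s : Circ) ≤ m := hzmax ⟨hs.1, hs.2.trans hy.2⟩
          exact mul_le_mul h2 h3 (hF0 _) hC0
      refine h1.trans ?_
      rw [intervalIntegral.integral_const, smul_eq_mul, mul_comm]
      have : 0 ≤ C * m := by positivity
      nlinarith [hy.2]
    have hm1 : m ≤ C / c * ε ^ 2 * m := by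
      have h1 := hF.2 t z
      rw [ht, sub_zero] at h1
      change m = _ at h1
      have h2 : ∫ s in t..z, K (s : Circ) / σ (s : Circ) ≤ ∫ _ in t..z, C * m * ε / c := by
        refine intervalIntegral.integral_mono_on hz.1 ?_ intervalIntegrable_const fun s hs => ?_
        · exact (continuous_lift (hc.continuous_div hK.continuous)).intervalIntegrable _ _
        · exact div_le_div₀ (by positivity) (hKle s ⟨hs.1, hs.2.trans hz.2⟩) hc0 (hcσ _)
      rw [← h1, intervalIntegral.integral_const, smul_eq_mul] at h2
      refine h2.trans ?_
      have h3 : z - t ≤ ε := by linarith [hz.2]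
      calc (z - t) * (C * m * ε / c) ≤ ε * (C * m * ε / c) := by gcongr
        _ = C / c * ε ^ 2 * m := by ring
    have hm : m = 0 := by nlinarith
    intro s hs
    exact le_antisymm (hm ▸ hzmax hs) (hF0 _)
  intro θ
  refine lt_of_le_of_ne (hF0 θ) fun hθ => ?_
  obtain ⟨θ₁, hθ₁⟩ := hne
  induction θ using QuotientAddGroup.induction_on with
  | H t =>
    have hall : ∀ n : ℕ, ∀ s ∈ Icc t (t + n * ε), F (s : Circ) = 0 := by
      intro n
      induction n with
      | zero =>
        intro s hs
        have : s = t := le_antisymm (by simpa using hs.2) hs.1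
        rw [this]; exact hθ.symm
      | succ n ih =>
        intro s hs
        by_cases h1 : s ≤ t + n * ε
        · exact ih s ⟨hs.1, h1⟩
        · refine hprop (t + n * ε) (ih _ ⟨by linarith [mul_nonneg n.cast_nonneg hε.le], le_rfl⟩) s
            ⟨(not_le.1 h1).le, ?_⟩
          have := hs.2
          push_cast at this
          linarith
    apply hθ₁
    induction θ₁ using QuotientAddGroup.induction_on with
    | H r =>
      -- Full turns move the representative of $\theta_1$ to the right of $t$, the only direction in
      -- which zeros propagate.
      obtain ⟨n, hn⟩ := exists_nat_ge ((t - r) / (2 * Real.pi))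
      rw [div_le_iff₀ Real.two_pi_pos] at hn
      have h1 : ((r + n * (2 * Real.pi) : ℝ) : Circ) = (r : Circ) := by
        rw [AddCircle.coe_add, ← nsmul_eq_mul, AddCircle.coe_nsmul, AddCircle.coe_period,
          smul_zero, add_zero]
      obtain ⟨k, hk⟩ := exists_nat_ge ((r + n * (2 * Real.pi) - t) / ε)
      rw [div_le_iff₀ hε] at hk
      change F (r : Circ) = 0
      rw [← h1]
      exact hall k _ ⟨by linarith, by linarith⟩

lemma resolvent_nonneg {l : ℝ} (hl : 0 < l) {h : X} (hh : 0 ≤ h) :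
    0 ≤ hc.isNonposSelfAdjoint.resolvent l hl h := by
  obtain ⟨F, K, e1, e2, e3⟩ :=
    hc.exists_elliptic_prims (hc.isNonposSelfAdjoint.resolvent_spec hl h)
  rw [X_nonneg_iff]
  filter_upwards [e1] with θ hθ
  rw [hθ]
  exact hc.elliptic_nonneg hl hh e2 e3 θ

/-- The solution of the elliptic equation is bounded and bounded away from zero. -/
lemma elliptic_bounds {l : ℝ} (hl : 0 < l) {f h : X} (hh : 0 ≤ h) (hne : h ≠ 0)
    (hf : opGraph σ δ f (l • f - h)) :
    ∃ c C : ℝ, 0 < c ∧ ∀ᵐ θ, c ≤ f θ ∧ f θ ≤ C := by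
  obtain ⟨F, K, e1, e2, e3⟩ := hc.exists_elliptic_prims hf
  have hF : ∃ θ, F θ ≠ 0 := by
    by_contra! hcon
    apply hne
    have h0 : f = 0 := by
      ext1
      filter_upwards [e1, Lp.coeFn_zero ℝ 2 (volume : Measure Circ)] with θ h1 h2
      rw [h1, h2, hcon θ]; rfl
    rw [h0] at hf
    simpa using hc.isNonposSelfAdjoint.eq_zero hf
  have hpos := hc.elliptic_pos hl hh e2 e3 hF
  obtain ⟨t, ht⟩ := exists_lift_isMin e2.continuous
  obtain ⟨C, hC⟩ := isCompact_univ.exists_bound_of_continuousOn e2.continuous.continuousOn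
  refine ⟨F t, C, hpos _, ?_⟩
  filter_upwards [e1] with θ hθ
  rw [hθ]
  exact ⟨ht θ, (le_abs_self _).trans (hC θ (mem_univ _))⟩

lemma semigroup_nonneg (t : NNReal) {f : X} (hf : 0 ≤ f) :
    0 ≤ hc.isNonposSelfAdjoint.semigroup t f := by
  refine hc.isNonposSelfAdjoint.semigroup_mem_of_resolvent_mem (Ici 0) isClosed_Ici
    self_mem_Ici (fun x (hx : 0 ≤ x) y (hy : 0 ≤ y) => mem_Ici.2 (add_nonneg hx hy)) (fun c hc0 x hx => ?_)
    (fun l hl x hx => hc.resolvent_nonneg hl hx) t hf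
  rw [mem_Ici, X_nonneg_iff] at hx ⊢
  filter_upwards [hx, Lp.coeFn_smul c x] with θ h1 h2
  rw [h2, Pi.smul_apply]
  exact mul_nonneg hc0 h1

end Coeffs

/-! ### Extended integrals -/

/-- The identity $f^++(L+b^-)=f^-+b^+$ for $f=b-L$. Written without subtraction it can be integrated
term by term, including where $L=\infty$. -/
lemma ennreal_decomp (b : ℝ) (L : ENNReal) :
    ((b : EReal) - (L : EReal)).toENNReal + (L + ENNReal.ofReal (-b))
      = (-((b : EReal) - (L : EReal))).toENNReal + ENNReal.ofReal b := by
  induction L with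
  | top => simp [EReal.sub_top]
  | coe r =>
    have e : ((b : EReal) - (((r : ENNReal)) : EReal)) = ((b - r : ℝ) : EReal) := by
      rw [EReal.coe_sub]; rfl
    rw [e, ← EReal.coe_neg, EReal.real_coe_toENNReal, EReal.real_coe_toENNReal]
    rw [← ENNReal.ofReal_coe_nnreal]
    rcases le_total b 0 with h1 | h1 <;> rcases le_total (b - r) 0 with h2 | h2
    · rw [ENNReal.ofReal_of_nonpos h2, ENNReal.ofReal_of_nonpos h1, zero_add, add_zero,
        ← ENNReal.ofReal_add r.coe_nonneg (by linarith)]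
      congr 1; ring
    · have hr : (r : ℝ) = 0 := le_antisymm (by linarith) r.coe_nonneg
      have hb : b = 0 := le_antisymm h1 (by linarith)
      simp [hr, hb]
    · rw [ENNReal.ofReal_of_nonpos h2, ENNReal.ofReal_of_nonpos (by linarith : -b ≤ 0), zero_add,
        add_zero, ← ENNReal.ofReal_add (by linarith) h1]
      congr 1; ring
    · rw [ENNReal.ofReal_of_nonpos (by linarith : -b ≤ 0),
        ENNReal.ofReal_of_nonpos (by linarith : -(b - r) ≤ 0), zero_add,
        add_zero, ← ENNReal.ofReal_add (by linarith) r.coe_nonneg]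
      congr 1; ring

lemma toENNReal_coe_sub_le (b : ℝ) (L : ENNReal) :
    ((b : EReal) - (L : EReal)).toENNReal ≤ ENNReal.ofReal b := by
  rw [← EReal.real_coe_toENNReal]
  apply EReal.toENNReal_le_toENNReal
  rw [sub_eq_add_neg]
  nth_rewrite 2 [← add_zero (b : EReal)]
  gcongr
  exact EReal.neg_le_zero.2 (EReal.coe_ennreal_nonneg L)

section EIntegral

variable {Ω : Type*} [MeasurableSpace Ω] {μ : Measure Ω} {b : Ω → ℝ} {L : Ω → ENNReal}

lemma aemeasurable_coe_sub (hb : AEMeasurable b μ) (hL : AEMeasurable L μ) :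
    AEMeasurable (fun x => (b x : EReal) - (L x : EReal)) μ := by
  simp_rw [sub_eq_add_neg]
  exact hb.coe_real_ereal.add hL.coe_ereal_ennreal.neg

lemma hasEIntegral_coe_sub (hb : Integrable b μ) (hL : AEMeasurable L μ) :
    HasEIntegral μ (fun x => (b x : EReal) - (L x : EReal)) := by
  refine ⟨aemeasurable_coe_sub hb.1.aemeasurable hL, Or.inl (ne_of_lt ?_)⟩
  refine (lintegral_mono fun x => toENNReal_coe_sub_le (b x) (L x)).trans_lt ?_
  exact hb.lintegral_lt_top

/-- The extended integral of an integrable function minus a nonnegative one. -/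
lemma eintegral_coe_sub (hb : Integrable b μ) (hL : AEMeasurable L μ) :
    eintegral μ (fun x => (b x : EReal) - (L x : EReal))
      = ((∫ x, b x ∂μ : ℝ) : EReal) - ((∫⁻ x, L x ∂μ : ENNReal) : EReal) := by
  have hbm := hb.1.aemeasurable
  have hfm := aemeasurable_coe_sub hbm hL
  have hBp : ∫⁻ x, ENNReal.ofReal (b x) ∂μ ≠ ⊤ := hb.lintegral_lt_top.ne
  have hBn : ∫⁻ x, ENNReal.ofReal (-b x) ∂μ ≠ ⊤ := hb.neg.lintegral_lt_top.ne
  have hP : ∫⁻ x, ((b x : EReal) - (L x : EReal)).toENNReal ∂μ ≠ ⊤ :=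
    ((lintegral_mono fun x => toENNReal_coe_sub_le (b x) (L x)).trans_lt hb.lintegral_lt_top).ne
  have key : ∫⁻ x, ((b x : EReal) - (L x : EReal)).toENNReal ∂μ
      + (∫⁻ x, L x ∂μ + ∫⁻ x, ENNReal.ofReal (-b x) ∂μ)
      = ∫⁻ x, (-((b x : EReal) - (L x : EReal))).toENNReal ∂μ
        + ∫⁻ x, ENNReal.ofReal (b x) ∂μ := by
    have hfm' : AEMeasurable (fun x => (-((b x : EReal) - (L x : EReal))).toENNReal) μ :=
      hfm.neg.ereal_toENNReal
    rw [← lintegral_add_left' hL, ← lintegral_add_left' hfm.ereal_toENNReal,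
      ← lintegral_add_left' hfm']
    exact lintegral_congr fun x => ennreal_decomp (b x) (L x)
  rw [integral_eq_lintegral_pos_part_sub_lintegral_neg_part hb]
  unfold eintegral
  generalize ∫⁻ x, ((b x : EReal) - (L x : EReal)).toENNReal ∂μ = P at *
  generalize ∫⁻ x, (-((b x : EReal) - (L x : EReal))).toENNReal ∂μ = N at *
  generalize ∫⁻ x, ENNReal.ofReal (b x) ∂μ = Bp at *
  generalize ∫⁻ x, ENNReal.ofReal (-b x) ∂μ = Bn at *
  generalize ∫⁻ x, L x ∂μ = I at *
  lift P to NNReal using hP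
  lift Bp to NNReal using hBp
  lift Bn to NNReal using hBn
  induction I with
  | top =>
    have hN : N = ⊤ := by
      by_contra hN
      lift N to NNReal using hN
      rw [top_add, add_top] at key
      exact ENNReal.coe_ne_top (r := N + Bp) (by rw [key]; rfl)
    rw [hN]
    simp [EReal.sub_top]
  | coe I =>
    have hN : N ≠ ⊤ := by
      rintro rfl
      rw [top_add] at key
      exact ENNReal.coe_ne_top (r := P + (I + Bn)) (by rw [← key]; rfl)
    lift N to NNReal using hN
    have key' : (P : ℝ) + (I + Bn) = N + Bp := by exact_mod_cast key
    have e : ∀ r : NNReal, (((r : ENNReal)) : EReal) = ((r : ℝ) : EReal) := fun _ => rfl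
    simp only [e, ENNReal.coe_toReal, ← EReal.coe_sub]
    congr 1
    linarith

lemma eintegral_congr_ae {f g : Ω → EReal} (h : f =ᵐ[μ] g) : eintegral μ f = eintegral μ g := by
  unfold eintegral
  rw [lintegral_congr_ae (h.mono fun x hx => by simp only [hx] :
      (fun x => (f x).toENNReal) =ᵐ[μ] fun x => (g x).toENNReal),
    lintegral_congr_ae (h.mono fun x hx => by simp only [hx] :
      (fun x => (-f x).toENNReal) =ᵐ[μ] fun x => (-g x).toENNReal)]

lemma HasEIntegral.congr_ae {f g : Ω → EReal} (hf : HasEIntegral μ f) (h : f =ᵐ[μ] g) :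
    HasEIntegral μ g := by
  refine ⟨hf.1.congr h, ?_⟩
  rw [← lintegral_congr_ae (h.mono fun x hx => by simp only [hx] :
      (fun x => (f x).toENNReal) =ᵐ[μ] fun x => (g x).toENNReal),
    ← lintegral_congr_ae (h.mono fun x hx => by simp only [hx] :
      (fun x => (-f x).toENNReal) =ᵐ[μ] fun x => (-g x).toENNReal)]
  exact hf.2

lemma eintegral_coe (hb : Integrable b μ) :
    eintegral μ (fun x => (b x : EReal)) = ((∫ x, b x ∂μ : ℝ) : EReal) := by
  have := eintegral_coe_sub (L := fun _ => 0) hb aemeasurable_const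
  simpa using this

end EIntegral

/-! ### The power utility -/

/-- The right side is the tangent at $x=1$ of the strictly concave left side. For $\gamma<1$ this is
Bernoulli's inequality; for $\gamma>1$ it follows from $e^y>1+y$ and $\log x\le x-1$. The last
hypothesis removes $x=0$ when $\gamma>1$, where the real power takes the value $0$ instead of
$\infty$. -/
lemma rpow_div_le {γ x : ℝ} (hγ : 0 < γ) (hγ1 : γ ≠ 1) (hx : 0 ≤ x) (hx1 : x ≠ 1)
    (h : γ < 1 ∨ 0 < x) : x ^ (1 - γ) / (1 - γ) < γ / (1 - γ) + x := by
  rcases lt_or_gt_of_ne hγ1 with hlt | hgt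
  · have hp : 0 < 1 - γ := by linarith
    have h1 := _root_.rpow_one_add_lt_one_add_mul_self (s := x - 1) (by linarith)
      (sub_ne_zero.2 hx1) hp (by linarith)
    rw [add_sub_cancel] at h1
    rw [div_lt_iff₀ hp, add_mul, div_mul_cancel₀ _ hp.ne']
    linarith
  · have hx0 : 0 < x := h.resolve_left (by linarith)
    have hp : 0 < γ - 1 := by linarith
    have hlog : Real.log x ≠ 0 := by
      intro h0
      exact hx1 (Real.eq_one_of_pos_of_log_eq_zero hx0 h0)
    have h1 := Real.add_one_lt_exp (x := (1 - γ) * Real.log x)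
      (mul_ne_zero (by linarith) hlog)
    have h2 : x ^ (1 - γ) = Real.exp ((1 - γ) * Real.log x) := by
      rw [Real.rpow_def_of_pos hx0, mul_comm]
    rw [← h2] at h1
    have h3 := Real.log_le_sub_one_of_pos hx0
    have e1 : x ^ (1 - γ) / (1 - γ) = -(x ^ (1 - γ) / (γ - 1)) := by
      rw [← neg_sub γ 1, div_neg]
    have e2 : γ / (1 - γ) = -(γ / (γ - 1)) := by
      rw [← neg_sub γ 1, div_neg]
    rw [e1, e2, neg_lt_iff_pos_add]
    have : 0 < (x ^ (1 - γ) - γ + x * (γ - 1)) / (γ - 1) := by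
      apply div_pos _ hp
      nlinarith
    have e3 : (x ^ (1 - γ) - γ + x * (γ - 1)) / (γ - 1)
        = x ^ (1 - γ) / (γ - 1) - γ / (γ - 1) + x := by field_simp
    linarith

/-- The supremum over `c ≥ 0` of `c^{1-γ}/(1-γ) - m c`. -/
def maxUtil (γ m : ℝ) : ℝ := γ / (1 - γ) * m ^ (1 - 1 / γ)

lemma mul_rpow_neg_inv {γ m : ℝ} (hm : 0 < m) : m * m ^ (-1 / γ) = m ^ (1 - 1 / γ) := by
  rw [sub_eq_add_neg, Real.rpow_add hm, Real.rpow_one, neg_div]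

lemma rpow_rpow_neg_inv {γ m : ℝ} (hγ : 0 < γ) (hm : 0 < m) :
    (m ^ (-1 / γ)) ^ (1 - γ) = m ^ (1 - 1 / γ) := by
  rw [← Real.rpow_mul hm.le]
  congr 1
  field_simp
  ring

lemma crra_optimal {γ m : ℝ} (hγ : 0 < γ) (hγ1 : γ ≠ 1) (hm : 0 < m) :
    crra γ (m ^ (-1 / γ)) = ((maxUtil γ m + m * m ^ (-1 / γ) : ℝ) : EReal) := by
  have hpos : 0 < m ^ (-1 / γ) := Real.rpow_pos_of_pos hm _
  rw [crra, if_neg (by simp [hpos.ne']), rpow_rpow_neg_inv hγ hm, mul_rpow_neg_inv hm, maxUtil]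
  have : 1 - γ ≠ 0 := sub_ne_zero.2 (Ne.symm hγ1)
  congr 1
  field_simp
  ring

/-- Rescaling $c=m^{-1/\gamma}x$ turns this into the tangent inequality at $x=1$, multiplied by
$m^{1-1/\gamma}$. -/
lemma crra_lt {γ m c : ℝ} (hγ : 0 < γ) (hγ1 : γ ≠ 1) (hm : 0 < m) (hc : 0 ≤ c)
    (hcm : c ≠ m ^ (-1 / γ)) : crra γ c < ((maxUtil γ m + m * c : ℝ) : EReal) := by
  rw [crra]
  split_ifs with h
  · exact EReal.bot_lt_coe _
  · rw [EReal.coe_lt_coe_iff]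
    set s := m ^ (-1 / γ) with hs
    have hs0 : 0 < s := Real.rpow_pos_of_pos hm _
    have hK := rpow_rpow_neg_inv hγ hm
    have hK' := mul_rpow_neg_inv (γ := γ) hm
    rw [← hs] at hK hK'
    have hor : γ < 1 ∨ 0 < c / s := by
      rcases lt_or_gt_of_ne hγ1 with h1 | h1
      · exact Or.inl h1
      · have : c ≠ 0 := fun h0 => h ⟨h0, h1⟩
        exact Or.inr (div_pos (lt_of_le_of_ne hc (Ne.symm this)) hs0)
    have h1 := rpow_div_le hγ hγ1 (div_nonneg hc hs0.le)
      (fun h0 => hcm ((div_eq_one_iff_eq hs0.ne').1 h0)) hor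
    have hKpos : 0 < m ^ (1 - 1 / γ) := Real.rpow_pos_of_pos hm _
    rw [Real.div_rpow hc hs0.le, hK] at h1
    have h2 := mul_lt_mul_of_pos_left h1 hKpos
    have e1 : m ^ (1 - 1 / γ) * (c ^ (1 - γ) / m ^ (1 - 1 / γ) / (1 - γ)) = c ^ (1 - γ) / (1 - γ) := by
      field_simp
    have e2 : m ^ (1 - 1 / γ) * (γ / (1 - γ) + c / s) = maxUtil γ m + m * c := by
      rw [maxUtil, mul_add, mul_comm]
      congr 1
      rw [← hK']
      field_simp
    rwa [e1, e2] at h2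

lemma crra_le {γ m c : ℝ} (hγ : 0 < γ) (hγ1 : γ ≠ 1) (hm : 0 < m) (hc : 0 ≤ c) :
    crra γ c ≤ ((maxUtil γ m + m * c : ℝ) : EReal) := by
  by_cases h : c = m ^ (-1 / γ)
  · rw [h]; exact (crra_optimal hγ hγ1 hm).le
  · exact (crra_lt hγ hγ1 hm hc h).le

/-- The utility lost by the consumption `c` with respect to the optimal one. -/
def loss (γ m c : ℝ) : ENNReal :=
  (((maxUtil γ m + m * c : ℝ) : EReal) - crra γ c).toENNReal

/-- An affine function of $c$ minus a $[0,\infty]$-valued term is the shape that `eintegral_coe_sub`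
integrates; the value $-\infty$ is absorbed by the loss. -/
lemma crra_eq_sub_loss {γ m c : ℝ} (hγ : 0 < γ) (hγ1 : γ ≠ 1) (hm : 0 < m) (hc : 0 ≤ c) :
    crra γ c = ((maxUtil γ m + m * c : ℝ) : EReal) - (loss γ m c : EReal) := by
  have h := crra_le hγ hγ1 hm hc
  rw [loss, EReal.coe_toENNReal (EReal.sub_nonneg (Or.inl (EReal.coe_ne_top _))
    (Or.inl (EReal.coe_ne_bot _)) |>.2 h)]
  generalize crra γ c = z at h ⊢
  induction z with
  | bot => rw [EReal.sub_bot (EReal.coe_ne_bot _), EReal.sub_top]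
  | top => exact absurd (top_le_iff.1 h) (EReal.coe_ne_top _)
  | coe x => rw [← EReal.coe_sub, ← EReal.coe_sub]; congr 1; ring

lemma loss_eq_zero_iff {γ m c : ℝ} (hγ : 0 < γ) (hγ1 : γ ≠ 1) (hm : 0 < m) (hc : 0 ≤ c) :
    loss γ m c = 0 ↔ c = m ^ (-1 / γ) := by
  constructor
  · intro h
    by_contra hne
    have h1 := crra_eq_sub_loss hγ hγ1 hm hc
    rw [h, EReal.coe_ennreal_zero, sub_zero] at h1
    exact (crra_lt hγ hγ1 hm hc hne).ne h1
  · rintro rfl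
    rw [loss, crra_optimal hγ hγ1 hm, ← EReal.coe_sub, sub_self]
    simp

lemma iSup_crra {γ m k : ℝ} (hγ : 0 < γ) (hγ1 : γ ≠ 1) (hm : 0 < m) (hk : 0 < k) :
    (⨆ v : NNReal, crra γ (k * v) - ((m * (k * v) : ℝ) : EReal)) = (maxUtil γ m : EReal) := by
  apply le_antisymm
  · refine iSup_le fun v => ?_
    have h := crra_le hγ hγ1 hm (mul_nonneg hk.le v.2)
    rw [EReal.sub_le_iff_le_add (by simp) (by simp)]
    exact h
  · have hpos : 0 < m ^ (-1 / γ) := Real.rpow_pos_of_pos hm _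
    refine le_iSup_of_le (m ^ (-1 / γ) / k).toNNReal ?_
    have e : k * ((m ^ (-1 / γ) / k).toNNReal : ℝ) = m ^ (-1 / γ) := by
      rw [Real.coe_toNNReal _ (by positivity)]
      field_simp
    rw [e, crra_optimal hγ hγ1 hm, ← EReal.coe_sub, add_sub_cancel_right]

/-- For $\gamma>1$ the value $-\infty$ at $0$ is the limit from the right, visible once the power is
taken in $[0,\infty]$. Truncation at $0$ gives a continuous function on all of $\mathbb R$, as
needed for elements of $L^2$ of any sign. -/
lemma continuous_crra {γ : ℝ} (hγ1 : γ ≠ 1) : Continuous fun c : ℝ => crra γ (max c 0) := by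
  rcases lt_or_gt_of_ne hγ1 with h | h
  · have e : (fun c : ℝ => crra γ (max c 0))
        = fun c => (((max c 0) ^ (1 - γ) / (1 - γ) : ℝ) : EReal) := by
      ext c
      rw [crra, if_neg (fun h' => absurd h'.2 (not_lt.2 h.le))]
    rw [e]
    refine continuous_coe_real_ereal.comp (Continuous.div_const ?_ _)
    exact (continuous_id.max continuous_const).rpow_const fun _ => Or.inr (by linarith)
  · have hp : 0 < γ - 1 := by linarith
    have e : (fun c : ℝ => crra γ (max c 0))
        = fun c => -(((ENNReal.ofReal c) ^ (1 - γ) / ENNReal.ofReal (γ - 1) : ENNReal) : EReal) := by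
      ext c
      rcases le_or_gt c 0 with hc | hc
      · rw [max_eq_right hc, crra, if_pos ⟨rfl, h⟩, ENNReal.ofReal_of_nonpos hc,
          ENNReal.zero_rpow_of_neg (by linarith), ENNReal.top_div_of_ne_top ENNReal.ofReal_ne_top]
        simp
      · rw [max_eq_left hc.le, crra, if_neg (by simp [hc.ne']), ENNReal.ofReal_rpow_of_pos hc,
          ← ENNReal.ofReal_div_of_pos hp, EReal.coe_ennreal_ofReal, max_eq_left (by positivity),
          ← EReal.coe_neg, ← div_neg, neg_sub]
    rw [e]
    refine (continuous_coe_ennreal_ereal.comp ?_).neg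
    exact (ENNReal.continuous_div_const _ (by simpa using h)).comp
      (ENNReal.continuous_rpow_const.comp ENNReal.continuous_ofReal)

lemma continuous_loss {γ m : ℝ} (hγ1 : γ ≠ 1) : Continuous fun c : ℝ => loss γ m (max c 0) := by
  unfold loss
  refine EReal.continuous_toENNReal.comp ?_
  simp_rw [sub_eq_add_neg]
  have h1 : Continuous fun c : ℝ => ((maxUtil γ m + m * max c 0 : ℝ) : EReal) :=
    continuous_coe_real_ereal.comp (by fun_prop)
  have h2 : Continuous fun c : ℝ => -crra γ (max c 0) := (continuous_crra hγ1).neg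
  rw [continuous_iff_continuousAt]
  intro c
  exact ContinuousAt.comp (f := fun c : ℝ => (((maxUtil γ m + m * max c 0 : ℝ) : EReal),
      -crra γ (max c 0))) (EReal.continuousAt_add (Or.inl (EReal.coe_ne_top _))
      (Or.inl (EReal.coe_ne_bot _)))
    (h1.prodMk h2).continuousAt

/-! ### Measurability of integral functionals on `L²` -/

lemma measurable_crra : Measurable fun p : ℝ × ℝ => crra p.1 p.2 := by
  unfold crra
  refine Measurable.ite ?_ measurable_const (Measurable.coe_real_ereal ?_)
  · exact (measurableSet_eq_fun measurable_snd measurable_const).inter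
      (measurableSet_lt measurable_const measurable_fst)
  · fun_prop

lemma measurable_loss : Measurable fun p : ℝ × ℝ × ℝ => loss p.1 p.2.1 p.2.2 := by
  unfold loss maxUtil
  refine Measurable.ereal_toENNReal ?_
  simp_rw [sub_eq_add_neg (_ : EReal)]
  refine Measurable.add (Measurable.coe_real_ereal (by fun_prop)) (Measurable.neg ?_)
  exact measurable_crra.comp (measurable_fst.prodMk measurable_snd.snd)

/-- Fatou's lemma along an a.e. convergent subsequence. Lower semicontinuity makes the functional
Borel on $L^2$, so the loss of a control is measurable in time without a jointly measurable version
of $u(t,\theta)$. -/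
lemma lowerSemicontinuous_lintegral {k : Circ → ℝ → ENNReal} (hk : ∀ θ, Continuous (k θ))
    (hm : ∀ f : X, AEMeasurable (fun θ => k θ (f θ)) volume) :
    LowerSemicontinuous fun f : X => ∫⁻ θ, k θ (f θ) := by
  rw [lowerSemicontinuous_iff_isClosed_preimage]
  intro r
  refine IsSeqClosed.isClosed fun f g hf hfg => ?_
  obtain ⟨ns, _, hns⟩ := (tendstoInMeasure_of_tendsto_Lp hfg).exists_seq_tendsto_ae
  have h1 : ∫⁻ θ, k θ (g θ) = ∫⁻ θ, liminf (fun i => k θ (f (ns i) θ)) atTop := by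
    refine lintegral_congr_ae ?_
    filter_upwards [hns] with θ hθ
    exact (((hk θ).tendsto _).comp hθ).liminf_eq.symm
  change ∫⁻ θ, k θ (g θ) ≤ r
  rw [h1]
  refine (lintegral_liminf_le' fun i => hm (f (ns i))).trans ?_
  refine (liminf_le_liminf (Eventually.of_forall fun i => hf (ns i))).trans_eq ?_
  exact liminf_const r

lemma aemeasurable_lintegral_comp {k : Circ → ℝ → ENNReal} (hk : ∀ θ, Continuous (k θ))
    (hm : ∀ f : X, AEMeasurable (fun θ => k θ (f θ)) volume) {μ : Measure ℝ} {u : ℝ → X}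
    (hu : AEStronglyMeasurable u μ) : AEMeasurable (fun t => ∫⁻ θ, k θ (u t θ)) μ := by
  borelize X
  exact (lowerSemicontinuous_lintegral hk hm).measurable.comp_aemeasurable hu.aemeasurable

namespace IsNonposSelfAdjoint

variable {H : Type*} [NormedAddCommGroup H] [InnerProductSpace ℝ H] [CompleteSpace H]
  {G : H → H → Prop} (hG : IsNonposSelfAdjoint G)

include hG

/-! ### Mild solutions -/

lemma aestronglyMeasurable_semigroup {μ : Measure ℝ} {k : ℝ → H}
    (hk : AEStronglyMeasurable k μ) (t : ℝ) :
    AEStronglyMeasurable (fun r => hG.semigroup (t - r).toNNReal (k r)) μ := by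
  have h1 : AEStronglyMeasurable (fun r : ℝ => (t - r).toNNReal) μ :=
    (continuous_real_toNNReal.comp (continuous_const.sub continuous_id)).aestronglyMeasurable
  have h2 : AEStronglyMeasurable (fun r : ℝ => ((t - r).toNNReal, k r)) μ := h1.prodMk hk
  obtain ⟨v, hv, hvk⟩ := h2
  have h3 := hG.continuous_semigroup_uncurry.comp_stronglyMeasurable hv
  refine ⟨_, h3, ?_⟩
  filter_upwards [hvk] with r hr
  simp only [← hr]

lemma integrable_semigroup {μ : Measure ℝ} {k : ℝ → H} (hk : Integrable k μ) (t : ℝ) :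
    Integrable (fun r => hG.semigroup (t - r).toNNReal (k r)) μ :=
  hk.mono (hG.aestronglyMeasurable_semigroup hk.1 t)
    (ae_of_all _ fun _ => hG.norm_semigroup_apply_le _ _)

lemma continuousOn_mild {k : ℝ → H} (hk : ∀ T, IntegrableOn k (Ioc 0 T)) :
    ContinuousOn (fun t : ℝ => ∫ r in (0 : ℝ)..t, hG.semigroup (t - r).toNNReal (k r)) (Ici 0) := by
  intro t₀ ht₀
  have ht₀' : 0 ≤ t₀ := ht₀
  -- The indicator moves the variable upper limit into the integrand; continuity then follows from
  -- dominated convergence, the only exceptional $r$ being $t_0$.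
  set F : ℝ → ℝ → H := fun t => (Iic t).indicator fun r => hG.semigroup (t - r).toNNReal (k r)
  have hF : ∀ t ∈ Icc 0 (t₀ + 1), ∫ r in (0 : ℝ)..t, hG.semigroup (t - r).toNNReal (k r)
      = ∫ r in Ioc 0 (t₀ + 1), F t r := by
    intro t ht
    rw [intervalIntegral.integral_of_le ht.1, setIntegral_indicator measurableSet_Iic]
    congr 2
    ext r
    simp only [mem_Ioc, mem_inter_iff, mem_Iic]
    exact ⟨fun h => ⟨⟨h.1, h.2.trans ht.2⟩, h.2⟩, fun h => ⟨h.1.1, h.2⟩⟩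
  have hcont : ContinuousAt (fun t => ∫ r in Ioc 0 (t₀ + 1), F t r) t₀ := by
    refine continuousAt_of_dominated (bound := fun r => ‖k r‖) (Eventually.of_forall fun t => ?_)
      (Eventually.of_forall fun t => ae_of_all _ fun r => ?_) (hk _).norm ?_
    · exact (hG.aestronglyMeasurable_semigroup (hk _).1 t).indicator measurableSet_Iic
    · refine (norm_indicator_le_norm_self _ _).trans (hG.norm_semigroup_apply_le _ _)
    · have : ∀ᵐ r ∂(volume.restrict (Ioc 0 (t₀ + 1))), r ≠ t₀ :=
        ae_restrict_of_ae (by simp [ae_iff, measure_singleton])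
      filter_upwards [this] with r hr
      rcases lt_or_gt_of_ne hr with h | h
      · have hc : ContinuousAt (fun t : ℝ => hG.semigroup (t - r).toNNReal (k r)) t₀ :=
          ((hG.continuous_semigroup_toNNReal (k r)).comp (continuous_id.sub continuous_const)).continuousAt
        refine hc.congr ?_
        filter_upwards [Ioi_mem_nhds h] with t ht
        exact (indicator_of_mem (s := Iic t) (mem_Iic.2 (le_of_lt (mem_Ioi.1 ht)))
          fun r => hG.semigroup (t - r).toNNReal (k r)).symm
      · refine (continuousAt_const (y := (0 : H))).congr ?_
        filter_upwards [Iio_mem_nhds h] with t ht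
        exact (indicator_of_notMem (fun h' => absurd (mem_Iic.1 h') (not_le.2 ht)) _).symm
  refine hcont.continuousWithinAt.congr_of_eventuallyEq ?_ (hF t₀ ⟨ht₀', by linarith⟩)
  filter_upwards [self_mem_nhdsWithin,
    nhdsWithin_le_nhds (Iio_mem_nhds (lt_add_one t₀))] with t h1 h2
  exact hF t ⟨h1, le_of_lt h2⟩

lemma mild_const (f : H) (t : ℝ) :
    ∫ r in (0 : ℝ)..t, hG.semigroup (t - r).toNNReal f
      = ∫ s in (0 : ℝ)..t, hG.semigroup s.toNNReal f := by
  rw [intervalIntegral.integral_comp_sub_left (fun s : ℝ => hG.semigroup s.toNNReal f) t]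
  simp

/-- The Laplace transform of the mild solution, tested against `w`. -/
lemma laplace_mild {l : ℝ} (hl : 0 < l) {k : ℝ → H} (hk : ∀ T, IntegrableOn k (Ioc 0 T))
    (hk' : IntegrableOn (fun r => Real.exp (-l * r) • k r) (Ioi 0)) (w : H) :
    IntegrableOn (fun t => Real.exp (-l * t) *
      inner ℝ w (∫ r in (0 : ℝ)..t, hG.semigroup (t - r).toNNReal (k r))) (Ioi 0) ∧
    ∫ t in Ioi (0 : ℝ), Real.exp (-l * t) *
      inner ℝ w (∫ r in (0 : ℝ)..t, hG.semigroup (t - r).toNNReal (k r))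
      = inner ℝ (hG.resolvent l hl w) (∫ r in Ioi (0 : ℝ), Real.exp (-l * r) • k r) := by
  obtain ⟨hW, hW'⟩ := hG.integral_exp_semigroup hl w
  -- The integrand is a convolution: $e^{-lt}=e^{-lr}e^{-l(t-r)}$, and symmetry moves the semigroup
  -- onto $w$. The integral of a convolution is the pairing of the two integrals, one of which is
  -- the resolvent of $w$.
  set K : ℝ → H := (Ioi (0 : ℝ)).indicator fun r => Real.exp (-l * r) • k r with hK
  set W : ℝ → H := (Ioi (0 : ℝ)).indicator fun s => Real.exp (-l * s) • hG.semigroup s.toNNReal w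
    with hWdef
  have hKi : Integrable K := hk'.integrable_indicator measurableSet_Ioi
  have hWi : Integrable W := hW.integrable_indicator measurableSet_Ioi
  let B : H →L[ℝ] H →L[ℝ] ℝ := innerSL ℝ
  have hconv : MeasureTheory.convolution K W B volume = (Ioi (0 : ℝ)).indicator (fun t =>
      Real.exp (-l * t) *
        inner ℝ w (∫ r in (0 : ℝ)..t, hG.semigroup (t - r).toNNReal (k r))) := by
    ext t
    change ∫ r, inner ℝ (K r) (W (t - r)) = _
    have hzero : ∀ r, r ∉ Ioo 0 t → inner ℝ (K r) (W (t - r)) = 0 := by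
      intro r hr
      by_cases h : 0 < r
      · have h2 : t - r ∉ Ioi (0 : ℝ) := fun h' => hr ⟨h, by simpa using h'⟩
        rw [hWdef, indicator_of_notMem h2, inner_zero_right]
      · rw [hK, indicator_of_notMem (by simpa using h), inner_zero_left]
    by_cases ht : 0 < t
    · rw [indicator_of_mem (mem_Ioi.2 ht), intervalIntegral.integral_of_le ht.le,
        ← integral_inner (hG.integrable_semigroup (hk t) t), ← integral_const_mul,
        ← setIntegral_eq_integral_of_forall_compl_eq_zero hzero, integral_Ioc_eq_integral_Ioo]
      refine setIntegral_congr_fun measurableSet_Ioo fun r hr => ?_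
      have h2 : t - r ∈ Ioi (0 : ℝ) := by simpa using hr.2
      simp only [hK, hWdef]
      rw [indicator_of_mem (mem_Ioi.2 hr.1), indicator_of_mem h2, inner_smul_left, inner_smul_right,
        ← hG.semigroup_symm, real_inner_comm, conj_trivial, ← mul_assoc, ← Real.exp_add]
      congr 2; ring
    · rw [indicator_of_notMem (by simpa using ht)]
      rw [integral_congr_ae (g := fun _ => (0 : ℝ)) (ae_of_all _ fun r => hzero r
        fun h => ht (h.1.trans h.2)), integral_zero]
  have h1 := Integrable.integrable_convolution B hKi hWi
  have h2 := integral_convolution B hKi hWi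
  rw [hconv] at h1 h2
  rw [integrable_indicator_iff measurableSet_Ioi] at h1
  rw [integral_indicator measurableSet_Ioi, integral_indicator measurableSet_Ioi,
    integral_indicator measurableSet_Ioi, hW'] at h2
  refine ⟨h1, h2.trans ?_⟩
  exact real_inner_comm _ _

end IsNonposSelfAdjoint

/-- Lets Bochner integrals of nonnegative $X$-valued functions be nonnegative, as used in
`Coeffs.mild_nonneg`. -/
instance isOrderedModule_X : IsOrderedModule ℝ X where
  smul_le_smul_of_nonneg_left c hc f g hfg := by
    rw [← Lp.coeFn_le] at *
    filter_upwards [hfg, Lp.coeFn_smul c f, Lp.coeFn_smul c g] with θ h1 h2 h3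
    rw [h2, h3]
    exact mul_le_mul_of_nonneg_left h1 hc
  smul_le_smul_of_nonneg_right f hf c d hcd := by
    rw [← Lp.coeFn_nonneg] at hf
    rw [← Lp.coeFn_le]
    filter_upwards [hf, Lp.coeFn_smul c f, Lp.coeFn_smul d f] with θ h1 h2 h3
    rw [h2, h3]
    exact mul_le_mul_of_nonneg_right hcd h1

lemma Coeffs.mild_nonneg {σ δ : Circ → ℝ} (hc : Coeffs σ δ) {k : ℝ → X}
    (hk : ∀ᵐ r ∂(volume.restrict (Ici (0 : ℝ))), 0 ≤ k r) {t : ℝ} (ht : 0 ≤ t) :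
    0 ≤ ∫ r in (0 : ℝ)..t, hc.isNonposSelfAdjoint.semigroup (t - r).toNNReal (k r) := by
  rw [intervalIntegral.integral_of_le ht]
  refine integral_nonneg_of_ae ?_
  have := ae_restrict_of_ae_restrict_of_subset
    (Ioc_subset_Ioi_self.trans Ioi_subset_Ici_self : Ioc (0 : ℝ) t ⊆ Ici 0) hk
  filter_upwards [this] with r hr
  exact hc.semigroup_nonneg _ hr

lemma IsBddMeas.memLp {m : Circ → ℝ} (hm : IsBddMeas m) : MemLp m 2 volume := by
  obtain ⟨C, hC⟩ := hm.2
  exact MemLp.of_bound hm.1.aestronglyMeasurable C (ae_of_all _ hC)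

lemma isBddMeas_of_nonneg {m : Circ → ℝ} (hm : Measurable m) (h0 : ∀ θ, 0 ≤ m θ)
    (hb : ∃ M, ∀ θ, m θ ≤ M) : IsBddMeas m := by
  obtain ⟨M, hM⟩ := hb
  exact ⟨hm, M, fun θ => by rw [Real.norm_of_nonneg (h0 θ)]; exact hM θ⟩

/-! ### The data of the control problem and integrability of the candidate control. -/

/-- The marginal utility `η α / (a - 1)` of the optimal consumption. -/
def marginal (η a : Circ → ℝ) (α : X) (θ : Circ) : ℝ := η θ * α θ / (a θ - 1)

/-- The total utility loss of the investment `u`. -/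
def totalLoss (η γ a : Circ → ℝ) (α u : X) : ENNReal :=
  ∫⁻ θ, loss (γ θ) (marginal η a α θ) (max ((a θ - 1) * u θ) 0)

/-- The data of the control problem, together with the solution `α` of the elliptic equation. -/
structure ControlData (ρ : ℝ) (σ δ η w γ a : Circ → ℝ) (α : X) : Prop where
  ρ_pos : 0 < ρ
  coeffs : Coeffs σ δ
  γ_meas : Measurable γ
  γ_range : ∃ K : Set ℝ, IsCompact K ∧ (K ⊆ Ioo 0 1 ∨ K ⊆ Ioi 1) ∧ ∀ θ, γ θ ∈ K
  a_meas : Measurable a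
  one_lt_a : ∀ θ, 1 < a θ
  η_bdd : IsBddMeas η
  η_pos : ∀ θ, 0 < η θ
  w_bdd : IsBddMeas w
  w_nonneg : ∀ θ, 0 ≤ w θ
  w_ne : ¬ ∀ᵐ θ, w θ = 0
  memLp_data : MemLp (fun θ => (a θ - 1) ^ ((1 - γ θ) / γ θ) * (η θ) ^ (-1 / γ θ)) 2 volume
  elliptic : SolvesElliptic σ δ ρ w α

namespace ControlData

variable {ρ : ℝ} {σ δ η w γ a : Circ → ℝ} {α : X} (D : ControlData ρ σ δ η w γ a α)

include D

lemma exists_range : ∃ K : Set ℝ, IsCompact K ∧ (∀ x ∈ K, 0 < x ∧ x ≠ 1) ∧ ∀ θ, γ θ ∈ K := by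
  obtain ⟨K, hK, h | h, hγ⟩ := D.γ_range
  · exact ⟨K, hK, fun x hx => ⟨(h hx).1, (h hx).2.ne⟩, hγ⟩
  · exact ⟨K, hK, fun x hx => ⟨one_pos.trans (h hx), (ne_of_lt (h hx)).symm⟩, hγ⟩

lemma γ_pos (θ : Circ) : 0 < γ θ := by
  obtain ⟨K, _, h, hγ⟩ := D.exists_range
  exact (h _ (hγ θ)).1

lemma γ_ne_one (θ : Circ) : γ θ ≠ 1 := by
  obtain ⟨K, _, h, hγ⟩ := D.exists_range
  exact (h _ (hγ θ)).2

lemma a_sub_pos (θ : Circ) : 0 < a θ - 1 := sub_pos.2 (D.one_lt_a θ)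

lemma toX_w_nonneg : 0 ≤ toX w := by
  rw [X_nonneg_iff]
  filter_upwards [toX_ae D.w_bdd.memLp] with θ h
  rw [h]
  exact D.w_nonneg θ

lemma toX_w_ne_zero : toX w ≠ 0 := by
  intro h
  apply D.w_ne
  filter_upwards [toX_ae D.w_bdd.memLp, Lp.coeFn_zero ℝ 2 (volume : Measure Circ)] with θ h1 h2
  rw [← h1, h, h2, Pi.zero_apply]

lemma bounds : ∃ c C : ℝ, 0 < c ∧ ∀ᵐ θ, c ≤ α θ ∧ α θ ≤ C :=
  D.coeffs.elliptic_bounds D.ρ_pos D.toX_w_nonneg D.toX_w_ne_zero D.elliptic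

lemma α_pos : ∀ᵐ θ, 0 < α θ := by
  obtain ⟨c, C, hc, h⟩ := D.bounds
  filter_upwards [h] with θ hθ using hc.trans_le hθ.1

lemma α_eq : α = D.coeffs.isNonposSelfAdjoint.resolvent ρ D.ρ_pos (toX w) :=
  D.coeffs.isNonposSelfAdjoint.eq_resolvent D.ρ_pos D.elliptic

lemma measurable_marginal : Measurable (marginal η a α) := by
  have h1 := (Lp.stronglyMeasurable α).measurable
  have h2 := D.η_bdd.1
  have h3 := D.a_meas
  unfold marginal
  fun_prop

lemma marginal_pos : ∀ᵐ θ, 0 < marginal η a α θ := by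
  filter_upwards [D.α_pos] with θ h
  exact div_pos (mul_pos (D.η_pos θ) h) (D.a_sub_pos θ)

lemma marginal_mul (θ : Circ) (v : ℝ) :
    marginal η a α θ * ((a θ - 1) * v) = η θ * v * α θ := by
  have := (D.a_sub_pos θ).ne'
  unfold marginal
  field_simp

lemma mul_optInvestment (θ : Circ) :
    (a θ - 1) * optInvestment η γ a α θ = marginal η a α θ ^ (-1 / γ θ) := by
  rw [optInvestment, mul_inv_cancel_left₀ (D.a_sub_pos θ).ne']
  rfl

lemma optInvestment_pos : ∀ᵐ θ, 0 < optInvestment η γ a α θ := by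
  filter_upwards [D.marginal_pos] with θ h
  exact mul_pos (inv_pos.2 (D.a_sub_pos θ)) (Real.rpow_pos_of_pos h _)

lemma measurable_optInvestment : Measurable (optInvestment η γ a α) := by
  have h1 := D.measurable_marginal
  have h2 := D.γ_meas
  have h3 := D.a_meas
  exact ((h3.sub_const 1).inv).mul (h1.pow (measurable_const.div h2))

/-- The profile factors as $\alpha^{-1/\gamma}$ times the function assumed to be in $L^2$. The first
factor is bounded, as $\alpha\ge c>0$ and $\gamma$ stays in a compact subset of $(0,\infty)$. -/
lemma memLp_optInvestment : MemLp (optInvestment η γ a α) 2 volume := by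
  obtain ⟨c, C, hc, hα⟩ := D.bounds
  obtain ⟨K, hK, hK', hγ⟩ := D.exists_range
  have hcont : ContinuousOn (fun x : ℝ => c ^ (-1 / x)) K :=
    ContinuousOn.rpow continuousOn_const
      (continuousOn_const.div continuousOn_id fun x hx => (hK' x hx).1.ne')
      fun x _ => Or.inl hc.ne'
  obtain ⟨B, hB⟩ := hK.exists_bound_of_continuousOn hcont
  refine D.memLp_data.of_le_mul (c := B) D.measurable_optInvestment.aestronglyMeasurable ?_
  filter_upwards [hα] with θ hθ
  have hk := D.a_sub_pos θ
  have hη := D.η_pos θ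
  have hα0 : 0 < α θ := hc.trans_le hθ.1
  have hγ0 := D.γ_pos θ
  have e : optInvestment η γ a α θ
      = α θ ^ (-1 / γ θ) * ((a θ - 1) ^ ((1 - γ θ) / γ θ) * (η θ) ^ (-1 / γ θ)) := by
    rw [optInvestment, Real.div_rpow (mul_pos hη hα0).le hk.le, Real.mul_rpow hη.le hα0.le]
    have e1 : (a θ - 1) ^ ((1 - γ θ) / γ θ) = (a θ - 1)⁻¹ / (a θ - 1) ^ (-1 / γ θ) := by
      rw [← Real.rpow_neg_one, ← Real.rpow_sub hk]
      congr 1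
      field_simp
      ring
    rw [e1]
    ring
  rw [e, norm_mul]
  refine mul_le_mul_of_nonneg_right ?_ (norm_nonneg _)
  rw [Real.norm_of_nonneg (Real.rpow_nonneg hα0.le _)]
  refine le_trans (Real.rpow_le_rpow_of_nonpos hc hθ.1 ?_)
    ((le_abs_self _).trans (hB _ (hγ θ)))
  rw [neg_div]
  exact neg_nonpos.2 (one_div_pos.2 hγ0).le

lemma toX_opt_ae : toX (optInvestment η γ a α) =ᵐ[volume] optInvestment η γ a α :=
  toX_ae D.memLp_optInvestment

lemma toX_opt_nonneg : 0 ≤ toX (optInvestment η γ a α) := by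
  rw [X_nonneg_iff]
  filter_upwards [D.toX_opt_ae, D.optInvestment_pos] with θ h1 h2
  rw [h1]; exact h2.le

/-- Since $m\cdot m^{-1/\gamma}=\eta\,\alpha\,i^*$, the maximal utility is
$\frac{\gamma}{1-\gamma}\eta\,\alpha\,i^*$: a bounded function, as $\gamma$ keeps away from $1$,
times $i^*\in L^2$. -/
lemma integrable_maxUtil : Integrable (fun θ => maxUtil (γ θ) (marginal η a α θ)) := by
  obtain ⟨c, C, hc, hα⟩ := D.bounds
  obtain ⟨K, hK, hK', hγ⟩ := D.exists_range
  obtain ⟨M, hM⟩ := D.η_bdd.2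
  have hcont : ContinuousOn (fun x : ℝ => x / (1 - x)) K :=
    continuousOn_id.div (continuousOn_const.sub continuousOn_id)
      fun x hx => sub_ne_zero.2 (Ne.symm (hK' x hx).2)
  obtain ⟨B, hB⟩ := hK.exists_bound_of_continuousOn hcont
  have hmeas : Measurable (fun θ => maxUtil (γ θ) (marginal η a α θ)) := by
    have h1 := D.measurable_marginal
    have h2 := D.γ_meas
    exact (h2.div (h2.const_sub 1)).mul (h1.pow ((h2.const_div 1).const_sub 1))
  have : MemLp (fun θ => maxUtil (γ θ) (marginal η a α θ)) 2 volume := by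
    refine D.memLp_optInvestment.of_le_mul (c := B * (M * C)) hmeas.aestronglyMeasurable ?_
    filter_upwards [hα, D.marginal_pos] with θ h1 h2
    have hα0 : 0 < α θ := hc.trans_le h1.1
    rw [maxUtil, ← mul_rpow_neg_inv h2, ← D.mul_optInvestment, D.marginal_mul]
    have e : η θ * optInvestment η γ a α θ * α θ = η θ * α θ * optInvestment η γ a α θ := by ring
    rw [e, norm_mul, norm_mul, ← mul_assoc, norm_mul (η θ)]
    have b1 : ‖γ θ / (1 - γ θ)‖ ≤ B := hB _ (hγ θ)
    have b2 : ‖α θ‖ ≤ C := by rw [Real.norm_of_nonneg hα0.le]; exact h1.2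
    have b3 : ‖η θ‖ ≤ M := hM θ
    have hB0 : 0 ≤ B := (norm_nonneg _).trans b1
    have hM0 : 0 ≤ M := (norm_nonneg _).trans b3
    gcongr
  exact this.integrable (by norm_num)

/-! ### The static problem -/

lemma crra_ae {u : X} (hu : 0 ≤ u) : ∀ᵐ θ, crra (γ θ) ((a θ - 1) * u θ)
    = ((maxUtil (γ θ) (marginal η a α θ) + mulX η u θ * α θ : ℝ) : EReal)
      - (loss (γ θ) (marginal η a α θ) (max ((a θ - 1) * u θ) 0) : EReal) := by
  filter_upwards [X_nonneg_iff.1 hu, D.marginal_pos, D.η_bdd.mulX_ae u] with θ h1 h2 h3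
  have h4 : 0 ≤ (a θ - 1) * u θ := mul_nonneg (D.a_sub_pos θ).le h1
  rw [max_eq_left h4, crra_eq_sub_loss (D.γ_pos θ) (D.γ_ne_one θ) h2 h4, D.marginal_mul, h3]

lemma measurable_loss_comp (f : X) : AEMeasurable
    (fun θ => loss (γ θ) (marginal η a α θ) (max ((a θ - 1) * f θ) 0)) volume := by
  have h1 := (Lp.stronglyMeasurable f).measurable
  have h2 := D.a_meas
  exact (measurable_loss.comp (D.γ_meas.prodMk (D.measurable_marginal.prodMk
    (((h2.sub_const 1).mul h1).max measurable_const)))).aemeasurable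

lemma integrable_static (u : X) :
    Integrable (fun θ => maxUtil (γ θ) (marginal η a α θ) + mulX η u θ * α θ) :=
  D.integrable_maxUtil.add (integrable_mul_X _ _)

lemma hasEIntegral_crra {u : X} (hu : 0 ≤ u) :
    HasEIntegral volume (fun θ => crra (γ θ) ((a θ - 1) * u θ)) :=
  (hasEIntegral_coe_sub (D.integrable_static u) (D.measurable_loss_comp u)).congr_ae
    (EventuallyEq.symm (D.crra_ae hu))

lemma utility_eq {u : X} (hu : 0 ≤ u) : utility γ a u
    = (((∫ θ, maxUtil (γ θ) (marginal η a α θ)) + inner ℝ α (mulX η u) : ℝ) : EReal)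
      - (totalLoss η γ a α u : EReal) := by
  rw [utility, eintegral_congr_ae (D.crra_ae hu),
    eintegral_coe_sub (D.integrable_static u) (D.measurable_loss_comp u),
    integral_add D.integrable_maxUtil (integrable_mul_X _ _), real_inner_comm, inner_X]
  rfl

lemma totalLoss_eq_zero_iff {u : X} (hu : 0 ≤ u) :
    totalLoss η γ a α u = 0 ↔ u = toX (optInvestment η γ a α) := by
  rw [totalLoss, lintegral_eq_zero_iff' (D.measurable_loss_comp u)]
  have key : ∀ᵐ θ, (loss (γ θ) (marginal η a α θ) (max ((a θ - 1) * u θ) 0) = 0 ↔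
      u θ = toX (optInvestment η γ a α) θ) := by
    filter_upwards [X_nonneg_iff.1 hu, D.marginal_pos, D.toX_opt_ae] with θ h1 h2 h3
    have h4 : 0 ≤ (a θ - 1) * u θ := mul_nonneg (D.a_sub_pos θ).le h1
    rw [max_eq_left h4, loss_eq_zero_iff (D.γ_pos θ) (D.γ_ne_one θ) h2 h4, h3,
      ← D.mul_optInvestment, mul_right_inj' (D.a_sub_pos θ).ne']
  constructor
  · intro h
    ext1
    filter_upwards [h, key] with θ h1 h2
    exact h2.1 h1
  · intro h
    filter_upwards [key] with θ h2
    exact h2.2 (by rw [h])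

lemma aemeasurable_totalLoss {μ : Measure ℝ} {u : ℝ → X} (hu : AEStronglyMeasurable u μ) :
    AEMeasurable (fun t => totalLoss η γ a α (u t)) μ :=
  aemeasurable_lintegral_comp
    (k := fun θ x => loss (γ θ) (marginal η a α θ) (max ((a θ - 1) * x) 0))
    (fun θ => (continuous_loss (D.γ_ne_one θ)).comp (continuous_const.mul continuous_id))
    D.measurable_loss_comp hu

lemma qConst_eq : qConst ρ η γ a α
    = ((1 / ρ * ∫ θ, maxUtil (γ θ) (marginal η a α θ) : ℝ) : EReal) := by
  rw [qConst, EReal.coe_mul, ← eintegral_coe D.integrable_maxUtil]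
  congr 1
  refine eintegral_congr_ae ?_
  filter_upwards [D.marginal_pos] with θ h
  rw [← iSup_crra (D.γ_pos θ) (D.γ_ne_one θ) h (D.a_sub_pos θ)]
  simp_rw [D.marginal_mul]

end ControlData

lemma restrict_Ici_eq : (volume : Measure ℝ).restrict (Ici 0) = volume.restrict (Ioi 0) :=
  Measure.restrict_congr_set Ioi_ae_eq_Ici.symm

lemma ereal_payoff (e r s : ℝ) (he : 0 < e) (Φ : ENNReal) :
    (e : EReal) * (((r : EReal) - (Φ : EReal)) - (s : EReal))
      = ((e * (r - s) : ℝ) : EReal) - ((ENNReal.ofReal e * Φ : ENNReal) : EReal) := by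
  induction Φ with
  | top =>
    rw [ENNReal.mul_top (by simpa using he), EReal.coe_ennreal_top, EReal.sub_top, EReal.sub_top,
      EReal.bot_sub, EReal.coe_mul_bot_of_pos he]
  | coe x =>
    have h1 : (((x : ENNReal)) : EReal) = ((x : ℝ) : EReal) := rfl
    rw [EReal.coe_ennreal_mul, EReal.coe_ennreal_ofReal, max_eq_left he.le, h1, ← EReal.coe_sub,
      ← EReal.coe_sub, ← EReal.coe_mul, ← EReal.coe_mul, ← EReal.coe_sub]
    congr 1; ring

/-! ### The dynamic problem: the objective formula, optimality and uniqueness. -/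

namespace ControlData

variable {ρ : ℝ} {σ δ η w γ a : Circ → ℝ} {α : X} (D : ControlData ρ σ δ η w γ a α)

include D

lemma mulX_nonneg {u : X} (hu : 0 ≤ u) : 0 ≤ mulX η u := by
  rw [X_nonneg_iff] at hu ⊢
  filter_upwards [hu, D.η_bdd.mulX_ae u] with θ h1 h2
  rw [h2]; exact mul_nonneg (D.η_pos θ).le h1

section Admissible

variable {u : ℝ → X} (hu : Admissible ρ η u)

include hu

lemma integrableOn_mulX (T : ℝ) : IntegrableOn (fun r => mulX η (u r)) (Ioc 0 T) := by
  have h1 : IntegrableOn u (Icc 0 T) :=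
    hu.locallyIntegrable.integrableOn_compact_subset Icc_subset_Ici_self isCompact_Icc
  exact (mulXL D.η_bdd).integrable_comp (h1.mono_set Ioc_subset_Icc_self)

lemma integrableOn_exp_mulX :
    IntegrableOn (fun r => Real.exp (-ρ * r) • mulX η (u r)) (Ioi 0) := by
  have h1 : AEStronglyMeasurable u (volume.restrict (Ici 0)) :=
    hu.locallyIntegrable.aestronglyMeasurable
  have h2 : AEStronglyMeasurable (fun r => mulX η (u r)) (volume.restrict (Ici 0)) :=
    (mulXL D.η_bdd).continuous.comp_aestronglyMeasurable h1
  refine IntegrableOn.mono_set ?_ Ioi_subset_Ici_self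
  refine hu.integrable.mono' ((by fun_prop :
    Continuous fun r : ℝ => Real.exp (-ρ * r)).aestronglyMeasurable.smul h2) (ae_of_all _ fun r => ?_)
  rw [norm_smul, Real.norm_of_nonneg (Real.exp_pos _).le]

lemma ae_mulX_nonneg : ∀ᵐ r ∂(volume.restrict (Ici (0 : ℝ))), 0 ≤ mulX η (u r) := by
  filter_upwards [hu.nonneg] with r hr using D.mulX_nonneg hr

/-- The integrable part of the payoff. -/
lemma integrable_part (x : X) :
    IntegrableOn (fun t => Real.exp (-ρ * t) * (((∫ θ, maxUtil (γ θ) (marginal η a α θ))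
      + inner ℝ α (mulX η (u t))) - inner ℝ (toX w)
        (trajectory D.coeffs.isNonposSelfAdjoint.semigroup η x u t))) (Ioi 0) ∧
    ∫ t in Ioi (0 : ℝ), Real.exp (-ρ * t) * (((∫ θ, maxUtil (γ θ) (marginal η a α θ))
      + inner ℝ α (mulX η (u t))) - inner ℝ (toX w)
        (trajectory D.coeffs.isNonposSelfAdjoint.semigroup η x u t))
      = -inner ℝ α x + 1 / ρ * ∫ θ, maxUtil (γ θ) (marginal η a α θ) := by
  set hG := D.coeffs.isNonposSelfAdjoint
  set g := ∫ θ, maxUtil (γ θ) (marginal η a α θ)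
  have hk' := D.integrableOn_exp_mulX hu
  obtain ⟨l1, l2⟩ := hG.laplace_mild D.ρ_pos (D.integrableOn_mulX hu) hk' (toX w)
  obtain ⟨s1, s2⟩ := hG.integral_exp_semigroup D.ρ_pos x
  rw [← D.α_eq] at l2
  have i1 : IntegrableOn (fun t => Real.exp (-ρ * t) * g) (Ioi 0) :=
    (integrableOn_exp_mul_Ioi (neg_neg_of_pos D.ρ_pos) 0).mul_const _
  have i2 : IntegrableOn (fun t => inner ℝ α (Real.exp (-ρ * t) • mulX η (u t))) (Ioi 0) :=
    hk'.const_inner α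
  have i3 : IntegrableOn (fun t : ℝ => inner ℝ (toX w)
      (Real.exp (-ρ * t) • hG.semigroup t.toNNReal x)) (Ioi 0) := s1.const_inner _
  have e1 : ∫ t in Ioi (0 : ℝ), Real.exp (-ρ * t) * g = 1 / ρ * g := by
    rw [integral_mul_const, integral_exp_mul_Ioi (neg_neg_of_pos D.ρ_pos)]
    simp
  have e2 : ∫ t in Ioi (0 : ℝ), inner ℝ α (Real.exp (-ρ * t) • mulX η (u t))
      = inner ℝ α (∫ r in Ioi (0 : ℝ), Real.exp (-ρ * r) • mulX η (u r)) := integral_inner hk' α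
  have e3 : ∫ t in Ioi (0 : ℝ), inner ℝ (toX w) (Real.exp (-ρ * t) • hG.semigroup t.toNNReal x)
      = inner ℝ α x := by
    rw [integral_inner s1, s2, ← hG.resolvent_symm, ← D.α_eq]
  have hfun : (fun t => Real.exp (-ρ * t) * ((g + inner ℝ α (mulX η (u t))) - inner ℝ (toX w)
        (trajectory hG.semigroup η x u t)))
      = fun t => ((Real.exp (-ρ * t) * g + inner ℝ α (Real.exp (-ρ * t) • mulX η (u t)))
        - inner ℝ (toX w) (Real.exp (-ρ * t) • hG.semigroup t.toNNReal x))
        - Real.exp (-ρ * t) * inner ℝ (toX w)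
          (∫ r in (0 : ℝ)..t, hG.semigroup (t - r).toNNReal (mulX η (u r))) := by
    ext t
    rw [trajectory, inner_add_right, inner_smul_right, inner_smul_right]
    ring
  rw [hfun]
  refine ⟨((i1.add i2).sub i3).sub l1, ?_⟩
  have i12 : IntegrableOn (fun t => Real.exp (-ρ * t) * g
      + inner ℝ α (Real.exp (-ρ * t) • mulX η (u t))) (Ioi 0) := i1.add i2
  have i123 : IntegrableOn (fun t => Real.exp (-ρ * t) * g
      + inner ℝ α (Real.exp (-ρ * t) • mulX η (u t))
      - inner ℝ (toX w) (Real.exp (-ρ * t) • hG.semigroup t.toNNReal x)) (Ioi 0) := i12.sub i3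
  -- The pairing of $\alpha$ with $\int_0^\infty e^{-\rho r}\eta u(r)\,dr$ appears twice, as the
  -- linear part of the utility (`e2`) and as the pollution cost of the investment (`l2`), and
  -- cancels.
  rw [integral_sub i123 l1, integral_sub i12 i3, integral_add i1 i2, e1, e2, e3, l2]
  ring

lemma payoff_ae (x : X) : ∀ᵐ t ∂(volume.restrict (Ici (0 : ℝ))),
    payoff ρ w γ a u (trajectory D.coeffs.isNonposSelfAdjoint.semigroup η x u) t
      = ((Real.exp (-ρ * t) * (((∫ θ, maxUtil (γ θ) (marginal η a α θ))
        + inner ℝ α (mulX η (u t))) - inner ℝ (toX w)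
        (trajectory D.coeffs.isNonposSelfAdjoint.semigroup η x u t)) : ℝ) : EReal)
        - ((ENNReal.ofReal (Real.exp (-ρ * t)) * totalLoss η γ a α (u t) : ENNReal) : EReal) := by
  filter_upwards [hu.nonneg] with t ht
  rw [payoff, D.utility_eq ht, ereal_payoff _ _ _ (Real.exp_pos _)]

lemma aemeasurable_loss_time : AEMeasurable
    (fun t => ENNReal.ofReal (Real.exp (-ρ * t)) * totalLoss η γ a α (u t))
    (volume.restrict (Ici (0 : ℝ))) := by
  have h1 : Measurable fun t : ℝ => ENNReal.ofReal (Real.exp (-ρ * t)) := by fun_prop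
  exact h1.aemeasurable.mul (D.aemeasurable_totalLoss hu.locallyIntegrable.aestronglyMeasurable)

lemma hasEIntegral_payoff (x : X) : HasEIntegral (volume.restrict (Ici 0))
    (payoff ρ w γ a u (trajectory D.coeffs.isNonposSelfAdjoint.semigroup η x u)) := by
  refine (hasEIntegral_coe_sub ?_ (D.aemeasurable_loss_time hu)).congr_ae
    (EventuallyEq.symm (D.payoff_ae hu x))
  rw [restrict_Ici_eq]
  exact (D.integrable_part hu x).1

/-- The objective is the optimal welfare minus the discounted utility loss. -/
lemma objective_eq (x : X) :
    objective D.coeffs.isNonposSelfAdjoint.semigroup ρ η w γ a x u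
      = ((-inner ℝ α x : ℝ) : EReal) + qConst ρ η γ a α
        - ((∫⁻ t in Ici (0 : ℝ), ENNReal.ofReal (Real.exp (-ρ * t)) * totalLoss η γ a α (u t) :
          ENNReal) : EReal) := by
  have hi := D.integrable_part hu x
  rw [objective, eintegral_congr_ae (D.payoff_ae hu x), eintegral_coe_sub ?_
    (D.aemeasurable_loss_time hu), D.qConst_eq, ← EReal.coe_add, restrict_Ici_eq, hi.2]
  rw [restrict_Ici_eq]
  exact hi.1

lemma continuousOn_trajectory (x : X) :
    ContinuousOn (trajectory D.coeffs.isNonposSelfAdjoint.semigroup η x u) (Ici 0) :=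
  (D.coeffs.isNonposSelfAdjoint.continuous_semigroup_toNNReal x).continuousOn.add
    (D.coeffs.isNonposSelfAdjoint.continuousOn_mild (D.integrableOn_mulX hu))

lemma trajectory_nonneg {x : X} (hx : 0 ≤ x) {t : ℝ} (ht : 0 ≤ t) :
    0 ≤ trajectory D.coeffs.isNonposSelfAdjoint.semigroup η x u t :=
  add_nonneg (D.coeffs.semigroup_nonneg _ hx) (D.coeffs.mild_nonneg (D.ae_mulX_nonneg hu) ht)

end Admissible

lemma admissible_const {v : X} (hv : 0 ≤ v) : Admissible ρ η fun _ => v where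
  locallyIntegrable := (locallyIntegrable_const v).locallyIntegrableOn _
  nonneg := ae_of_all _ fun _ => hv
  integrable := by
    rw [IntegrableOn, restrict_Ici_eq]
    exact (integrableOn_exp_mul_Ioi (neg_neg_of_pos D.ρ_pos) 0).mul_const _

lemma admissible_opt : Admissible ρ η fun _ => toX (optInvestment η γ a α) :=
  D.admissible_const D.toX_opt_nonneg

lemma objective_opt (x : X) : objective D.coeffs.isNonposSelfAdjoint.semigroup ρ η w γ a x
    (fun _ => toX (optInvestment η γ a α)) = ((-inner ℝ α x : ℝ) : EReal) + qConst ρ η γ a α := by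
  rw [D.objective_eq D.admissible_opt, (D.totalLoss_eq_zero_iff D.toX_opt_nonneg).2 rfl]
  simp

lemma objective_le {u : ℝ → X} (hu : Admissible ρ η u) (x : X) :
    objective D.coeffs.isNonposSelfAdjoint.semigroup ρ η w γ a x u
      ≤ ((-inner ℝ α x : ℝ) : EReal) + qConst ρ η γ a α := by
  rw [D.objective_eq hu, sub_eq_add_neg]
  nth_rewrite 2 [← add_zero (((-inner ℝ α x : ℝ) : EReal) + qConst ρ η γ a α)]
  gcongr
  exact EReal.neg_le_zero.2 (EReal.coe_ennreal_nonneg _)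

lemma isOptimal_opt (x : X) : IsOptimal D.coeffs.isNonposSelfAdjoint.semigroup ρ η w γ a x
    (fun _ => toX (optInvestment η γ a α)) :=
  ⟨D.admissible_opt, fun v hv => by rw [D.objective_opt]; exact D.objective_le hv x⟩

lemma value_eq (x : X) : value D.coeffs.isNonposSelfAdjoint.semigroup ρ η w γ a x
    = ((-inner ℝ α x : ℝ) : EReal) + qConst ρ η γ a α := by
  apply le_antisymm
  · exact iSup₂_le fun u hu => D.objective_le hu x
  · rw [← D.objective_opt]
    exact le_iSup₂ (f := fun (u : ℝ → X) (_ : Admissible ρ η u) =>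
      objective D.coeffs.isNonposSelfAdjoint.semigroup ρ η w γ a x u) _ D.admissible_opt

/-- Because $-\langle\alpha,x\rangle+q$ is finite, a control attaining it has zero discounted loss;
the loss then vanishes for a.e. $t$, which determines $u(t)$. -/
lemma eq_opt_of_isOptimal {u : ℝ → X} {x : X}
    (hu : IsOptimal D.coeffs.isNonposSelfAdjoint.semigroup ρ η w γ a x u) :
    ∀ᵐ t ∂(volume.restrict (Ici (0 : ℝ))), u t = toX (optInvestment η γ a α) := by
  have h1 := hu.2 _ D.admissible_opt
  rw [D.objective_opt, D.objective_eq hu.1, D.qConst_eq, ← EReal.coe_add] at h1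
  have h2 : ∫⁻ t in Ici (0 : ℝ), ENNReal.ofReal (Real.exp (-ρ * t)) * totalLoss η γ a α (u t)
      = 0 := by
    generalize (∫⁻ t in Ici (0 : ℝ), ENNReal.ofReal (Real.exp (-ρ * t))
      * totalLoss η γ a α (u t)) = I at h1
    induction I with
    | top =>
      rw [EReal.coe_ennreal_top, EReal.sub_top] at h1
      exact absurd (le_bot_iff.1 h1) (EReal.coe_ne_bot _)
    | coe r =>
      have e : (((r : ENNReal)) : EReal) = ((r : ℝ) : EReal) := rfl
      rw [e, ← EReal.coe_sub, EReal.coe_le_coe_iff] at h1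
      have h3 : (r : ℝ) = 0 := le_antisymm (by linarith) r.coe_nonneg
      have h4 : r = 0 := by exact_mod_cast h3
      rw [h4]; rfl
  rw [lintegral_eq_zero_iff' (D.aemeasurable_loss_time hu.1)] at h2
  filter_upwards [h2, hu.1.nonneg] with t h3 h4
  rw [Pi.zero_apply, mul_eq_zero] at h3
  refine (D.totalLoss_eq_zero_iff h4).1 (h3.resolve_left ?_)
  simpa using Real.exp_pos (-ρ * t)

end ControlData

/-! ### The parabolic equation for the optimal trajectory. -/

section PDE

variable {σ δ η : Circ → ℝ} (hc : Coeffs σ δ)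

include hc

/-- For a constant control the mild solution is $S(t)x+\int_0^tS(s)\eta v\,ds$. Smoothing makes both
terms differentiable with values in the domain at every $t>0$, for any $x\in X$. -/
lemma solvesPDE_trajectory (v x : X) :
    SolvesPDE σ δ (mulX η v) x
      (trajectory hc.isNonposSelfAdjoint.semigroup η x fun _ => v) := by
  set hG := hc.isNonposSelfAdjoint
  have e : (trajectory hG.semigroup η x fun _ => v) = fun t : ℝ => hG.semigroup t.toNNReal x
      + ∫ s in (0 : ℝ)..t, hG.semigroup s.toNNReal (mulX η v) := by
    ext1 t
    rw [trajectory, hG.mild_const]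
  rw [e]
  refine ⟨?_, ?_, fun t ht => hG.cauchy_solution (mulX η v) x ht⟩
  · refine Continuous.continuousOn ((hG.continuous_semigroup_toNNReal x).add ?_)
    rw [continuous_iff_continuousAt]
    exact fun t => (hG.hasDerivAt_integral_semigroup (mulX η v) t).continuousAt
  · simp [hG.semigroup_zero]

lemma solvesPDE_unique {f x : X} {p q : ℝ → X} (hp : SolvesPDE σ δ f x p)
    (hq : SolvesPDE σ δ f x q) : EqOn p q (Ici 0) :=
  hc.isNonposSelfAdjoint.cauchy_unique hp.1 hq.1 (hp.2.1.trans hq.2.1.symm) hp.2.2 hq.2.2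

end PDE

end Pollution

end

open Pollution

theorem mainTheorem7 (ρ : ℝ) (σ δ η w γ a : Circ → ℝ) (p₀ : X)
    (hρ : 0 < ρ)
    (hσ : CircContDiff 1 σ) (hσ_pos : ∀ θ, 0 < σ θ)
    (hδ : Continuous δ) (hδ_nonneg : ∀ θ, 0 ≤ δ θ)
    (hγ : Measurable γ)
    (hγ_range : ∃ K : Set ℝ, IsCompact K ∧ (K ⊆ Ioo 0 1 ∨ K ⊆ Ioi 1) ∧ ∀ θ, γ θ ∈ K)
    (ha : Measurable a) (ha_one : ∀ θ, 1 < a θ) (ha_bdd : ∃ M, ∀ θ, a θ ≤ M)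
    (hη : Measurable η) (hη_pos : ∀ θ, 0 < η θ) (hη_bdd : ∃ M, ∀ θ, η θ ≤ M)
    (hw : Measurable w) (hw_nonneg : ∀ θ, 0 ≤ w θ) (hw_bdd : ∃ M, ∀ θ, w θ ≤ M)
    (hw_ne : ¬ ∀ᵐ θ, w θ = 0)
    (h_data : MemLp (fun θ => (a θ - 1) ^ ((1 - γ θ) / γ θ) * (η θ) ^ (-1 / γ θ)) 2 volume)
    (hp₀ : 0 ≤ p₀) :
    (∃! S, IsPollutionSemigroup σ δ S) ∧
    (∃! α, SolvesElliptic σ δ ρ w α) ∧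
    ∀ S, IsPollutionSemigroup σ δ S → ∀ α, SolvesElliptic σ δ ρ w α →
      -- the control problem is well posed
      (∀ u, Admissible ρ η u →
        ContinuousOn (trajectory S η p₀ u) (Ici 0) ∧
        (∀ t, 0 ≤ t → 0 ≤ trajectory S η p₀ u t) ∧
        (∀ᵐ t ∂(volume.restrict (Ici (0 : ℝ))),
          HasEIntegral volume (fun θ => crra (γ θ) ((a θ - 1) * u t θ))) ∧
        HasEIntegral (volume.restrict (Ici 0)) (payoff ρ w γ a u (trajectory S η p₀ u))) ∧
      -- the formula for the investment profile makes sense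
      (∀ᵐ θ, 0 < α θ) ∧
      MemLp (optInvestment η γ a α) 2 volume ∧
      -- the time-independent control with this profile is optimal, and the only optimal one
      IsOptimal S ρ η w γ a p₀ (fun _ => toX (optInvestment η γ a α)) ∧
      (∀ u, IsOptimal S ρ η w γ a p₀ u →
        ∀ᵐ t ∂(volume.restrict (Ici (0 : ℝ))), u t = toX (optInvestment η γ a α)) ∧
      -- the optimal trajectory is the solution of the parabolic equation with source `η i*`
      SolvesPDE σ δ (mulX η (toX (optInvestment η γ a α))) p₀
        (trajectory S η p₀ (fun _ => toX (optInvestment η γ a α))) ∧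
      (∀ p, SolvesPDE σ δ (mulX η (toX (optInvestment η γ a α))) p₀ p →
        EqOn p (trajectory S η p₀ (fun _ => toX (optInvestment η γ a α))) (Ici 0)) ∧
      -- the optimal welfare
      (qConst ρ η γ a α ≠ ⊤ ∧ qConst ρ η γ a α ≠ ⊥) ∧
      objective S ρ η w γ a p₀ (fun _ => toX (optInvestment η γ a α)) =
        ((-inner ℝ α p₀ : ℝ) : EReal) + qConst ρ η γ a α ∧
      value S ρ η w γ a p₀ = ((-inner ℝ α p₀ : ℝ) : EReal) + qConst ρ η γ a α := by
  have hc : Coeffs σ δ := ⟨hσ, hσ_pos, hδ, hδ_nonneg⟩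
  have hG := hc.isNonposSelfAdjoint
  refine ⟨⟨hG.semigroup, ⟨hG.isC0Semigroup, hG.isGenerator⟩,
      fun S hS => hG.eq_of_generator hS.1 hS.2⟩,
    ⟨hG.resolvent ρ hρ (toX w), hG.resolvent_spec hρ _, fun α hα => hG.eq_resolvent hρ hα⟩, ?_⟩
  intro S hS α hα
  have hη' := isBddMeas_of_nonneg hη (fun θ => (hη_pos θ).le) hη_bdd
  have D : ControlData ρ σ δ η w γ a α :=
    { ρ_pos := hρ, coeffs := hc, γ_meas := hγ, γ_range := hγ_range, a_meas := ha
      one_lt_a := ha_one, η_bdd := hη', η_pos := hη_pos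
      w_bdd := isBddMeas_of_nonneg hw hw_nonneg hw_bdd, w_nonneg := hw_nonneg, w_ne := hw_ne
      memLp_data := h_data, elliptic := hα }
  -- Uniqueness transfers everything proved for the constructed semigroup to the given one.
  obtain rfl := hG.eq_of_generator hS.1 hS.2
  refine ⟨fun u hu => ⟨D.continuousOn_trajectory hu p₀, fun t ht => D.trajectory_nonneg hu hp₀ ht,
      ?_, D.hasEIntegral_payoff hu p₀⟩, D.α_pos, D.memLp_optInvestment, D.isOptimal_opt p₀,
    fun u hu => D.eq_opt_of_isOptimal hu, solvesPDE_trajectory hc _ p₀,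
    fun p hp => solvesPDE_unique hc hp (solvesPDE_trajectory hc _ p₀), ?_,
    D.objective_opt p₀, D.value_eq p₀⟩
  · filter_upwards [hu.nonneg] with t ht using D.hasEIntegral_crra ht
  · rw [D.qConst_eq]
    exact ⟨EReal.coe_ne_top _, EReal.coe_ne_bot _⟩
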